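/- **Conventions.** For $X=(X_1,\dots,X_g)\in M_n(\mathbb C)^g$ write $X^*=(X_1^*,\dots,X_g^*)$, $\Lambda_A(X)=\sum_j A_j\otimes X_j$, and for $\varepsilon>0$ let $\mathbb B_\varepsilon(n)=\{X\in M_n(\mathbb C)^g:\sum_j X_j^*X_j\prec\varepsilon^2I_n\}$. An nc rational function $r$ in $x=(x_1,\dots,x_g)$ and $x^*$, regular at $0$, is given by a descriptor realization $r(x,x^*)=c^*(J-\Lambda_A(x)-\Lambda_B(x^*))^{-1}b$ with $J\in M_d(\mathbb C)$ invertible, $A,B\in M_d(\mathbb C)^g$, $b,c\in\mathbb C^d$. It is evaluated as $r(X,Y)=(c^*\otimes I_n)(J\otimes I_n-\Lambda_A(X)-\Lambda_B(Y))^{-1}(b\otimes I_n)$, and its domain is the set of $X$ for which $r(X,X^*)$ is defined. Identities between nc rational functions mean equality of values at all $X$ of all sizes for which both sides are defined. The function $r$ is symmetric if $r(X,X^*)^*=r(X,X^*)$ on its domain, and analytic if no $x^*$ occurs ($B=0$). Its complex Hessian is $$r_{x,x^*}(X,X^*)[H,H^*]=\frac{d}{dt}\Big|_{t=0}\frac{d}{ds}\Big|_{s=0}r(X+sH,X^*+tH^*)\qquad(s,t\in\mathbb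 R).$$ A symmetric $r$ is *plush in a neighborhood of $0$* if there is $\varepsilon>0$ such that for all $n$ and $X\in\mathbb B_\varepsilon(n)$, $X$ is in the domain of $r$ and $r_{x,x^*}(X,X^*)[H,H^*]\succeq0$ for all $H\in M_n(\mathbb C)^g$. A symmetric $f$ is *convex in a neighborhood of $0$* if there is $\varepsilon>0$ such that for every $n$ the ball $\mathbb B_\varepsilon(n)$ lies in the domain of $f$, and $F(\frac{X+Y}2)\preceq\frac{F(X)+F(Y)}2$ for all $X,Y\in\mathbb B_\varepsilon(n)$, where $F(X)=f(X,X^*)$. **Theorem.** Let $r$ be a symmetric nc rational function in $g$ variables that is regular at $0$. (1) $r$ is plush in a neighborhood of $0$ if and only if there exist a positive integer $h$, a symmetric nc rational function $f$ in $h$ variables that is regular at $0$ and convex in a neighborhood of $0$, and an analytic nc rational mapping $q=(q_1,\dots,q_h)$ in $g$ variables that is regular at $0$ with $q(0)=0$, such that $r=f\circ q$, that is, $r(X,X^*)=f(q(X),q(X)^*)$. (2) Suppose that $r$ is plush in a neighborhood of $0$. Then $r$ has a symmetric realization $r=c^*(K-\Lambda_B(x)-\Lambda_{B^*}(x^*))^{-1}c$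 with $K=I_a\oplus -I_b$ that is minimal (the vectors $w(B_1K,\dots,B_gK,B_1^*K,\dots,B_g^*K)c$, $w$ a word in $2g$ letters, span $\mathbb C^{a+b}$). For every such realization, choices as follows exist, and every such choice gives a pair $(f,q)$ with all the properties listed in (1) (the number $h$ below may be $0$). Choose contractions $\rho,\rho_*:\mathbb C^a\to\mathbb C^b$ such that $\{u\oplus\rho u\}$ contains the ranges of all $B_j$ and $\{u\oplus\rho_*u\}$ those of all $B_j^*$; a basis $C_1,\dots,C_h$ of the (non-unital) algebra generated by $KB_1,\dots,KB_g$; matrices $\Xi_k\in M_h(\mathbb C)$ with $C_jC_k=\sum_s(\Xi_k)_{j,s}C_s$; and $M\in M_{g\times h}(\mathbb C)$ with $KB_i=\sum_sM_{i,s}C_s$. Let $D=(I-\rho^*\rho)^{1/2}$ and $D_*=(I-\rho_*^*\rho_*)^{1/2}$, let $\dagger$ denote the Moore–Penrose inverse, and put $$\psi=\begin{bmatrix}D^\dagger[\,I_a\ \ \rho^*]\\0\\c^*\\c^*\end{bmatrix},\qquad \psi_*=\Big[\,0\quad\begin{bmatrix}I_a\\\rho_*\end{bmatrix}D_*^\dagger\quad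 c\quad c\,\Big],\qquad A_s=\psi C_sK\psi_*\ \ (1\le s\le h),$$ $J=I_a\oplus I_a\oplus1\oplus-1$ and $v=0\oplus0\oplus\sigma\oplus\tau$ with $\sigma-\tau=1$, $\sigma+\tau=c^*Kc$. Then $$f(y)=v^*(J-\Lambda_A(y)-\Lambda_A(y)^*)^{-1}v,\qquad q(x)=y\,(I-\Lambda_\Xi(y))^{-1}\ \text{ with } y_s=\sum_iM_{i,s}x_i\ \ (1\le s\le h).$$ -/

import Mathlib

open scoped Kronecker Matrix ComplexOrder

/-- The `g`-tuples of `n × n` complex matrices. -/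
abbrev MatTuple (g n : ℕ) : Type := Fin g → Matrix (Fin n) (Fin n) ℂ

/-- The entrywise adjoint `X* = (X₁*, …, X_g*)` of a tuple. -/
def MatTuple.adj {g n : ℕ} (X : MatTuple g n) : MatTuple g n := fun j => (X j)ᴴ

/-- The (column) free ball of radius `ε`, at level `n`: `∑ⱼ Xⱼ* Xⱼ ≺ ε² Iₙ`. -/
def freeBall (g : ℕ) (ε : ℝ) (n : ℕ) : Set (MatTuple g n) :=
  {X | ((ε : ℂ) ^ 2 • (1 : Matrix (Fin n) (Fin n) ℂ) - ∑ j, (X j)ᴴ * X j).PosDef}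

/-- The column `v ⊗ Iₙ`, as a map `ℂⁿ → ℂᵈ ⊗ ℂⁿ`. -/
def colTensor {ι : Type} (v : ι → ℂ) (n : ℕ) : Matrix (ι × Fin n) (Fin n) ℂ :=
  Matrix.of fun p l => v p.1 * (1 : Matrix (Fin n) (Fin n) ℂ) p.2 l

/-- A descriptor realization `r(x, x*) = c* (J - Λ_A(x) - Λ_B(x*))⁻¹ b`, with `J` invertible,
of an nc rational function in `g` variables (and their adjoints) that is regular at `0`.
The index type `ι` plays the role of `{1, …, d}`. -/
structure DescriptorRealization (g : ℕ) where
  ι : Type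
  [fintypeIndex : Fintype ι]
  [decEqIndex : DecidableEq ι]
  J : Matrix ι ι ℂ
  A : Fin g → Matrix ι ι ℂ
  B : Fin g → Matrix ι ι ℂ
  b : ι → ℂ
  c : ι → ℂ
  isUnit_J : IsUnit J

attribute [instance] DescriptorRealization.fintypeIndex DescriptorRealization.decEqIndex

namespace DescriptorRealization

variable {g n : ℕ}

/-- `J ⊗ I - Λ_A(X) - Λ_B(Y)`, where `Y` is substituted for the variables `x*`. -/
def pencil (r : DescriptorRealization g) (X Y : MatTuple g n) :
    Matrix (r.ι × Fin n) (r.ι × Fin n) ℂ :=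
  r.J ⊗ₖ (1 : Matrix (Fin n) (Fin n) ℂ) - ∑ j, r.A j ⊗ₖ X j - ∑ j, r.B j ⊗ₖ Y j

/-- `r(X, Y)`, the value with `X` substituted for `x` and, independently, `Y` for `x*`. -/
noncomputable def evalPair (r : DescriptorRealization g) (X Y : MatTuple g n) :
    Matrix (Fin n) (Fin n) ℂ :=
  (colTensor r.c n)ᴴ * (r.pencil X Y)⁻¹ * colTensor r.b n

/-- The domain of `r` at level `n`. -/
def dom (r : DescriptorRealization g) (n : ℕ) : Set (MatTuple g n) :=
  {X | IsUnit (r.pencil X X.adj)}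

/-- The value `r(X, X*)`; meaningful for `X ∈ r.dom n`. -/
noncomputable def eval (r : DescriptorRealization g) (X : MatTuple g n) :
    Matrix (Fin n) (Fin n) ℂ :=
  r.evalPair X X.adj

/-- Two realizations are equivalent (define the same nc rational function) if they agree on the
intersection of their domains. -/
def Equivalent (r s : DescriptorRealization g) : Prop :=
  ∀ (n : ℕ) (X : MatTuple g n), X ∈ r.dom n → X ∈ s.dom n → r.eval X = s.eval X

/-- `r = r*`. -/
def IsSymmetric (r : DescriptorRealization g) : Prop :=
  ∀ (n : ℕ) (X : MatTuple g n), X ∈ r.dom n → (r.eval X)ᴴ = r.eval X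

/-- No `x*` variables occur. -/
def IsAnalytic (r : DescriptorRealization g) : Prop := ∀ j, r.B j = 0

/-- The complex Hessian `r_{x,x*}(X, X*)[H, H*]`: first differentiate
`s ↦ r(X + sH, ·)` at `s = 0`, then `t ↦ r(·, (X + tH)*)` at `t = 0`
(derivatives of matrix functions being taken entrywise). -/
noncomputable def complexHessian (r : DescriptorRealization g) (X H : MatTuple g n) :
    Matrix (Fin n) (Fin n) ℂ :=
  Matrix.of fun k l =>
    deriv (fun t : ℝ => deriv (fun s : ℝ => r.evalPair (X + s • H) (X + t • H).adj k l) 0) 0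

/-- `r` is plush in a neighborhood of `0`: its complex Hessian is positive semidefinite
on some free ball, at all levels and in all directions. -/
def IsPlushNearZero (r : DescriptorRealization g) : Prop :=
  ∃ ε : ℝ, 0 < ε ∧ ∀ (n : ℕ), ∀ X ∈ freeBall g ε n,
    X ∈ r.dom n ∧ ∀ H : MatTuple g n, (r.complexHessian X H).PosSemidef

/-- `r` is (matrix) convex in a neighborhood of `0`: on some free ball,
`r((X+Y)/2) ⪯ (r(X) + r(Y))/2`. -/
def IsConvexNearZero (r : DescriptorRealization g) : Prop :=
  ∃ ε : ℝ, 0 < ε ∧ ∀ (n : ℕ), freeBall g ε n ⊆ r.dom n ∧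
    ∀ X ∈ freeBall g ε n, ∀ Y ∈ freeBall g ε n,
      ((1 / 2 : ℂ) • (r.eval X + r.eval Y) - r.eval ((1 / 2 : ℂ) • (X + Y))).PosSemidef

/-- The value `q(X) = (q₁(X), …, q_h(X))` of a tuple of nc rational functions. -/
noncomputable def evalMap {h : ℕ} (q : Fin h → DescriptorRealization g) (X : MatTuple g n) :
    MatTuple h n :=
  fun s => (q s).eval X

/-- `r = f ∘ q` as nc rational functions: `r(X, X*) = f(q(X), q(X)*)` whenever `X` lies in the
domains of `r` and of `q`, and `q(X)` in the domain of `f`. -/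
def IsComposite {h : ℕ} (r : DescriptorRealization g) (f : DescriptorRealization h)
    (q : Fin h → DescriptorRealization g) : Prop :=
  ∀ (n : ℕ) (X : MatTuple g n), X ∈ r.dom n → (∀ s, X ∈ (q s).dom n) →
    evalMap q X ∈ f.dom n → r.eval X = f.eval (evalMap q X)

/-- `r = f ∘ q`, where `f` is a symmetric nc rational function that is convex in a neighborhood of
`0` and `q` is an analytic nc rational mapping, regular at `0`, with `q(0) = 0`. -/
structure IsConvexAnalyticComposite {h : ℕ} (r : DescriptorRealization g)
    (f : DescriptorRealization h) (q : Fin h → DescriptorRealization g) : Prop where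
  symmetric : f.IsSymmetric
  convex : f.IsConvexNearZero
  analytic : ∀ s, (q s).IsAnalytic
  map_zero : ∀ n : ℕ, evalMap q (0 : MatTuple g n) = 0
  comp : r.IsComposite f q

end DescriptorRealization

/-- The signature matrix `K = I_a ⊕ -I_b`. -/
def signatureMatrix (a b : ℕ) : Matrix (Fin a ⊕ Fin b) (Fin a ⊕ Fin b) ℂ :=
  Matrix.fromBlocks 1 0 0 (-1)

theorem signatureMatrix_mul_self (a b : ℕ) : signatureMatrix a b * signatureMatrix a b = 1 := by
  simp [signatureMatrix, Matrix.fromBlocks_multiply]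

/-- A symmetric descriptor realization `c* (K - Λ_B(x) - Λ_{B*}(x*))⁻¹ c` whose signature matrix
is in the diagonal form `K = I_a ⊕ -I_b`. -/
structure SymmetricRealization (g : ℕ) where
  a : ℕ
  b : ℕ
  B : Fin g → Matrix (Fin a ⊕ Fin b) (Fin a ⊕ Fin b) ℂ
  c : Fin a ⊕ Fin b → ℂ

namespace SymmetricRealization

variable {g : ℕ}

/-- The signature matrix of the realization. -/
def K (m : SymmetricRealization g) : Matrix (Fin m.a ⊕ Fin m.b) (Fin m.a ⊕ Fin m.b) ℂ :=
  signatureMatrix m.a m.b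

def toDescriptor (m : SymmetricRealization g) : DescriptorRealization g where
  ι := Fin m.a ⊕ Fin m.b
  J := m.K
  A := m.B
  B := fun j => (m.B j)ᴴ
  b := m.c
  c := m.c
  isUnit_J := IsUnit.of_mul_eq_one _ (signatureMatrix_mul_self m.a m.b)

/-- Minimality: the vectors `w(B₁K, …, B_gK, B₁*K, …, B_g*K) c`, `w` a word in `2g` letters,
span the state space. -/
def IsMinimal (m : SymmetricRealization g) : Prop :=
  Submodule.span ℂ (Set.range fun w : List (Fin g ⊕ Fin g) =>
    (w.map (Sum.elim (fun j => m.B j * m.K) (fun j => (m.B j)ᴴ * m.K))).prod *ᵥ m.c) = ⊤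

end SymmetricRealization

/-- `E` is the Moore-Penrose pseudoinverse of `D`. -/
structure IsMoorePenroseInverse {a : ℕ} (D E : Matrix (Fin a) (Fin a) ℂ) : Prop where
  mul_mul_left : D * E * D = D
  mul_mul_right : E * D * E = E
  hermitian_left : (D * E)ᴴ = D * E
  hermitian_right : (E * D)ᴴ = E * D

/-- A contraction `ρ : ℂᵃ → ℂᵇ`, the angular operator of the maximal `K`-nonnegative subspace
`{u ⊕ ρu}`, together with the positive square root `D` of `I - ρ*ρ` and its pseudoinverse. -/
structure AngularOperator (a b : ℕ) where
  ρ : Matrix (Fin b) (Fin a) ℂ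
  D : Matrix (Fin a) (Fin a) ℂ
  Dinv : Matrix (Fin a) (Fin a) ℂ
  contraction : (1 - ρᴴ * ρ).PosSemidef
  posSemidef_D : D.PosSemidef
  sq_D : D * D = 1 - ρᴴ * ρ
  pinv_D : IsMoorePenroseInverse D Dinv

namespace AngularOperator

variable {a b : ℕ}

/-- The column `[I; ρ]`. -/
def col (P : AngularOperator a b) : Matrix (Fin a ⊕ Fin b) (Fin a) ℂ :=
  Matrix.fromRows 1 P.ρ

/-- The subspace `{u ⊕ ρu}` contains the range of `E`. -/
def ContainsRange (P : AngularOperator a b) (E : Matrix (Fin a ⊕ Fin b) (Fin a ⊕ Fin b) ℂ) :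
    Prop :=
  LinearMap.range E.mulVecLin ≤ LinearMap.range P.col.mulVecLin

end AngularOperator

/-- The choices entering the construction of `f` and `q` from a symmetric realization `m`. -/
structure ConstructionData {g : ℕ} (m : SymmetricRealization g) where
  /-- angular operator of a maximal nonnegative subspace containing the ranges of the `Bⱼ` -/
  P : AngularOperator m.a m.b
  /-- angular operator of a maximal nonnegative subspace containing the ranges of the `Bⱼ*` -/
  Ps : AngularOperator m.a m.b
  range_le : ∀ j, P.ContainsRange (m.B j)
  range_le_adj : ∀ j, Ps.ContainsRange (m.B j)ᴴ
  /-- number of intermediate variables -/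
  h : ℕ
  /-- a basis of the (non-unital) algebra generated by `KB₁, …, KB_g` -/
  C : Fin h → Matrix (Fin m.a ⊕ Fin m.b) (Fin m.a ⊕ Fin m.b) ℂ
  linearIndependent_C : LinearIndependent ℂ C
  span_C : Submodule.span ℂ (Set.range C) =
    (NonUnitalAlgebra.adjoin ℂ (Set.range fun j => m.K * m.B j)).toSubmodule
  /-- the structure constants `Cⱼ Cₖ = ∑ₛ (Ξₖ)ⱼₛ Cₛ` -/
  Ξ : Fin h → Matrix (Fin h) (Fin h) ℂ
  mul_C : ∀ j k, C j * C k = ∑ s, Ξ k j s • C s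
  /-- the coordinates `KBᵢ = ∑ₛ Mᵢₛ Cₛ` -/
  M : Matrix (Fin g) (Fin h) ℂ
  coord : ∀ i, m.K * m.B i = ∑ s, M i s • C s

namespace ConstructionData

variable {g : ℕ} {m : SymmetricRealization g}

/-- The state space `ℂᵃ ⊕ ℂᵃ ⊕ ℂ ⊕ ℂ` of `f`. -/
abbrev StateIndex (m : SymmetricRealization g) : Type :=
  (Fin m.a ⊕ Fin m.a) ⊕ (Fin 1 ⊕ Fin 1)

/-- `J = I_a ⊕ I_a ⊕ 1 ⊕ -1`. -/
def J (m : SymmetricRealization g) : Matrix (StateIndex m) (StateIndex m) ℂ :=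
  Matrix.fromBlocks 1 0 0 (Matrix.fromBlocks 1 0 0 (-1))

theorem J_mul_self (m : SymmetricRealization g) : J m * J m = 1 := by
  simp [J, Matrix.fromBlocks_multiply]

/-- `ψ`, with block rows `D† [I ρ*]`, `0`, `c*`, `c*`. -/
def ψ (δ : ConstructionData m) : Matrix (StateIndex m) (Fin m.a ⊕ Fin m.b) ℂ :=
  Matrix.fromRows (Matrix.fromRows (δ.P.Dinv * δ.P.colᴴ) 0)
    (Matrix.fromRows (Matrix.of fun _ k => star (m.c k)) (Matrix.of fun _ k => star (m.c k)))

/-- `ψ_*`, with block columns `0`, `[I; ρ_*] D_*†`, `c`, `c`. -/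
def ψs (δ : ConstructionData m) : Matrix (Fin m.a ⊕ Fin m.b) (StateIndex m) ℂ :=
  Matrix.fromCols (Matrix.fromCols 0 (δ.Ps.col * δ.Ps.Dinv))
    (Matrix.fromCols (Matrix.of fun k _ => m.c k) (Matrix.of fun k _ => m.c k))

/-- The vector `v = 0 ⊕ 0 ⊕ s ⊕ t` with `s - t = 1` and `s + t = c*Kc`. -/
noncomputable def v (m : SymmetricRealization g) : StateIndex m → ℂ :=
  Sum.elim 0 (Sum.elim (fun _ => (star m.c ⬝ᵥ (m.K *ᵥ m.c) + 1) / 2)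
    (fun _ => (star m.c ⬝ᵥ (m.K *ᵥ m.c) - 1) / 2))

/-- `A_s = ψ C_s K ψ_*`. -/
def A (δ : ConstructionData m) (s : Fin δ.h) : Matrix (StateIndex m) (StateIndex m) ℂ :=
  δ.ψ * δ.C s * m.K * δ.ψs

/-- The function `f(y) = v* (J - Λ_A(y) - Λ_A(y)*)⁻¹ v`. -/
noncomputable def f (δ : ConstructionData m) : DescriptorRealization δ.h where
  ι := StateIndex m
  J := J m
  A := δ.A
  B := fun s => (δ.A s)ᴴ
  b := v m
  c := v m
  isUnit_J := IsUnit.of_mul_eq_one _ (J_mul_self m)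

/-- The mapping `q(x) = y (I - Λ_Ξ(y))⁻¹`, where `y_s = ∑ᵢ Mᵢₛ xᵢ`, is the convexotonic map of `Ξ`
after a linear substitution. Its component `q_s` is the `(0, s)` entry of the inverse of
`[1, -y; 0, I - Λ_Ξ(y)]`. -/
def q (δ : ConstructionData m) (s : Fin δ.h) : DescriptorRealization g where
  ι := Fin 1 ⊕ Fin δ.h
  J := 1
  A := fun i => Matrix.fromBlocks 0 (Matrix.of fun _ k => δ.M i k) 0 (∑ k, δ.M i k • δ.Ξ k)
  B := 0
  b := Pi.single (Sum.inr s) 1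
  c := Pi.single (Sum.inl 0) 1
  isUnit_J := isUnit_one

end ConstructionData

/-!
The proof works with states. A realization `c* (J - Λ_A(x) - Λ_B(x*))⁻¹ b` is evaluated by solving
a linear system, and all comparisons below are comparisons of solutions of such systems; the norm
bounds involved depend on the coefficients only, never on the size `n` of the matrices.

*Composites are plush.* The average of `r` over the four points `X ± εH`, `X ± iεH` equals
`r(X) + ε² r_{x,x*}(X, X*)[H, H*] + o(ε²)` (`tendsto_quarterAverage_eval`). For an analytic `q` the
second term is absent, so the four points `q(X ± εH)`, `q(X ± iεH)` have mean `q(X) + o(ε²)`, and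
the convexity of `f` makes the Hessian of `f ∘ q` positive semidefinite
(`IsConvexAnalyticComposite.isPlushNearZero`).

*Minimal symmetric realizations.* The direct sum of `r / 2` and `r* / 2`, with the off-diagonal
Hermitian pairing, is a realization whose pencil is Hermitian. Restricting it to its reachable
subspace, dividing by the degenerate part of the form and applying Sylvester's law of inertia give
a minimal realization with `K = I_a ⊕ -I_b` (`IsSymmetric.exists_isMinimal`).

*Plush functions have nonnegative ranges.* The Hessian of a symmetric realization is a sum of the
form `K` evaluated at a `B`-combination and at a `B*`-combination of a state. In a minimal
realization there are, at arbitrarily small `X`, states whose slices span the whole state space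
(`exists_slices_eq_top`): a state with the most slices has them invariant under all coefficients,
since otherwise a small bordering of `X` would create one more. Adding one dimension and letting
`H` act between the old dimensions and the new one makes both combinations arbitrary, so the sum of
the ranges of the `Bⱼ` and that of the ranges of the `Bⱼ*` are `K`-nonnegative
(`nonneg_of_isPlushNearZero`). A nonnegative subspace is contained in the graph of a contraction
(`exists_angularOperator`), so the choices entering the construction can be made
(`nonempty_constructionData`).

*Every choice gives a factorization.* Let `Q = Λ_C(q(X))`. The structure constants of the algebra
make `q` convexotonic: `(1 + Q)(1 - Λ_{KB}(X)) = 1` (`one_add_mul_one_sub`). Multiplication by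
`1 + Q*` and `1 + Q` turns the pencil `K - Λ_B(X) - Λ_B(X)*` into `K - Q* K Q`. The
ranges of `KQ` and of `Q*` lie in the graphs of `ρ` and `ρ_*`, so `Q* K Q` and `Q K Q*` are Gram
matrices with factors `D† [I ρ*] Q` and `Q K [I; ρ_*] D_*†`, of which the coefficients of `f` are
made (`butterflyBlocks`). Solving the system of `f` in these terms gives the value of `r`
(`mem_dom_and_eval_eq`). On the other hand the pencil of `f` involves the neutral vector
`0 ⊕ 0 ⊕ 1 ⊕ 1`, and eliminating it writes `f` as an affine function plus `L* (1 - T)⁻¹ L` with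
affine `L` and `T = T*`. This expression is jointly convex in `(L, T)` as long as `T ≺ 1`, so `f` is
convex near `0` (`isConvexNearZero_f`).

If the algebra is zero, then `h = 0`; a variable on which `f` does not depend is then added
(`IsConvexAnalyticComposite.exists_pos`).
-/

open scoped Kronecker Matrix ComplexOrder

/-! ### Tensor evaluations and norm bounds that are uniform in the size of the matrices -/

/-- `Λ_A(X) = ∑ⱼ Aⱼ ⊗ Xⱼ`, for possibly rectangular coefficients `Aⱼ` and for matrices `Xⱼ`
indexed by an arbitrary type. -/
def tensorEval {g : ℕ} {κ ι N : Type*} (A : Fin g → Matrix κ ι ℂ) (X : Fin g → Matrix N N ℂ) :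
    Matrix (κ × N) (ι × N) ℂ :=
  ∑ j, A j ⊗ₖ X j

section TensorEval

variable {g : ℕ} {κ ι ι' N : Type*}

theorem kronecker_one_mul_tensorEval [Fintype ι] [Fintype N] [DecidableEq N]
    (S : Matrix κ ι ℂ) (A : Fin g → Matrix ι ι' ℂ) (X : Fin g → Matrix N N ℂ) :
    (S ⊗ₖ (1 : Matrix N N ℂ)) * tensorEval A X = tensorEval (fun j => S * A j) X := by
  simp [tensorEval, Matrix.mul_sum, ← Matrix.mul_kronecker_mul]

theorem tensorEval_mul_kronecker_one [Fintype ι] [Fintype N] [DecidableEq N]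
    (S : Matrix ι ι' ℂ) (A : Fin g → Matrix κ ι ℂ) (X : Fin g → Matrix N N ℂ) :
    tensorEval A X * (S ⊗ₖ (1 : Matrix N N ℂ)) = tensorEval (fun j => A j * S) X := by
  simp [tensorEval, Matrix.sum_mul, ← Matrix.mul_kronecker_mul]

theorem conjTranspose_tensorEval (A : Fin g → Matrix κ ι ℂ) (X : Fin g → Matrix N N ℂ) :
    (tensorEval A X)ᴴ = tensorEval (fun j => (A j)ᴴ) (fun j => (X j)ᴴ) := by
  simp [tensorEval, Matrix.conjTranspose_sum, Matrix.conjTranspose_kronecker]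

theorem tensorEval_add (A : Fin g → Matrix κ ι ℂ) (X Y : Fin g → Matrix N N ℂ) :
    tensorEval A (X + Y) = tensorEval A X + tensorEval A Y := by
  simp [tensorEval, Matrix.kronecker_add, Finset.sum_add_distrib]

theorem tensorEval_smul (A : Fin g → Matrix κ ι ℂ) (z : ℂ) (X : Fin g → Matrix N N ℂ) :
    tensorEval A (z • X) = z • tensorEval A X := by
  simp [tensorEval, Matrix.kronecker_smul, Finset.smul_sum]

theorem tensorEval_zero (A : Fin g → Matrix κ ι ℂ) :
    tensorEval A (0 : Fin g → Matrix N N ℂ) = 0 := by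
  simp [tensorEval]

end TensorEval

section Norms

open scoped Matrix.Norms.L2Operator MatrixOrder

variable {ι N : Type*} [Fintype ι] [DecidableEq ι] [Fintype N] [DecidableEq N]

/-- Tensoring with an identity matrix is a star homomorphism, hence contractive. -/
theorem norm_kronecker_one_le (A : Matrix ι ι ℂ) : ‖A ⊗ₖ (1 : Matrix N N ℂ)‖ ≤ ‖A‖ := by
  let φ : Matrix ι ι ℂ →⋆ₙₐ[ℂ] Matrix (ι × N) (ι × N) ℂ :=
    { toFun := fun A => A ⊗ₖ (1 : Matrix N N ℂ)
      map_smul' := fun z A => by simp [Matrix.smul_kronecker]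
      map_zero' := by simp
      map_add' := fun A B => by simp [Matrix.add_kronecker]
      map_mul' := fun A B => by simp [← Matrix.mul_kronecker_mul]
      map_star' := fun A => by
        simp [Matrix.star_eq_conjTranspose, Matrix.conjTranspose_kronecker] }
  exact NonUnitalStarAlgHom.norm_apply_le φ A

theorem norm_one_kronecker_le (X : Matrix N N ℂ) : ‖(1 : Matrix ι ι ℂ) ⊗ₖ X‖ ≤ ‖X‖ := by
  let φ : Matrix N N ℂ →⋆ₙₐ[ℂ] Matrix (ι × N) (ι × N) ℂ :=
    { toFun := fun X => (1 : Matrix ι ι ℂ) ⊗ₖ X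
      map_smul' := fun z A => by simp [Matrix.kronecker_smul]
      map_zero' := by simp
      map_add' := fun A B => by simp [Matrix.kronecker_add]
      map_mul' := fun A B => by simp [← Matrix.mul_kronecker_mul]
      map_star' := fun A => by
        simp [Matrix.star_eq_conjTranspose, Matrix.conjTranspose_kronecker] }
  exact NonUnitalStarAlgHom.norm_apply_le φ X

theorem norm_kronecker_le (A : Matrix ι ι ℂ) (X : Matrix N N ℂ) : ‖A ⊗ₖ X‖ ≤ ‖A‖ * ‖X‖ := by
  have h : A ⊗ₖ X = (A ⊗ₖ (1 : Matrix N N ℂ)) * ((1 : Matrix ι ι ℂ) ⊗ₖ X) := by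
    simp [← Matrix.mul_kronecker_mul]
  rw [h]
  exact (norm_mul_le _ _).trans
    (mul_le_mul (norm_kronecker_one_le A) (norm_one_kronecker_le X) (norm_nonneg _) (norm_nonneg _))

theorem norm_tensorEval_le {g : ℕ} (A : Fin g → Matrix ι ι ℂ) (X : Fin g → Matrix N N ℂ) {δ : ℝ}
    (hX : ∀ j, ‖X j‖ ≤ δ) : ‖tensorEval A X‖ ≤ (∑ j, ‖A j‖) * δ := by
  rw [Finset.sum_mul]
  refine (norm_sum_le _ _).trans (Finset.sum_le_sum fun j _ => ?_)
  exact (norm_kronecker_le _ _).trans (mul_le_mul_of_nonneg_left (hX j) (norm_nonneg _))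

theorem norm_one_matrix_le : ‖(1 : Matrix N N ℂ)‖ ≤ 1 := by
  cases subsingleton_or_nontrivial (Matrix N N ℂ) with
  | inl h => simp [Subsingleton.elim (1 : Matrix N N ℂ) 0]
  | inr h => exact CStarRing.norm_one.le

theorem conjTranspose_colTensor_mul_colTensor {ι : Type} [Fintype ι] (u v : ι → ℂ)
    (n : ℕ) : (colTensor u n)ᴴ * colTensor v n = (star u ⬝ᵥ v) • 1 := by
  ext k l
  by_cases hkl : k = l
  · subst hkl
    simp [colTensor, Matrix.mul_apply, Fintype.sum_prod_type, Matrix.one_apply, dotProduct]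
  · simp [colTensor, Matrix.mul_apply, Fintype.sum_prod_type, Matrix.one_apply, dotProduct, hkl,
      Ne.symm hkl]

theorem exists_norm_colTensor_le {ι : Type} [Fintype ι] [DecidableEq ι] (v : ι → ℂ) :
    ∃ C : ℝ, 0 ≤ C ∧ ∀ n : ℕ, ‖colTensor v n‖ ≤ C ∧ ‖(colTensor v n)ᴴ‖ ≤ C := by
  refine ⟨Real.sqrt ‖star v ⬝ᵥ v‖, Real.sqrt_nonneg _, fun n => ?_⟩
  have h : ‖colTensor v n‖ ≤ Real.sqrt ‖star v ⬝ᵥ v‖ := by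
    refine Real.le_sqrt_of_sq_le ?_
    rw [sq, ← Matrix.l2_opNorm_conjTranspose_mul_self, conjTranspose_colTensor_mul_colTensor,
      norm_smul]
    exact mul_le_of_le_one_right (norm_nonneg _) norm_one_matrix_le
  exact ⟨h, by rwa [Matrix.l2_opNorm_conjTranspose]⟩

/-- The free ball lies in the polydisc of the same radius. -/
theorem norm_le_of_mem_freeBall {g n : ℕ} {ε : ℝ} (hε : 0 < ε) {X : MatTuple g n}
    (hX : X ∈ freeBall g ε n) (j : Fin g) : ‖X j‖ ≤ ε := by
  have h1 : (X j)ᴴ * X j ≤ ∑ i, (X i)ᴴ * X i :=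
    Finset.single_le_sum (f := fun i => (X i)ᴴ * X i)
      (fun i _ => Matrix.nonneg_iff_posSemidef.2 (Matrix.posSemidef_conjTranspose_mul_self _))
      (Finset.mem_univ j)
  have h2 : ∑ i, (X i)ᴴ * X i ≤ (ε : ℂ) ^ 2 • (1 : Matrix (Fin n) (Fin n) ℂ) :=
    Matrix.le_iff.2 (Matrix.PosDef.posSemidef hX)
  have h3 : ‖(X j)ᴴ * X j‖ ≤ ε ^ 2 := by
    refine (CStarAlgebra.norm_le_iff_le_algebraMap _ (by positivity)
      (Matrix.nonneg_iff_posSemidef.2 (Matrix.posSemidef_conjTranspose_mul_self _))).2 ?_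
    refine (h1.trans h2).trans (le_of_eq ?_)
    rw [Algebra.algebraMap_eq_smul_one]
    ext k l
    simp [Matrix.smul_apply]
  rw [Matrix.l2_opNorm_conjTranspose_mul_self, ← sq] at h3
  exact (sq_le_sq₀ (norm_nonneg _) hε.le).1 h3

theorem posDef_one_sub_of_norm_lt_one {T : Matrix N N ℂ} (hT : T.IsHermitian) (h : ‖T‖ < 1) :
    (1 - T).PosDef := by
  have h1 : T ≤ algebraMap ℝ _ ‖T‖ := IsSelfAdjoint.le_algebraMap_norm_self (a := T) hT
  have h2 : (1 - T) = (algebraMap ℝ (Matrix N N ℂ) ‖T‖ - T) + (((1 - ‖T‖ : ℝ) : ℂ)) • 1 := by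
    ext i k
    by_cases hik : i = k <;> simp [Matrix.algebraMap_eq_diagonal, hik]
  rw [h2]
  refine Matrix.PosDef.posSemidef_add (Matrix.le_iff.1 h1) (Matrix.PosDef.one.smul ?_)
  exact_mod_cast sub_pos.2 h

/-- The free ball contains a polydisc, of a radius that does not depend on the size `n`. -/
theorem mem_freeBall_of_norm {g : ℕ} {ε : ℝ} (hε : 0 < ε) :
    ∃ δ : ℝ, 0 < δ ∧ ∀ (n : ℕ) (X : MatTuple g n), (∀ j, ‖X j‖ ≤ δ) → X ∈ freeBall g ε n := by
  refine ⟨ε / (g + 1), by positivity, fun n X hX => ?_⟩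
  have hg : (0 : ℝ) < g + 1 := by positivity
  have h1 : ‖∑ j, (((ε⁻¹ : ℝ) : ℂ) • X j)ᴴ * (((ε⁻¹ : ℝ) : ℂ) • X j)‖ < 1 := by
    refine (norm_sum_le _ _).trans_lt ?_
    have h2 : ∀ j ∈ (Finset.univ : Finset (Fin g)),
        ‖(((ε⁻¹ : ℝ) : ℂ) • X j)ᴴ * (((ε⁻¹ : ℝ) : ℂ) • X j)‖ ≤ (1 / (g + 1) : ℝ) ^ 2 := by
      intro j _
      rw [Matrix.l2_opNorm_conjTranspose_mul_self, norm_smul, Complex.norm_real,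
        Real.norm_of_nonneg (by positivity), ← sq]
      refine pow_le_pow_left₀ (by positivity) ?_ 2
      calc ε⁻¹ * ‖X j‖ ≤ ε⁻¹ * (ε / (g + 1)) := by
            exact mul_le_mul_of_nonneg_left (hX j) (by positivity)
        _ = 1 / (g + 1) := by field_simp
    refine (Finset.sum_le_sum h2).trans_lt ?_
    simp only [Finset.sum_const, Finset.card_univ, Fintype.card_fin, nsmul_eq_mul]
    rw [div_pow, one_pow, mul_one_div, div_lt_one (by positivity)]
    have : (0 : ℝ) ≤ g := Nat.cast_nonneg g
    nlinarith
  have h3 : (∑ j, (((ε⁻¹ : ℝ) : ℂ) • X j)ᴴ * (((ε⁻¹ : ℝ) : ℂ) • X j)).IsHermitian := by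
    refine isSelfAdjoint_sum _ fun j _ => ?_
    exact Matrix.isHermitian_conjTranspose_mul_self _
  have h4 := posDef_one_sub_of_norm_lt_one h3 h1
  have h5 := h4.smul (show (0 : ℂ) < (ε : ℂ) ^ 2 by exact_mod_cast pow_pos hε 2)
  have hε' : (ε : ℂ) ≠ 0 := by exact_mod_cast hε.ne'
  have h6 : (ε : ℂ) ^ 2 • (1 - ∑ j, (((ε⁻¹ : ℝ) : ℂ) • X j)ᴴ * (((ε⁻¹ : ℝ) : ℂ) • X j)) =
      (ε : ℂ) ^ 2 • (1 : Matrix (Fin n) (Fin n) ℂ) - ∑ j, (X j)ᴴ * X j := by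
    rw [smul_sub, Finset.smul_sum]
    congr 1
    refine Finset.sum_congr rfl fun j _ => ?_
    simp only [Matrix.conjTranspose_smul, Matrix.smul_mul, Matrix.mul_smul, smul_smul]
    simp only [Complex.ofReal_inv, star_inv₀, Complex.star_def, Complex.conj_ofReal]
    rw [show (ε : ℂ) ^ 2 * ((ε : ℂ)⁻¹ * (ε : ℂ)⁻¹) = 1 by field_simp, one_smul]
  rw [h6] at h5
  exact h5

end Norms

namespace DescriptorRealization

variable {g n : ℕ}

theorem pencil_eq (r : DescriptorRealization g) (X Y : MatTuple g n) :
    r.pencil X Y = r.J ⊗ₖ (1 : Matrix (Fin n) (Fin n) ℂ) - tensorEval r.A X - tensorEval r.B Y :=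
  rfl

open scoped Matrix.Norms.L2Operator

/-- The resolvent identity behind all perturbation arguments. -/
theorem _root_.Matrix.inv_sub_inv_eq {N : Type*} [Fintype N] [DecidableEq N]
    {P Q : Matrix N N ℂ} (hP : IsUnit P) (hQ : IsUnit Q) : P⁻¹ - Q⁻¹ = P⁻¹ * (Q - P) * Q⁻¹ := by
  have h1 : P⁻¹ * P = 1 := Matrix.nonsing_inv_mul _ ((Matrix.isUnit_iff_isUnit_det _).1 hP)
  have h2 : Q * Q⁻¹ = 1 := Matrix.mul_nonsing_inv _ ((Matrix.isUnit_iff_isUnit_det _).1 hQ)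
  rw [Matrix.mul_sub, Matrix.sub_mul, Matrix.mul_assoc, h2, h1, Matrix.mul_one, Matrix.one_mul]

/-- If `G` inverts `J₀` and `GE` is a strict contraction, then `J₀ - E` is invertible, and its
inverse is bounded. -/
theorem _root_.Matrix.isUnit_sub_of_norm_le_half {N : Type*} [Fintype N] [DecidableEq N]
    {J₀ G E : Matrix N N ℂ} (hGJ : G * J₀ = 1) (hGE : ‖G * E‖ ≤ 1 / 2) :
    IsUnit (J₀ - E) ∧ ‖(J₀ - E)⁻¹‖ ≤ 2 * ‖G‖ := by
  have h2 : G * (J₀ - E) = 1 - G * E := by rw [Matrix.mul_sub, hGJ]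
  have hu : IsUnit (1 - G * E) := isUnit_one_sub_of_norm_lt_one (hGE.trans_lt (by norm_num))
  have hPu : IsUnit (J₀ - E) := by
    rw [← h2, Matrix.isUnit_iff_isUnit_det, Matrix.det_mul] at hu
    exact (Matrix.isUnit_iff_isUnit_det _).2 (isUnit_of_mul_isUnit_right hu)
  refine ⟨hPu, ?_⟩
  have h1 : (J₀ - E) * (J₀ - E)⁻¹ = 1 :=
    Matrix.mul_nonsing_inv _ ((Matrix.isUnit_iff_isUnit_det _).1 hPu)
  have hR : (J₀ - E)⁻¹ = G + G * E * (J₀ - E)⁻¹ := by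
    have h3 : G * ((J₀ - E) * (J₀ - E)⁻¹) = G := by rw [h1, Matrix.mul_one]
    rw [← Matrix.mul_assoc, h2, Matrix.sub_mul, Matrix.one_mul] at h3
    exact eq_add_of_sub_eq h3
  have h5 : ‖(J₀ - E)⁻¹‖ ≤ ‖G‖ + 1 / 2 * ‖(J₀ - E)⁻¹‖ := by
    calc ‖(J₀ - E)⁻¹‖ = ‖G + G * E * (J₀ - E)⁻¹‖ := by rw [← hR]
      _ ≤ ‖G‖ + ‖G * E‖ * ‖(J₀ - E)⁻¹‖ :=
        (norm_add_le _ _).trans (add_le_add le_rfl (norm_mul_le _ _))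
      _ ≤ _ := add_le_add le_rfl (mul_le_mul_of_nonneg_right hGE (norm_nonneg _))
  linarith

/-- Near `0` the pencil is invertible, and its inverse is bounded, uniformly in the size. -/
theorem exists_isUnit_pencil (r : DescriptorRealization g) :
    ∃ δ C : ℝ, 0 < δ ∧ 0 ≤ C ∧ ∀ (n : ℕ) (X Y : MatTuple g n), (∀ j, ‖X j‖ ≤ δ) →
      (∀ j, ‖Y j‖ ≤ δ) → IsUnit (r.pencil X Y) ∧ ‖(r.pencil X Y)⁻¹‖ ≤ C := by
  obtain ⟨a, ha⟩ : ∃ a : ℝ, a = ‖r.J⁻¹‖ := ⟨_, rfl⟩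
  obtain ⟨s, hs⟩ : ∃ s : ℝ, s = ∑ j, ‖r.A j‖ + ∑ j, ‖r.B j‖ := ⟨_, rfl⟩
  have ha0 : 0 ≤ a := by rw [ha]; exact norm_nonneg _
  have hs0 : 0 ≤ s := by
    rw [hs]
    exact add_nonneg (Finset.sum_nonneg fun j _ => norm_nonneg _)
      (Finset.sum_nonneg fun j _ => norm_nonneg _)
  refine ⟨1 / (2 * (a * s + 1)), 2 * a, by positivity, by positivity, fun n X Y hX hY => ?_⟩
  have hJ : r.J⁻¹ * r.J = 1 :=
    Matrix.nonsing_inv_mul _ ((Matrix.isUnit_iff_isUnit_det _).1 r.isUnit_J)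
  have hGJ : (r.J⁻¹ ⊗ₖ (1 : Matrix (Fin n) (Fin n) ℂ)) *
      (r.J ⊗ₖ (1 : Matrix (Fin n) (Fin n) ℂ)) = 1 := by
    rw [← Matrix.mul_kronecker_mul, hJ]; simp
  have hGn : ‖r.J⁻¹ ⊗ₖ (1 : Matrix (Fin n) (Fin n) ℂ)‖ ≤ a := by
    rw [ha]; exact norm_kronecker_one_le _
  have hEn : ‖tensorEval r.A X + tensorEval r.B Y‖ ≤ s * (1 / (2 * (a * s + 1))) := by
    rw [hs, add_mul, ← hs]
    exact (norm_add_le _ _).trans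
      (add_le_add (norm_tensorEval_le _ _ hX) (norm_tensorEval_le _ _ hY))
  have hGE : ‖(r.J⁻¹ ⊗ₖ (1 : Matrix (Fin n) (Fin n) ℂ)) *
      (tensorEval r.A X + tensorEval r.B Y)‖ ≤ 1 / 2 := by
    refine (norm_mul_le _ _).trans ((mul_le_mul hGn hEn (norm_nonneg _) ha0).trans ?_)
    rw [← mul_assoc, mul_one_div, div_le_div_iff₀ (by positivity) (by norm_num)]
    linarith
  have h := Matrix.isUnit_sub_of_norm_le_half hGJ hGE
  rw [← sub_sub, ← pencil_eq] at h
  exact ⟨h.1, h.2.trans (by linarith)⟩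

theorem exists_forall_norm_le_mem_dom (r : DescriptorRealization g) :
    ∃ δ : ℝ, 0 < δ ∧ ∀ (n : ℕ) (X : MatTuple g n), (∀ j, ‖X j‖ ≤ δ) → X ∈ r.dom n := by
  obtain ⟨δ, C, hδ, -, h⟩ := r.exists_isUnit_pencil
  refine ⟨δ, hδ, fun n X hX => (h n X X.adj hX fun j => ?_).1⟩
  rw [MatTuple.adj, Matrix.l2_opNorm_conjTranspose]
  exact hX j

/-- An nc rational function that vanishes at `0` is small near `0`, uniformly in the size. -/
theorem exists_forall_norm_eval_le (r : DescriptorRealization g)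
    (h0 : ∀ n : ℕ, r.eval (0 : MatTuple g n) = 0) {ε : ℝ} (hε : 0 < ε) :
    ∃ δ : ℝ, 0 < δ ∧ ∀ (n : ℕ) (X : MatTuple g n), (∀ j, ‖X j‖ ≤ δ) → ‖r.eval X‖ ≤ ε := by
  obtain ⟨δ, C, hδ, hC, h⟩ := r.exists_isUnit_pencil
  obtain ⟨Cb, hCb, hb⟩ := exists_norm_colTensor_le r.b
  obtain ⟨Cc, hCc, hc⟩ := exists_norm_colTensor_le r.c
  set s : ℝ := ∑ j, ‖r.A j‖ + ∑ j, ‖r.B j‖ with hs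
  have hs0 : 0 ≤ s := by positivity
  set D : ℝ := Cc * (C * s * C) * Cb with hD
  have hD0 : 0 ≤ D := by positivity
  refine ⟨min δ (ε / (D + 1)), by positivity, fun n X hX => ?_⟩
  have hX1 : ∀ j, ‖X j‖ ≤ δ := fun j => (hX j).trans (min_le_left _ _)
  have hX2 : ∀ j, ‖X j‖ ≤ ε / (D + 1) := fun j => (hX j).trans (min_le_right _ _)
  have hXa : ∀ j, ‖X.adj j‖ = ‖X j‖ := fun j => Matrix.l2_opNorm_conjTranspose _
  obtain ⟨hu, hR⟩ := h n X X.adj hX1 (fun j => (hXa j).trans_le (hX1 j))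
  obtain ⟨hu0, hR0⟩ := h n 0 (MatTuple.adj 0) (fun j => by simpa using hδ.le)
    (fun j => by simpa [MatTuple.adj] using hδ.le)
  have e1 : r.eval X = (colTensor r.c n)ᴴ * ((r.pencil X X.adj)⁻¹ *
      (tensorEval r.A X + tensorEval r.B X.adj) * (r.pencil 0 (MatTuple.adj 0))⁻¹) *
      colTensor r.b n := by
    have e2 : tensorEval r.A X + tensorEval r.B X.adj =
        r.pencil 0 (MatTuple.adj 0) - r.pencil X X.adj := by
      have : (MatTuple.adj (0 : MatTuple g n)) = 0 := by ext; simp [MatTuple.adj]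
      rw [pencil_eq, pencil_eq, this, tensorEval_zero, tensorEval_zero]; abel
    rw [e2, ← Matrix.inv_sub_inv_eq hu hu0, Matrix.mul_sub, Matrix.sub_mul]
    have := h0 n
    rw [eval, evalPair] at this
    rw [this, sub_zero]; rfl
  have hE : ‖tensorEval r.A X + tensorEval r.B X.adj‖ ≤ s * (ε / (D + 1)) := by
    rw [hs, add_mul]
    exact (norm_add_le _ _).trans (add_le_add (norm_tensorEval_le _ _ hX2)
      (norm_tensorEval_le _ _ fun j => (hXa j).trans_le (hX2 j)))
  have key : ‖r.eval X‖ ≤ Cc * (C * (s * (ε / (D + 1))) * C) * Cb := by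
    rw [e1]
    refine (Matrix.l2_opNorm_mul _ _).trans (mul_le_mul ((Matrix.l2_opNorm_mul _ _).trans
      (mul_le_mul (hc n).2 ?_ (norm_nonneg _) hCc)) (hb n).1 (norm_nonneg _) (by positivity))
    exact (norm_mul_le _ _).trans (mul_le_mul ((norm_mul_le _ _).trans
      (mul_le_mul hR hE (norm_nonneg _) hC)) hR0 (norm_nonneg _) (by positivity))
  refine key.trans ?_
  have : Cc * (C * (s * (ε / (D + 1))) * C) * Cb = D * ε / (D + 1) := by rw [hD]; ring
  rw [this, div_le_iff₀ (by positivity)]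
  nlinarith

end DescriptorRealization

/-! ### The complex Hessian as a limit of averages over fourth roots of unity -/

section QuarterAverage

/-- The average of `φ` over the four points `ε, -ε, iε, -iε`. -/
noncomputable def quarterAverage {E : Type*} [AddCommGroup E] [Module ℂ E] (φ : ℂ → E) (ε : ℝ) :
    E :=
  (1 / 4 : ℂ) • ((φ ε + φ (-ε)) + (φ (Complex.I * ε) + φ (-(Complex.I * ε))))

theorem map_quarterAverage {E F : Type*} [AddCommGroup E] [Module ℂ E] [AddCommGroup F]
    [Module ℂ F] (L : E →ₗ[ℂ] F) (φ : ℂ → E) (ε : ℝ) :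
    L (quarterAverage φ ε) = quarterAverage (fun z => L (φ z)) ε := by
  simp [quarterAverage]

theorem quarterAverage_congr {E : Type*} [AddCommGroup E] [Module ℂ E] {φ φ' : ℂ → E}
    {ε : ℝ} (h : ∀ z : ℂ, ‖z‖ = |ε| → φ z = φ' z) : quarterAverage φ ε = quarterAverage φ' ε := by
  simp only [quarterAverage]
  rw [h, h, h, h] <;> simp

open scoped Matrix.Norms.L2Operator
open Filter Topology

namespace Matrix

variable {N : Type*} [Fintype N] [DecidableEq N]

theorem continuousAt_inv_of_isUnit {P : Matrix N N ℂ} (hP : IsUnit P) :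
    ContinuousAt (fun Q : Matrix N N ℂ => Q⁻¹) P := by
  obtain ⟨u, rfl⟩ := hP
  simp only [nonsing_inv_eq_ringInverse]
  exact NormedRing.inverse_continuousAt u

theorem eventually_isUnit {P : Matrix N N ℂ} (hP : IsUnit P) : ∀ᶠ Q in 𝓝 P, IsUnit Q :=
  Units.isOpen.mem_nhds hP

theorem hasDerivAt_inv_sub_smul {P : Matrix N N ℂ} (hP : IsUnit P) (L : Matrix N N ℂ) :
    HasDerivAt (fun s : ℝ => (P - s • L)⁻¹) (P⁻¹ * L * P⁻¹) 0 := by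
  obtain ⟨u, rfl⟩ := hP
  have h1 : HasDerivAt (fun s : ℝ => (u : Matrix N N ℂ) - s • L) (-L) 0 := by
    simpa using ((hasDerivAt_id (0 : ℝ)).smul_const L).const_sub (u : Matrix N N ℂ)
  have h2 := hasFDerivAt_ringInverse (𝕜 := ℝ) u
  have h3 : HasFDerivAt Ring.inverse
      (-((ContinuousLinearMap.mulLeftRight ℝ (Matrix N N ℂ)) ↑u⁻¹) ↑u⁻¹)
      ((u : Matrix N N ℂ) - (0 : ℝ) • L) := by simpa using h2
  have h4 := h3.comp_hasDerivAt (0 : ℝ) h1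
  simp only [nonsing_inv_eq_ringInverse, Ring.inverse_unit]
  simpa [Function.comp_def] using h4

/-- The linear functional `M ↦ (S M T)ₖₗ`. -/
noncomputable def entryFunctional {m : Type*} [Fintype m] (S : Matrix m N ℂ) (T : Matrix N m ℂ)
    (k l : m) : Matrix N N ℂ →L[ℝ] ℂ :=
  LinearMap.toContinuousLinearMap
    { toFun := fun M => (S * M * T) k l
      map_add' := fun M M' => by simp [Matrix.mul_add, Matrix.add_mul]
      map_smul' := fun z M => by simp }

theorem entryFunctional_apply {m N : Type*} [Fintype m] [Fintype N]
    (S : Matrix m N ℂ) (T : Matrix N m ℂ)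
    (k l : m) (M : Matrix N N ℂ) : entryFunctional S T k l M = (S * M * T) k l := rfl

theorem posSemidef_of_tendsto {u : ℝ → Matrix N N ℂ} {M : Matrix N N ℂ} {l : Filter ℝ} [l.NeBot]
    (hu : Tendsto u l (𝓝 M)) (h : ∀ᶠ t in l, (u t).PosSemidef) : M.PosSemidef := by
  open scoped MatrixOrder in
  rw [← Matrix.nonneg_iff_posSemidef]
  refine ge_of_tendsto hu ?_
  filter_upwards [h] with t ht using Matrix.nonneg_iff_posSemidef.2 ht

/-- Third order expansion of the resolvent. -/
theorem inv_sub_eq_expansion {P E : Matrix N N ℂ} (hP : IsUnit P) (hE : IsUnit (P - E)) :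
    (P - E)⁻¹ = P⁻¹ + P⁻¹ * E * P⁻¹ + P⁻¹ * (E * P⁻¹ * E) * P⁻¹ +
      P⁻¹ * E * P⁻¹ * E * P⁻¹ * E * (P - E)⁻¹ := by
  have h' := Matrix.inv_sub_inv_eq hP hE
  have e1 : (P - E)⁻¹ = P⁻¹ + P⁻¹ * E * (P - E)⁻¹ := by
    rw [show P - E - P = -E by abel, Matrix.mul_neg, Matrix.neg_mul, ← neg_eq_iff_eq_neg,
      neg_sub] at h'
    exact sub_eq_iff_eq_add'.1 h'
  have e2 : (P - E)⁻¹ = P⁻¹ + P⁻¹ * E * (P⁻¹ + P⁻¹ * E * (P⁻¹ + P⁻¹ * E * (P - E)⁻¹)) := by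
    rw [← e1, ← e1, ← e1]
  nth_rewrite 1 [e2]
  noncomm_ring

/-- The average of four expansions `R + εLₖ + ε²Qₖ + ε³rₖ` in which the linear terms cancel. -/
theorem quarterAverage_expansion_aux {E : Type*} [AddCommGroup E] [Module ℂ E] {ε : ℂ}
    (hε : ε ≠ 0) {R L₁ L₂ L₃ L₄ Q₁ Q₂ Q₃ Q₄ H r₁ r₂ r₃ r₄ : E} (hL : L₁ + L₂ + (L₃ + L₄) = 0)
    (hQ : Q₁ + Q₂ + (Q₃ + Q₄) = (4 : ℂ) • H) :
    (ε ^ 2)⁻¹ • ((1 / 4 : ℂ) •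
      ((R + ε • L₁ + ε ^ 2 • Q₁ + ε ^ 2 • ε • r₁ + (R + ε • L₂ + ε ^ 2 • Q₂ + ε ^ 2 • ε • r₂)) +
        (R + ε • L₃ + ε ^ 2 • Q₃ + ε ^ 2 • ε • r₃ + (R + ε • L₄ + ε ^ 2 • Q₄ + ε ^ 2 • ε • r₄)))
        - R) =
      H + (1 / 4 : ℂ) • ((ε • r₁ + ε • r₂) + (ε • r₃ + ε • r₄)) := by
  have hL4 : L₄ = -(L₁ + L₂ + L₃) := by
    rw [← add_assoc] at hL; exact (neg_eq_of_add_eq_zero_right hL).symm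
  have hQ4 : Q₄ = (4 : ℂ) • H - (Q₁ + Q₂ + Q₃) := by
    rw [← add_assoc] at hQ; exact eq_sub_of_add_eq' hQ
  subst hL4 hQ4
  match_scalars <;> field_simp <;> ring

/-- The mixed second derivative of the resolvent `(P - zA - z̄B)⁻¹` at `z = 0`, as a limit of averages
over `z = ±ε, ±iε`. -/
theorem tendsto_quarterAverage_inv {P : Matrix N N ℂ} (hP : IsUnit P) (A B : Matrix N N ℂ) :
    Tendsto (fun ε : ℝ => ((ε : ℂ) ^ 2)⁻¹ •
        (quarterAverage (fun z : ℂ => (P - z • A - star z • B)⁻¹) ε - P⁻¹)) (𝓝[≠] 0)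
      (𝓝 (P⁻¹ * (A * P⁻¹ * B + B * P⁻¹ * A) * P⁻¹)) := by
  set R := P⁻¹ with hR
  -- the remainder of the third order expansion along the direction `w`
  let ρ : ℂ → ℝ → Matrix N N ℂ := fun w ε =>
    R * (w • A + star w • B) * R * (w • A + star w • B) * R * (w • A + star w • B) *
      (P - (ε : ℂ) • (w • A + star w • B))⁻¹
  have hcont : ∀ w : ℂ, Tendsto (fun ε : ℝ => P - (ε : ℂ) • (w • A + star w • B)) (𝓝 0) (𝓝 P) := by
    intro w
    have : Continuous fun ε : ℝ => P - (ε : ℂ) • (w • A + star w • B) := by fun_prop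
    simpa using this.tendsto 0
  have hρ : ∀ w : ℂ, Tendsto (fun ε : ℝ => (ε : ℂ) • ρ w ε) (𝓝[≠] 0) (𝓝 0) := by
    intro w
    have h1 := (continuousAt_inv_of_isUnit hP).tendsto.comp (hcont w)
    have h2 : Tendsto (fun ε : ℝ => (ε : ℂ)) (𝓝 0) (𝓝 0) := by
      simpa using Complex.continuous_ofReal.tendsto 0
    have h3 := h2.smul (h1.const_mul
      (R * (w • A + star w • B) * R * (w • A + star w • B) * R * (w • A + star w • B)))
    rw [zero_smul] at h3
    exact h3.mono_left nhdsWithin_le_nhds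
  have hunit : ∀ w : ℂ, ∀ᶠ ε : ℝ in 𝓝[≠] 0, IsUnit (P - (ε : ℂ) • (w • A + star w • B)) :=
    fun w => ((hcont w).eventually (eventually_isUnit hP)).filter_mono nhdsWithin_le_nhds
  have hlim : Tendsto (fun ε : ℝ => R * (A * R * B + B * R * A) * R + (1 / 4 : ℂ) •
      (((ε : ℂ) • ρ 1 ε + (ε : ℂ) • ρ (-1) ε) +
        ((ε : ℂ) • ρ Complex.I ε + (ε : ℂ) • ρ (-Complex.I) ε)))
      (𝓝[≠] 0) (𝓝 (R * (A * R * B + B * R * A) * R)) := by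
    have := (((hρ 1).add (hρ (-1))).add ((hρ Complex.I).add (hρ (-Complex.I)))).const_smul
      (1 / 4 : ℂ)
    simpa using this.const_add (R * (A * R * B + B * R * A) * R)
  refine hlim.congr' ?_
  filter_upwards [hunit 1, hunit (-1), hunit Complex.I, hunit (-Complex.I),
    self_mem_nhdsWithin] with ε h1 h2 h3 h4 hε
  have hε0 : (ε : ℂ) ≠ 0 := by exact_mod_cast hε
  have hexp : ∀ w : ℂ, IsUnit (P - (ε : ℂ) • (w • A + star w • B)) →
      (P - ((w * ε) • A) - star (w * ε) • B)⁻¹ = R + (ε : ℂ) • (R * (w • A + star w • B) * R) +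
        (ε : ℂ) ^ 2 • (R * ((w • A + star w • B) * R * (w • A + star w • B)) * R) +
        (ε : ℂ) ^ 2 • (ε : ℂ) • ρ w ε := by
    intro w hw
    have e0 : P - ((w * ε) • A) - star (w * ε) • B = P - (ε : ℂ) • (w • A + star w • B) := by
      rw [smul_add, smul_smul, smul_smul, sub_sub, star_mul', Complex.star_def,
        Complex.conj_ofReal, mul_comm, mul_comm (ε : ℂ) (_ : ℂ)]
      simp [mul_comm]
    rw [e0, inv_sub_eq_expansion hP hw]
    simp only [ρ, ← hR, Matrix.mul_smul, Matrix.smul_mul, smul_smul]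
    congr 2 <;> ring_nf
  have q := hexp 1 h1
  have q2 := hexp (-1) h2
  have q3 := hexp Complex.I h3
  have q4 := hexp (-Complex.I) h4
  simp only [one_mul, neg_mul] at q q2 q3 q4
  simp only [quarterAverage]
  rw [q, q2, q3, q4]
  have alg : (R * ((1 : ℂ) • A + star (1 : ℂ) • B) * R) +
      (R * ((-1 : ℂ) • A + star (-1 : ℂ) • B) * R)
      + ((R * (Complex.I • A + star Complex.I • B) * R) +
        (R * ((-Complex.I) • A + star (-Complex.I) • B) * R)) = 0 := by
    simp only [star_neg, star_one, neg_smul, one_smul]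
    noncomm_ring
  have hII : ∀ M : Matrix N N ℂ, Complex.I • Complex.I • M = - M := by
    intro M; rw [smul_smul, Complex.I_mul_I, neg_one_smul]
  have alg3 : (R * (((1 : ℂ) • A + star (1 : ℂ) • B) * R * ((1 : ℂ) • A + star (1 : ℂ) • B)) * R) +
      (R * (((-1 : ℂ) • A + star (-1 : ℂ) • B) * R * ((-1 : ℂ) • A + star (-1 : ℂ) • B)) * R)
      + ((R * ((Complex.I • A + star Complex.I • B) * R * (Complex.I • A + star Complex.I • B)) * R) +
        (R * (((-Complex.I) • A + star (-Complex.I) • B) * R *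
          ((-Complex.I) • A + star (-Complex.I) • B)) * R)) =
      (4 : ℂ) • (R * (A * R * B + B * R * A) * R) := by
    have : (4 : ℂ) • (R * (A * R * B + B * R * A) * R) =
      (4 : ℕ) • (R * (A * R * B + B * R * A) * R) := by
      rw [← Nat.cast_smul_eq_nsmul ℂ]; norm_num
    rw [this]
    simp only [star_neg, star_one, neg_smul, one_smul, Complex.star_def, Complex.conj_I,
      Matrix.add_mul, Matrix.mul_add, Matrix.mul_smul, Matrix.smul_mul, Matrix.neg_mul,
      Matrix.mul_neg, neg_neg, smul_neg, hII, smul_add]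
    noncomm_ring
  exact (quarterAverage_expansion_aux hε0 alg alg3).symm

end Matrix

namespace DescriptorRealization

variable {g n : ℕ}

theorem pencil_line (r : DescriptorRealization g) (X H : MatTuple g n) (z w : ℂ) :
    r.pencil (X + z • H) (X + w • H).adj =
      r.pencil X X.adj - z • tensorEval r.A H - star w • tensorEval r.B H.adj := by
  have h : (X + w • H).adj = X.adj + star w • H.adj := by
    ext j : 1
    simp [MatTuple.adj]
  rw [h, pencil_eq, pencil_eq, tensorEval_add, tensorEval_add, tensorEval_smul, tensorEval_smul]
  abel

/-- The complex Hessian in closed form. Its two terms are the two orders in which the directions `H`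
and `H*` occur. -/
theorem complexHessian_eq (r : DescriptorRealization g) {X : MatTuple g n} (hX : X ∈ r.dom n)
    (H : MatTuple g n) :
    r.complexHessian X H = (colTensor r.c n)ᴴ * ((r.pencil X X.adj)⁻¹ *
      (tensorEval r.A H * (r.pencil X X.adj)⁻¹ * tensorEval r.B H.adj +
        tensorEval r.B H.adj * (r.pencil X X.adj)⁻¹ * tensorEval r.A H) *
      (r.pencil X X.adj)⁻¹) * colTensor r.b n := by
  set P := r.pencil X X.adj with hP
  set A := tensorEval r.A H with hA
  set B := tensorEval r.B H.adj with hB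
  have hPu : IsUnit P := hX
  ext k l
  simp only [complexHessian, Matrix.of_apply]
  have hline : ∀ s t : ℝ, r.pencil (X + s • H) (X + t • H).adj = P - t • B - s • A := by
    intro s t
    have := r.pencil_line X H (s : ℂ) (t : ℂ)
    rw [show X + (s : ℂ) • H = X + s • H from rfl, show X + (t : ℂ) • H = X + t • H from rfl] at this
    rw [this, Complex.star_def, Complex.conj_ofReal, ← hP, ← hA, ← hB, sub_right_comm]
    rfl
  have hinner : ∀ t : ℝ, IsUnit (P - t • B) →
      deriv (fun s : ℝ => r.evalPair (X + s • H) (X + t • H).adj k l) 0 =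
        ((colTensor r.c n)ᴴ * ((P - t • B)⁻¹ * A * (P - t • B)⁻¹) * colTensor r.b n) k l := by
    intro t ht
    have h1 := (Matrix.entryFunctional (colTensor r.c n)ᴴ (colTensor r.b n)
      k l).hasFDerivAt.comp_hasDerivAt (0 : ℝ) (Matrix.hasDerivAt_inv_sub_smul ht A)
    rw [Matrix.entryFunctional_apply] at h1
    refine Eq.trans ?_ h1.deriv
    congr 1
    ext s
    rw [evalPair, hline]
    rfl
  have hev : ∀ᶠ t : ℝ in 𝓝 0, IsUnit (P - t • B) := by
    have h1 : Continuous fun t : ℝ => P - t • B := by fun_prop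
    have h2 : Tendsto (fun t : ℝ => P - t • B) (𝓝 0) (𝓝 P) := by simpa using h1.tendsto 0
    exact h2.eventually (Matrix.eventually_isUnit hPu)
  have hev2 := hev.mono hinner
  rw [Filter.EventuallyEq.deriv_eq hev2]
  have hd := Matrix.hasDerivAt_inv_sub_smul hPu B
  have hd2 := (hd.mul_const A).mul hd
  have h1 := (Matrix.entryFunctional (colTensor r.c n)ᴴ (colTensor r.b n)
      k l).hasFDerivAt.comp_hasDerivAt (0 : ℝ) hd2
  rw [Matrix.entryFunctional_apply] at h1
  refine (Eq.trans (congrArg (fun F : ℝ → ℂ => deriv F 0) (funext fun t => ?_)) h1.deriv).trans ?_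
  · exact (Matrix.entryFunctional_apply (colTensor r.c n)ᴴ (colTensor r.b n) k l
      ((P - t • B)⁻¹ * A * (P - t • B)⁻¹)).symm
  · simp only [zero_smul, sub_zero]
    simp only [Matrix.mul_add, Matrix.add_mul, Matrix.mul_assoc]
    exact add_comm _ _

/-- The complex Hessian only depends on the values `r(X, X*)` near `X`: averaging over
`X ± εH, X ± iεH` kills all terms up to third order except the mixed one. -/
theorem tendsto_quarterAverage_eval (r : DescriptorRealization g) {X : MatTuple g n}
    (hX : X ∈ r.dom n) (H : MatTuple g n) :
    Tendsto (fun ε : ℝ => ((ε : ℂ) ^ 2)⁻¹ •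
      (quarterAverage (fun z : ℂ => r.eval (X + z • H)) ε - r.eval X)) (𝓝[≠] 0)
      (𝓝 (r.complexHessian X H)) := by
  rw [complexHessian_eq r hX]
  have h := Matrix.tendsto_quarterAverage_inv (show IsUnit (r.pencil X X.adj) from hX)
    (tensorEval r.A H) (tensorEval r.B H.adj)
  let L : Matrix (r.ι × Fin n) (r.ι × Fin n) ℂ →ₗ[ℂ] Matrix (Fin n) (Fin n) ℂ :=
    { toFun := fun M => (colTensor r.c n)ᴴ * M * colTensor r.b n
      map_add' := fun M M' => by simp [Matrix.mul_add, Matrix.add_mul]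
      map_smul' := fun z M => by simp }
  have hL : Continuous L := LinearMap.continuous_of_finiteDimensional L
  refine ((hL.tendsto _).comp h).congr fun ε => ?_
  simp only [Function.comp_apply, map_smul, map_sub, map_quarterAverage]
  congr 2
  · refine quarterAverage_congr fun z _ => ?_
    rw [eval, evalPair, pencil_line]
    rfl

end DescriptorRealization

end QuarterAverage

/-! ### Compositions of convex and analytic functions are plush -/

section Composite

open scoped Matrix.Norms.L2Operator
open Filter Topology

/-- Finitely many radii have a common positive lower bound. -/
theorem exists_pos_forall_of_antitone {σ : Type*} [Finite σ] {p : σ → ℝ → Prop}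
    (hp : ∀ s, ∀ δ δ', δ ≤ δ' → p s δ' → p s δ) (h : ∀ s, ∃ δ : ℝ, 0 < δ ∧ p s δ) :
    ∃ δ : ℝ, 0 < δ ∧ ∀ s, p s δ := by
  have h1 : ∀ s, ∀ᶠ δ in 𝓝[>] (0 : ℝ), p s δ := by
    intro s
    obtain ⟨δ, hδ, h⟩ := h s
    filter_upwards [Ioc_mem_nhdsGT hδ] with δ' hδ' using hp s _ _ hδ'.2 h
  obtain ⟨δ, hδ, h0⟩ := ((eventually_all.2 h1).and self_mem_nhdsWithin).exists
  exact ⟨δ, h0, hδ⟩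

theorem continuous_tensorEval {g : ℕ} {ι κ N : Type*} (A : Fin g → Matrix ι κ ℂ) :
    Continuous fun X : Fin g → Matrix N N ℂ => tensorEval A X := by
  unfold tensorEval
  refine continuous_finsetSum _ fun j _ => continuous_matrix fun p q => ?_
  simp only [Matrix.kroneckerMap_apply]
  fun_prop

namespace DescriptorRealization

variable {g n : ℕ}

theorem continuous_pencil (r : DescriptorRealization g) :
    Continuous fun Y : MatTuple g n => r.pencil Y Y.adj := by
  have h : Continuous fun Y : MatTuple g n => Y.adj := by unfold MatTuple.adj; fun_prop
  simp only [pencil_eq]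
  exact (continuous_const.sub (continuous_tensorEval _)).sub ((continuous_tensorEval _).comp h)

theorem eval_sub_eval (r : DescriptorRealization g) {X Y : MatTuple g n} (hX : X ∈ r.dom n)
    (hY : Y ∈ r.dom n) : r.eval X - r.eval Y = (colTensor r.c n)ᴴ * ((r.pencil X X.adj)⁻¹ *
      (tensorEval r.A (X - Y) + tensorEval r.B (X - Y).adj) * (r.pencil Y Y.adj)⁻¹) *
      colTensor r.b n := by
  have h : tensorEval r.A (X - Y) + tensorEval r.B (X - Y).adj =
      r.pencil Y Y.adj - r.pencil X X.adj := by
    have e : (X - Y).adj + Y.adj = X.adj := by ext j : 1; simp [MatTuple.adj]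
    have h1 := tensorEval_add r.A (X - Y) Y
    have h2 := tensorEval_add r.B (X - Y).adj Y.adj
    rw [sub_add_cancel] at h1
    rw [e] at h2
    rw [pencil_eq, pencil_eq, h1, h2]
    abel
  rw [h, ← Matrix.inv_sub_inv_eq hX hY, Matrix.mul_sub, Matrix.sub_mul]
  rfl

/-- A perturbation of the argument that is `o(1 / a)` changes the value by `o(1 / a)`. -/
theorem tendsto_smul_eval_sub (r : DescriptorRealization g) {Y : MatTuple g n} (hY : Y ∈ r.dom n)
    {l : Filter ℝ} {Y' : ℝ → MatTuple g n} {a : ℝ → ℝ} (hY' : Tendsto Y' l (𝓝 Y))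
    (ha : Tendsto (fun t => (a t : ℂ) • (Y' t - Y)) l (𝓝 0)) :
    Tendsto (fun t => (a t : ℂ) • (r.eval (Y' t) - r.eval Y)) l (𝓝 0) := by
  have hP : Tendsto (fun t => r.pencil (Y' t) (Y' t).adj) l (𝓝 (r.pencil Y Y.adj)) :=
    (r.continuous_pencil.tendsto Y).comp hY'
  have hR := (Matrix.continuousAt_inv_of_isUnit (show IsUnit (r.pencil Y Y.adj) from hY)).tendsto.comp
    hP
  have hadj : Continuous fun Y : MatTuple g n => Y.adj := by unfold MatTuple.adj; fun_prop
  have hE : Tendsto (fun t => tensorEval r.A ((a t : ℂ) • (Y' t - Y)) +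
      tensorEval r.B ((a t : ℂ) • (Y' t - Y)).adj) l (𝓝 0) := by
    have hc : Continuous fun Z : MatTuple g n => tensorEval r.A Z + tensorEval r.B Z.adj :=
      (continuous_tensorEval _).add ((continuous_tensorEval _).comp hadj)
    have h0 := (hc.tendsto 0).comp ha
    have e0 : (MatTuple.adj (0 : MatTuple g n)) = 0 := by ext; simp [MatTuple.adj]
    rw [e0, tensorEval_zero, tensorEval_zero, add_zero] at h0
    exact h0
  let L : Matrix (r.ι × Fin n) (r.ι × Fin n) ℂ →ₗ[ℂ] Matrix (Fin n) (Fin n) ℂ :=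
    { toFun := fun M => (colTensor r.c n)ᴴ * M * colTensor r.b n
      map_add' := fun M M' => by simp [Matrix.mul_add, Matrix.add_mul]
      map_smul' := fun z M => by simp }
  have hL : Continuous L := LinearMap.continuous_of_finiteDimensional L
  have hlim := (hL.tendsto _).comp ((hR.mul hE).mul_const ((r.pencil Y Y.adj)⁻¹))
  rw [mul_zero, zero_mul, map_zero] at hlim
  refine hlim.congr' ?_
  filter_upwards [hP.eventually (Matrix.eventually_isUnit hY)] with t ht
  rw [eval_sub_eval r ht hY]
  have e : ((a t : ℂ) • (Y' t - Y)).adj = (a t : ℂ) • (Y' t - Y).adj := by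
    ext j : 1
    simp only [MatTuple.adj, Pi.smul_apply, Matrix.conjTranspose_smul, Complex.star_def,
      Complex.conj_ofReal]
  simp only [Function.comp_apply, e, tensorEval_smul, ← smul_add]
  change (colTensor r.c n)ᴴ * ((r.pencil (Y' t) (Y' t).adj)⁻¹ * ((a t : ℂ) • _) *
    (r.pencil Y Y.adj)⁻¹) * colTensor r.b n = _
  simp only [Matrix.mul_smul, Matrix.smul_mul]

/-- Convexity at the midpoint gives convexity for the average of four points. -/
theorem posSemidef_quarterAverage_sub {f : DescriptorRealization g} {S : Set (MatTuple g n)}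
    (hf : ∀ X ∈ S, ∀ Y ∈ S,
      ((1 / 2 : ℂ) • (f.eval X + f.eval Y) - f.eval ((1 / 2 : ℂ) • (X + Y))).PosSemidef)
    {φ : ℂ → MatTuple g n} {ε : ℝ} {δ : ℝ} (hδ : ∀ X : MatTuple g n, (∀ j, ‖X j‖ ≤ δ) → X ∈ S)
    (hφ : ∀ z : ℂ, ‖z‖ = |ε| → ∀ j, ‖φ z j‖ ≤ δ) :
    (quarterAverage (fun z => f.eval (φ z)) ε - f.eval (quarterAverage φ ε)).PosSemidef := by
  have hmid : ∀ X Y : MatTuple g n, (∀ j, ‖X j‖ ≤ δ) → (∀ j, ‖Y j‖ ≤ δ) →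
      ∀ j, ‖((1 / 2 : ℂ) • (X + Y)) j‖ ≤ δ := by
    intro X Y hX hY j
    rw [Pi.smul_apply, Pi.add_apply, norm_smul]
    have := norm_add_le (X j) (Y j)
    have h1 := hX j
    have h2 := hY j
    norm_num
    linarith
  have b1 := hφ ε (by simp)
  have b2 := hφ (-ε) (by simp)
  have b3 := hφ (Complex.I * ε) (by simp)
  have b4 := hφ (-(Complex.I * ε)) (by simp)
  have h1 := hf _ (hδ _ b1) _ (hδ _ b2)
  have h2 := hf _ (hδ _ b3) _ (hδ _ b4)
  have h3 := hf _ (hδ _ (hmid _ _ b1 b2)) _ (hδ _ (hmid _ _ b3 b4))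
  have hhalf : (0 : ℂ) ≤ 1 / 2 := by
    rw [show (1 / 2 : ℂ) = ((1 / 2 : ℝ) : ℂ) by norm_num]
    exact Complex.zero_le_real.2 (by norm_num)
  have h4 := ((h1.smul hhalf).add (h2.smul hhalf)).add h3
  convert h4 using 1
  have e : quarterAverage φ ε = (1 / 2 : ℂ) • ((1 / 2 : ℂ) • (φ ε + φ (-ε)) +
      (1 / 2 : ℂ) • (φ (Complex.I * ε) + φ (-(Complex.I * ε)))) := by
    rw [quarterAverage]; module
  rw [e, quarterAverage]
  module

/-- A composite of a convex and an analytic function is plush: averaging over `X ± εH, X ± iεH`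
moves the analytic `q` only by `o(ε²)` and does not decrease the convex `f`, while the average of `r`
exceeds `r(X)` by `ε²` times the complex Hessian, up to `o(ε²)`. -/
theorem IsConvexAnalyticComposite.isPlushNearZero {h : ℕ} {r : DescriptorRealization g}
    {f : DescriptorRealization h} {q : Fin h → DescriptorRealization g}
    (hc : r.IsConvexAnalyticComposite f q) : r.IsPlushNearZero := by
  obtain ⟨εf, hεf, hconv⟩ := hc.convex
  obtain ⟨δf, hδf, hball⟩ := mem_freeBall_of_norm (g := h) hεf
  obtain ⟨δr, hδr, hr⟩ := r.exists_forall_norm_le_mem_dom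
  obtain ⟨δq, hδq, hq⟩ := exists_pos_forall_of_antitone
    (p := fun (s : Fin h) δ => ∀ (n : ℕ) (X : MatTuple g n), (∀ j, ‖X j‖ ≤ δ) → X ∈ (q s).dom n)
    (fun s δ δ' hδ H n X hX => H n X fun j => (hX j).trans hδ)
    (fun s => (q s).exists_forall_norm_le_mem_dom)
  obtain ⟨δv, hδv, hv⟩ := exists_pos_forall_of_antitone
    (p := fun (s : Fin h) δ => ∀ (n : ℕ) (X : MatTuple g n), (∀ j, ‖X j‖ ≤ δ) →
      ‖(q s).eval X‖ ≤ δf)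
    (fun s δ δ' hδ H n X hX => H n X fun j => (hX j).trans hδ)
    (fun s => (q s).exists_forall_norm_eval_le (fun n => congrFun (hc.map_zero n) s) hδf)
  obtain ⟨δ, hδ0, hδ1, hδ2, hδ3⟩ : ∃ δ : ℝ, 0 < δ ∧ δ ≤ δr ∧ δ ≤ δq ∧ δ ≤ δv :=
    ⟨min δr (min δq δv), by positivity, min_le_left _ _, (min_le_right _ _).trans (min_le_left _ _),
      (min_le_right _ _).trans (min_le_right _ _)⟩
  refine ⟨δ / 2, by positivity, fun n X hX => ?_⟩
  have hXn : ∀ j, ‖X j‖ ≤ δ / 2 := norm_le_of_mem_freeBall (by positivity) hX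
  have hXr : X ∈ r.dom n := hr n X fun j => (hXn j).trans (by linarith)
  refine ⟨hXr, fun H => ?_⟩
  -- all points `X + zH` with `|z| = ε` and `ε` small lie in the polydisc of radius `δ`
  have hsmall : ∀ᶠ ε : ℝ in 𝓝[≠] 0, ∀ z : ℂ, ‖z‖ = |ε| → ∀ j, ‖(X + z • H) j‖ ≤ δ := by
    have h1 : ∀ j, ∀ᶠ ε : ℝ in 𝓝 (0 : ℝ), |ε| * ‖H j‖ < δ / 2 := by
      intro j
      have hcont : Continuous fun ε : ℝ => |ε| * ‖H j‖ := by fun_prop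
      have := hcont.tendsto 0
      rw [abs_zero, zero_mul] at this
      exact this.eventually (gt_mem_nhds (by positivity))
    filter_upwards [(eventually_all.2 h1).filter_mono nhdsWithin_le_nhds] with ε hε z hz j
    calc ‖(X + z • H) j‖ ≤ ‖X j‖ + ‖z • H j‖ := norm_add_le _ _
      _ = ‖X j‖ + |ε| * ‖H j‖ := by rw [norm_smul, hz]
      _ ≤ δ := by linarith [hXn j, (hε j).le]
  have hX0 : ∀ j, ‖X j‖ ≤ δ := fun j => (hXn j).trans (by linarith)
  have hqn : ∀ Z : MatTuple g n, (∀ j, ‖Z j‖ ≤ δ) → ∀ s, ‖evalMap q Z s‖ ≤ δf := fun Z hZ s =>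
    hv s n Z fun j => (hZ j).trans hδ3
  have hfdom : ∀ Y : MatTuple h n, (∀ s, ‖Y s‖ ≤ δf) → Y ∈ f.dom n := fun Y hY =>
    (hconv n).1 (hball n Y hY)
  have hcomp : ∀ Z : MatTuple g n, (∀ j, ‖Z j‖ ≤ δ) → r.eval Z = f.eval (evalMap q Z) := fun Z hZ =>
    hc.comp n Z (hr n Z fun j => (hZ j).trans hδ1)
      (fun s => hq s n Z fun j => (hZ j).trans hδ2) (hfdom _ (hqn Z hZ))
  set Y' : ℝ → MatTuple h n := quarterAverage (fun z : ℂ => evalMap q (X + z • H)) with hY'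
  set Y : MatTuple h n := evalMap q X with hY
  -- `q` is analytic, so its average agrees with its value at the centre up to `o(ε²)`
  have hW : Tendsto (fun ε : ℝ => (((ε ^ 2)⁻¹ : ℝ) : ℂ) • (Y' ε - Y)) (𝓝[≠] 0) (𝓝 0) := by
    rw [tendsto_pi_nhds]
    intro s
    have h1 := (q s).tendsto_quarterAverage_eval (hq s n X fun j => (hX0 j).trans hδ2) H
    have h2 : (q s).complexHessian X H = 0 := by
      rw [complexHessian_eq _ (hq s n X fun j => (hX0 j).trans hδ2)]
      have hB : ∀ j, (q s).B j = 0 := hc.analytic s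
      have : tensorEval (q s).B H.adj = 0 := by simp [tensorEval, hB]
      rw [this]; simp
    rw [h2] at h1
    refine h1.congr fun ε => ?_
    simp only [hY', hY, Pi.smul_apply, Pi.sub_apply, quarterAverage, Pi.add_apply, evalMap,
      Complex.ofReal_inv, Complex.ofReal_pow]
  have hYlim : Tendsto Y' (𝓝[≠] 0) (𝓝 Y) := by
    have h1 : Tendsto (fun ε : ℝ => ((ε : ℂ) ^ 2)) (𝓝[≠] 0) (𝓝 0) := by
      have : Continuous fun ε : ℝ => ((ε : ℂ) ^ 2) := by fun_prop
      have := this.tendsto 0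
      simp only [Complex.ofReal_zero, ne_eq, OfNat.ofNat_ne_zero, not_false_eq_true,
        zero_pow] at this
      exact this.mono_left nhdsWithin_le_nhds
    have h2 := (h1.smul hW).add_const Y
    rw [smul_zero, zero_add] at h2
    refine h2.congr' ?_
    filter_upwards [self_mem_nhdsWithin] with ε hε
    have hε0 : (ε : ℂ) ^ 2 ≠ 0 := pow_ne_zero _ (by exact_mod_cast hε)
    rw [smul_smul, Complex.ofReal_inv, Complex.ofReal_pow, mul_inv_cancel₀ hε0, one_smul,
      sub_add_cancel]
  have hYdom : Y ∈ f.dom n := hfdom _ (hqn X hX0)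
  have hf0 := f.tendsto_smul_eval_sub hYdom hYlim hW
  have hlim := (r.tendsto_quarterAverage_eval hXr H).sub hf0
  rw [sub_zero] at hlim
  refine Matrix.posSemidef_of_tendsto hlim ?_
  filter_upwards [hsmall] with ε hε
  have hpsd := posSemidef_quarterAverage_sub (hconv n).2 (φ := fun z : ℂ => evalMap q (X + z • H))
    (ε := ε) (hball n) fun z hz => hqn _ (hε z hz)
  have hnn : (0 : ℂ) ≤ (((ε ^ 2)⁻¹ : ℝ) : ℂ) := by exact_mod_cast (by positivity : (0:ℝ) ≤ (ε ^ 2)⁻¹)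
  convert hpsd.smul hnn using 1
  rw [quarterAverage_congr fun z hz => hcomp _ (hε z hz), hcomp X hX0, ← Complex.ofReal_pow,
    ← Complex.ofReal_inv, ← smul_sub]
  congr 1
  abel

end DescriptorRealization

end Composite

/-! ### The function `f` in butterfly form, and its convexity -/

section ColTensor

variable {ι κ : Type} [Fintype ι]

theorem kronecker_one_mul_colTensor (S : Matrix κ ι ℂ) (v : ι → ℂ) (n : ℕ) :
    (S ⊗ₖ (1 : Matrix (Fin n) (Fin n) ℂ)) * colTensor v n = colTensor (S *ᵥ v) n := by
  ext p l
  simp [Matrix.mul_apply, colTensor, Fintype.sum_prod_type, Matrix.mulVec, dotProduct,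
    Matrix.kroneckerMap_apply, Matrix.one_apply]

theorem tensorEval_mul_colTensor {g n : ℕ} (A : Fin g → Matrix κ ι ℂ) (X : MatTuple g n)
    (v : ι → ℂ) : tensorEval A X * colTensor v n = ∑ j, colTensor (A j *ᵥ v) n * X j := by
  rw [tensorEval, Matrix.sum_mul]
  refine Finset.sum_congr rfl fun j _ => ?_
  ext p l
  simp [Matrix.mul_apply, colTensor, Fintype.sum_prod_type, Matrix.mulVec, dotProduct,
    Matrix.kroneckerMap_apply, Matrix.one_apply, Finset.sum_mul, mul_right_comm]

end ColTensor

namespace Matrix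

variable {N P : Type*} [Fintype N] [Fintype P] [DecidableEq P]

/-- Joint midpoint convexity of the matrix fractional function `(M, L) ↦ L* M⁻¹ L`. -/
theorem posSemidef_fractional_midpoint {M₁ M₂ M₀ : Matrix P P ℂ} {L₁ L₂ L₀ : Matrix P N ℂ}
    (h₁ : M₁.PosDef) (h₂ : M₂.PosDef) (h₀ : M₀.PosDef) (hM : M₀ = (1 / 2 : ℂ) • (M₁ + M₂))
    (hL : L₀ = (1 / 2 : ℂ) • (L₁ + L₂)) :
    ((1 / 2 : ℂ) • (L₁ᴴ * M₁⁻¹ * L₁ + L₂ᴴ * M₂⁻¹ * L₂) - L₀ᴴ * M₀⁻¹ * L₀).PosSemidef := by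
  set Z := M₀⁻¹ * L₀ with hZ
  have hM0Z : M₀ * Z = L₀ := by
    rw [hZ, ← Matrix.mul_assoc, Matrix.mul_nonsing_inv _
      ((Matrix.isUnit_iff_isUnit_det _).1 h₀.isUnit), Matrix.one_mul]
  have hZM : Zᴴ * M₀ = L₀ᴴ := by
    have := congrArg Matrix.conjTranspose hM0Z
    rwa [Matrix.conjTranspose_mul, h₀.isHermitian.eq] at this
  have key : ∀ {M : Matrix P P ℂ} {L : Matrix P N ℂ}, M.PosDef →
      (L - M * Z)ᴴ * M⁻¹ * (L - M * Z) = Lᴴ * M⁻¹ * L - (Lᴴ * Z + Zᴴ * L - Zᴴ * (M * Z)) := by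
    intro M L hM
    have hu := (Matrix.isUnit_iff_isUnit_det _).1 hM.isUnit
    have e1 : (L - M * Z)ᴴ = Lᴴ - Zᴴ * M := by
      rw [Matrix.conjTranspose_sub, Matrix.conjTranspose_mul, hM.isHermitian.eq]
    rw [e1, Matrix.sub_mul, Matrix.mul_assoc Zᴴ, Matrix.mul_nonsing_inv _ hu, Matrix.mul_one,
      Matrix.sub_mul, Matrix.mul_sub, Matrix.mul_sub, Matrix.mul_assoc Lᴴ, Matrix.mul_assoc Lᴴ,
      ← Matrix.mul_assoc M⁻¹ M, Matrix.nonsing_inv_mul _ hu, Matrix.one_mul]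
    abel
  have hp : ∀ {M : Matrix P P ℂ} {L : Matrix P N ℂ}, M.PosDef →
      (Lᴴ * M⁻¹ * L - (Lᴴ * Z + Zᴴ * L - Zᴴ * (M * Z))).PosSemidef := by
    intro M L hM
    rw [← key hM]
    exact hM.inv.posSemidef.conjTranspose_mul_mul_same _
  have hhalf : (0 : ℂ) ≤ 1 / 2 := by
    rw [show (1 / 2 : ℂ) = ((1 / 2 : ℝ) : ℂ) by norm_num]
    exact Complex.zero_le_real.2 (by norm_num)
  have h := ((hp (L := L₁) h₁).add (hp (L := L₂) h₂)).smul hhalf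
  convert h using 1
  have e2 : L₀ᴴ * M₀⁻¹ * L₀ = L₀ᴴ * Z + Zᴴ * L₀ - Zᴴ * (M₀ * Z) := by
    rw [hM0Z, Matrix.mul_assoc, ← hZ]; abel
  rw [e2, hL, hM]
  simp only [Matrix.conjTranspose_smul, Matrix.conjTranspose_add, Matrix.smul_mul, Matrix.mul_smul,
    Matrix.add_mul, Matrix.mul_add, smul_add, smul_sub]
  have hs : star (1 / 2 : ℂ) = 1 / 2 := by
    simp
  rw [hs]
  abel

variable {D : Type*} [DecidableEq N] [Fintype D] [DecidableEq D]

/-- The geometry of the state space of a butterfly realization: the isometry `W` embeds the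
positive part, `e` is a neutral vector, and `v` is dual to `e`. -/
structure ButterflyFrame (J : Matrix D D ℂ) (W : Matrix D P ℂ) (e v : Matrix D N ℂ) (κ : ℂ) :
    Prop where
  mul_self : J * J = 1
  mul_W : J * W = W
  W_mul : Wᴴ * J = Wᴴ
  isometry : Wᴴ * W = 1
  W_e : Wᴴ * e = 0
  W_v : Wᴴ * v = 0
  v_W : vᴴ * W = 0
  e_W : eᴴ * W = 0
  e_e : eᴴ * J * e = 0
  e_v : eᴴ * J * v = 1
  v_e : vᴴ * J * e = 1
  v_v : vᴴ * J * v = κ • 1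

variable {J : Matrix D D ℂ} {W : Matrix D P ℂ} {e v : Matrix D N ℂ} {κ : ℂ}

/-- The hermitian pencil `J - W T W* - W L e* - e L* W* - e ℓ e*`. -/
def butterflyPencil (J : Matrix D D ℂ) (W : Matrix D P ℂ) (e : Matrix D N ℂ) (T : Matrix P P ℂ)
    (L : Matrix P N ℂ) (ℓ : Matrix N N ℂ) : Matrix D D ℂ :=
  J - (W * T * Wᴴ + W * L * eᴴ + e * Lᴴ * Wᴴ + e * ℓ * eᴴ)

/-- The solution of the system with a butterfly pencil and right hand side `v`, from the solution
`U` of the reduced system. -/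
theorem ButterflyFrame.pencil_mul (h : ButterflyFrame J W e v κ) {T : Matrix P P ℂ}
    {L : Matrix P N ℂ} {ℓ : Matrix N N ℂ} {U : Matrix P N ℂ} (hU : (1 - T) * U = L) :
    butterflyPencil J W e T L ℓ * (W * U + J * v + J * e * (Lᴴ * U + ℓ)) = v := by
  set S := Lᴴ * U + ℓ with hS
  have h1 : J * (W * U + J * v + J * e * S) = W * U + v + e * S := by
    simp only [Matrix.mul_add, ← Matrix.mul_assoc, h.mul_self, h.mul_W, Matrix.one_mul]
  have h2 : Wᴴ * (W * U + J * v + J * e * S) = U := by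
    simp only [Matrix.mul_add, ← Matrix.mul_assoc, h.isometry, h.W_mul, h.W_v, h.W_e,
      Matrix.one_mul, Matrix.zero_mul, add_zero]
  have h3 : eᴴ * (W * U + J * v + J * e * S) = 1 := by
    simp only [Matrix.mul_add, ← Matrix.mul_assoc, h.e_W, h.e_v, h.e_e, Matrix.zero_mul, zero_add,
      add_zero]
  have hU' : L = U - T * U := by rw [← hU, Matrix.sub_mul, Matrix.one_mul]
  generalize W * U + J * v + J * e * S = Y at h1 h2 h3 ⊢
  rw [butterflyPencil, Matrix.sub_mul, h1]
  simp only [Matrix.add_mul, Matrix.mul_assoc, h2, h3, Matrix.mul_one]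
  have h4 : W * L = W * U - W * (T * U) := by rw [hU', Matrix.mul_sub]
  rw [h4, hS, Matrix.mul_add]
  abel

/-- The butterfly form `κ + ℓ + L* (1 - T)⁻¹ L`: an affine term plus a matrix fractional term. -/
theorem ButterflyFrame.value (h : ButterflyFrame J W e v κ) {T : Matrix P P ℂ}
    {L : Matrix P N ℂ} {ℓ : Matrix N N ℂ} {U : Matrix P N ℂ} (hU : (1 - T) * U = L)
    (hP : IsUnit (butterflyPencil J W e T L ℓ)) :
    vᴴ * (butterflyPencil J W e T L ℓ)⁻¹ * v = κ • 1 + (Lᴴ * U + ℓ) := by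
  have h1 : (butterflyPencil J W e T L ℓ)⁻¹ * v = W * U + J * v + J * e * (Lᴴ * U + ℓ) := by
    rw [← h.pencil_mul hU, ← Matrix.mul_assoc, Matrix.nonsing_inv_mul _
      ((Matrix.isUnit_iff_isUnit_det _).1 hP), Matrix.one_mul, h.pencil_mul hU]
  rw [Matrix.mul_assoc, h1]
  simp only [Matrix.mul_add, ← Matrix.mul_assoc, h.v_W, h.v_v, h.v_e, Matrix.zero_mul, zero_add,
    Matrix.one_mul]

/-- If the butterfly pencil is invertible, so is its block `1 - T`. -/
theorem ButterflyFrame.eq_zero (h : ButterflyFrame J W e v κ) {T : Matrix P P ℂ}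
    {L : Matrix P N ℂ} {ℓ : Matrix N N ℂ} {Q : Type*} [Fintype Q] {U : Matrix P Q ℂ}
    (hU : (1 - T) * U = 0) (hP : IsUnit (butterflyPencil J W e T L ℓ)) : U = 0 := by
  set S := Lᴴ * U with hS
  have h1 : J * (W * U + J * e * S) = W * U + e * S := by
    simp only [Matrix.mul_add, ← Matrix.mul_assoc, h.mul_self, h.mul_W, Matrix.one_mul]
  have h2 : Wᴴ * (W * U + J * e * S) = U := by
    simp only [Matrix.mul_add, ← Matrix.mul_assoc, h.isometry, h.W_mul, h.W_e,
      Matrix.one_mul, Matrix.zero_mul, add_zero]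
  have h3 : eᴴ * (W * U + J * e * S) = 0 := by
    simp only [Matrix.mul_add, ← Matrix.mul_assoc, h.e_W, h.e_e, Matrix.zero_mul, add_zero]
  have hU' : T * U = U := by
    rw [Matrix.sub_mul, Matrix.one_mul, sub_eq_zero] at hU; exact hU.symm
  have h4 : butterflyPencil J W e T L ℓ * (W * U + J * e * S) = 0 := by
    generalize W * U + J * e * S = Y at h1 h2 h3 ⊢
    rw [butterflyPencil, Matrix.sub_mul, h1]
    simp only [Matrix.add_mul, Matrix.mul_assoc, h2, h3, Matrix.mul_zero, hU', hS, add_zero]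
    abel_nf
  have h5 : W * U + J * e * S = 0 := by
    rw [← Matrix.one_mul (W * U + J * e * S), ← Matrix.nonsing_inv_mul _
      ((Matrix.isUnit_iff_isUnit_det _).1 hP), Matrix.mul_assoc, h4, Matrix.mul_zero]
  rw [← h2, h5, Matrix.mul_zero]

/-- A square matrix with trivial kernel is invertible. -/
theorem isUnit_of_forall_mul_eq_zero {M : Matrix P P ℂ}
    (h : ∀ U : Matrix P Unit ℂ, M * U = 0 → U = 0) : IsUnit M := by
  rw [← Matrix.mulVec_injective_iff_isUnit]
  refine (injective_iff_map_eq_zero (Matrix.mulVecLin M)).2 fun u hu => ?_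
  have h1 := h (Matrix.replicateCol Unit u) (by
    rw [← Matrix.replicateCol_mulVec]
    simp only [Matrix.mulVecLin_apply] at hu
    rw [hu]; rfl)
  funext i
  exact congrFun (congrFun h1 i) ()

end Matrix

namespace ConstructionData

variable {g : ℕ} {m : SymmetricRealization g}

/-- The inclusion of `ℂᵃ ⊕ ℂᵃ` into the state space. -/
def incl (m : SymmetricRealization g) : Matrix (StateIndex m) (Fin m.a ⊕ Fin m.a) ℂ :=
  Matrix.fromRows 1 0

/-- The neutral vector `0 ⊕ 0 ⊕ 1 ⊕ 1`. -/
def neutral (m : SymmetricRealization g) : StateIndex m → ℂ := Sum.elim 0 1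

/-- The part `D† [I ρ*] ⊕ 0` of `ψ`. -/
def ψtop (δ : ConstructionData m) : Matrix (Fin m.a ⊕ Fin m.a) (Fin m.a ⊕ Fin m.b) ℂ :=
  Matrix.fromRows (δ.P.Dinv * δ.P.colᴴ) 0

/-- The part `0 ⊕ [I; ρ_*] D_*†` of `ψ_*`. -/
def ψsleft (δ : ConstructionData m) : Matrix (Fin m.a ⊕ Fin m.b) (Fin m.a ⊕ Fin m.a) ℂ :=
  Matrix.fromCols 0 (δ.Ps.col * δ.Ps.Dinv)

theorem ψ_eq (δ : ConstructionData m) :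
    δ.ψ = incl m * δ.ψtop + Matrix.vecMulVec (neutral m) (star m.c) := by
  ext (i | i | i) k <;>
    simp [ψ, ψtop, incl, neutral, Matrix.fromRows_mul, Matrix.vecMulVec_apply]

theorem ψs_eq (δ : ConstructionData m) :
    δ.ψs = δ.ψsleft * (incl m)ᴴ + Matrix.vecMulVec m.c (star (neutral m)) := by
  ext k (i | i | i) <;>
    simp [ψs, ψsleft, incl, neutral, Matrix.conjTranspose_fromRows_eq_fromCols_conjTranspose,
      Matrix.mul_fromCols, Matrix.vecMulVec_apply]

theorem ψsleft_mul_ψtop (δ : ConstructionData m) : δ.ψsleft * δ.ψtop = 0 := by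
  simp [ψsleft, ψtop, Matrix.fromCols_mul_fromRows]

theorem conjTranspose_K (m : SymmetricRealization g) : m.Kᴴ = m.K := by
  simp [SymmetricRealization.K, signatureMatrix, Matrix.fromBlocks_conjTranspose]

theorem K_mul_K (m : SymmetricRealization g) : m.K * m.K = 1 := signatureMatrix_mul_self _ _

/-- The number `c* K c`, the value of the realization at `0`. -/
def valueAtZero (m : SymmetricRealization g) : ℂ := star m.c ⬝ᵥ (m.K *ᵥ m.c)

theorem star_valueAtZero (m : SymmetricRealization g) : star (valueAtZero m) = valueAtZero m := by
  rw [valueAtZero, ← Matrix.star_dotProduct_star, star_star, Matrix.star_mulVec, conjTranspose_K,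
    ← Matrix.dotProduct_mulVec]

theorem v_eq (m : SymmetricRealization g) : v m = Sum.elim (0 : Fin m.a ⊕ Fin m.a → ℂ) (Sum.elim
    (fun _ => (valueAtZero m + 1) / 2) (fun _ => (valueAtZero m - 1) / 2)) := rfl

theorem butterflyFrame (m : SymmetricRealization g) (n : ℕ) :
    Matrix.ButterflyFrame (J m ⊗ₖ (1 : Matrix (Fin n) (Fin n) ℂ))
      (incl m ⊗ₖ (1 : Matrix (Fin n) (Fin n) ℂ)) (colTensor (neutral m) n) (colTensor (v m) n)
      (valueAtZero m) := by
  have hκ := star_valueAtZero m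
  have hJW : J m * incl m = incl m := by
    simp [J, incl, Matrix.fromBlocks_mul_fromRows]
  have hJ : (J m)ᴴ = J m := by simp [J, Matrix.fromBlocks_conjTranspose]
  have hWJ : (incl m)ᴴ * J m = (incl m)ᴴ := by
    have := congrArg Matrix.conjTranspose hJW
    rwa [Matrix.conjTranspose_mul, hJ] at this
  have hWW : (incl m)ᴴ * incl m = 1 := by
    simp [incl, Matrix.conjTranspose_fromRows_eq_fromCols_conjTranspose,
      Matrix.fromCols_mul_fromRows]
  have hWe : (incl m)ᴴ *ᵥ neutral m = 0 := by
    simp [incl, neutral, Matrix.conjTranspose_fromRows_eq_fromCols_conjTranspose]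
  have hWv : (incl m)ᴴ *ᵥ v m = 0 := by
    simp [incl, v, Matrix.conjTranspose_fromRows_eq_fromCols_conjTranspose]
  have hJe : J m *ᵥ neutral m = Sum.elim (0 : Fin m.a ⊕ Fin m.a → ℂ)
      (Sum.elim (fun _ => (1 : ℂ)) (fun _ => -1)) := by
    funext i
    rcases i with i | i | i <;> (try rw [Subsingleton.elim i 0]) <;>
      simp [J, neutral, Matrix.mulVec, dotProduct, Fintype.sum_sum_type, Matrix.one_apply]
  have hJv : J m *ᵥ v m = Sum.elim (0 : Fin m.a ⊕ Fin m.a → ℂ)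
      (Sum.elim (fun _ => (valueAtZero m + 1) / 2) (fun _ => -((valueAtZero m - 1) / 2))) := by
    funext i
    rw [v_eq]
    generalize valueAtZero m = κ
    rcases i with i | i | i <;> (try rw [Subsingleton.elim i 0]) <;>
      simp [J, Matrix.mulVec, dotProduct, Fintype.sum_sum_type, Matrix.one_apply]
  have hsv : star (v m) = v m := by
    funext i
    rcases i with i | i | i
    · simp [v]
    · change star ((valueAtZero m + 1) / 2) = (valueAtZero m + 1) / 2
      rw [star_div₀, star_add, hκ]; simp
    · change star ((valueAtZero m - 1) / 2) = (valueAtZero m - 1) / 2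
      rw [star_div₀, star_sub, hκ]; simp
  have hW0 : ∀ u : StateIndex m → ℂ, (incl m)ᴴ *ᵥ u = 0 →
      (incl m ⊗ₖ (1 : Matrix (Fin n) (Fin n) ℂ))ᴴ * colTensor u n = 0 := by
    intro u hu
    rw [Matrix.conjTranspose_kronecker, Matrix.conjTranspose_one, kronecker_one_mul_colTensor, hu]
    ext; simp [colTensor]
  have hval : ∀ u w : StateIndex m → ℂ, (colTensor u n)ᴴ *
      (J m ⊗ₖ (1 : Matrix (Fin n) (Fin n) ℂ)) * colTensor w n = (star u ⬝ᵥ (J m *ᵥ w)) • 1 := by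
    intro u w
    rw [Matrix.mul_assoc, kronecker_one_mul_colTensor, conjTranspose_colTensor_mul_colTensor]
  refine
    { mul_self := by rw [← Matrix.mul_kronecker_mul, J_mul_self]; simp
      mul_W := by rw [← Matrix.mul_kronecker_mul, hJW]; simp
      W_mul := by
        rw [Matrix.conjTranspose_kronecker, ← Matrix.mul_kronecker_mul, hWJ]; simp
      isometry := by
        rw [Matrix.conjTranspose_kronecker, ← Matrix.mul_kronecker_mul, hWW]; simp
      W_e := hW0 _ hWe
      W_v := hW0 _ hWv
      v_W := by simpa using congrArg Matrix.conjTranspose (hW0 _ hWv)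
      e_W := by simpa using congrArg Matrix.conjTranspose (hW0 _ hWe)
      e_e := ?_
      e_v := ?_
      v_e := ?_
      v_v := ?_ }
  · rw [hval, hJe]
    simp [neutral, dotProduct, Fintype.sum_sum_type]
  · rw [hval, hJv]
    simp only [neutral, dotProduct, Fintype.sum_sum_type]
    generalize valueAtZero m = κ
    simp
    ring_nf
    simp
  · rw [hval, hJe, hsv, v_eq]
    generalize valueAtZero m = κ
    simp [dotProduct, Fintype.sum_sum_type]
    ring_nf
    simp
  · rw [hval, hJv, hsv, v_eq]
    congr 1
    generalize valueAtZero m = κ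
    simp [dotProduct, Fintype.sum_sum_type]
    ring

section Blocks

variable {n : ℕ} (δ : ConstructionData m)
  (Q : Matrix ((Fin m.a ⊕ Fin m.b) × Fin n) ((Fin m.a ⊕ Fin m.b) × Fin n) ℂ)

/-- The block `D† [I ρ*] Q K [I; ρ_*] D_*†`, in its place on `ℂᵃ ⊕ ℂᵃ`. -/
noncomputable def wing : Matrix ((Fin m.a ⊕ Fin m.a) × Fin n) ((Fin m.a ⊕ Fin m.a) × Fin n) ℂ :=
  (δ.ψtop ⊗ₖ (1 : Matrix (Fin n) (Fin n) ℂ)) * Q * (m.K ⊗ₖ (1 : Matrix (Fin n) (Fin n) ℂ)) *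
    (δ.ψsleft ⊗ₖ (1 : Matrix (Fin n) (Fin n) ℂ))

/-- The block `D† [I ρ*] Q K c`, in its place on `ℂᵃ ⊕ ℂᵃ`. -/
noncomputable def bodyLeft : Matrix ((Fin m.a ⊕ Fin m.a) × Fin n) (Fin n) ℂ :=
  (δ.ψtop ⊗ₖ (1 : Matrix (Fin n) (Fin n) ℂ)) * Q * (m.K ⊗ₖ (1 : Matrix (Fin n) (Fin n) ℂ)) *
    colTensor m.c n

/-- The block `c* Q K [I; ρ_*] D_*†`, in its place on `ℂᵃ ⊕ ℂᵃ`. -/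
noncomputable def bodyRight : Matrix (Fin n) ((Fin m.a ⊕ Fin m.a) × Fin n) ℂ :=
  (colTensor m.c n)ᴴ * Q * (m.K ⊗ₖ (1 : Matrix (Fin n) (Fin n) ℂ)) *
    (δ.ψsleft ⊗ₖ (1 : Matrix (Fin n) (Fin n) ℂ))

/-- The block `c* Q K c`. -/
noncomputable def head (m : SymmetricRealization g) {n : ℕ}
    (Q : Matrix ((Fin m.a ⊕ Fin m.b) × Fin n) ((Fin m.a ⊕ Fin m.b) × Fin n) ℂ) :
    Matrix (Fin n) (Fin n) ℂ :=
  (colTensor m.c n)ᴴ * Q * (m.K ⊗ₖ (1 : Matrix (Fin n) (Fin n) ℂ)) * colTensor m.c n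

end Blocks

theorem vecMulVec_kronecker_one {ι κ : Type} [Fintype ι] [Fintype κ] (u : ι → ℂ) (w : κ → ℂ)
    (n : ℕ) : Matrix.vecMulVec u (star w) ⊗ₖ (1 : Matrix (Fin n) (Fin n) ℂ) =
      colTensor u n * (colTensor w n)ᴴ := by
  ext p q
  simp only [Matrix.kroneckerMap_apply, Matrix.vecMulVec_apply, Matrix.mul_apply, colTensor,
    Matrix.of_apply, Matrix.conjTranspose_apply, star_mul', Matrix.one_apply]
  simp [eq_comm, mul_comm, mul_left_comm]

/-- The pencil of `f` is a butterfly pencil, whose blocks depend linearly on `Q = Λ_C(y)`. -/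
theorem pencil_f (δ : ConstructionData m) {n : ℕ} (Y : MatTuple δ.h n) :
    δ.f.pencil Y Y.adj = Matrix.butterflyPencil (J m ⊗ₖ (1 : Matrix (Fin n) (Fin n) ℂ))
      (incl m ⊗ₖ (1 : Matrix (Fin n) (Fin n) ℂ)) (colTensor (neutral m) n)
      (δ.wing (tensorEval δ.C Y) + (δ.wing (tensorEval δ.C Y))ᴴ)
      (δ.bodyLeft (tensorEval δ.C Y) + (δ.bodyRight (tensorEval δ.C Y))ᴴ)
      (head m (tensorEval δ.C Y) + (head m (tensorEval δ.C Y))ᴴ) := by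
  have hA : tensorEval δ.A Y = (δ.ψ ⊗ₖ (1 : Matrix (Fin n) (Fin n) ℂ)) * tensorEval δ.C Y *
      (m.K ⊗ₖ (1 : Matrix (Fin n) (Fin n) ℂ)) * (δ.ψs ⊗ₖ (1 : Matrix (Fin n) (Fin n) ℂ)) := by
    rw [kronecker_one_mul_tensorEval, tensorEval_mul_kronecker_one, tensorEval_mul_kronecker_one]
    rfl
  have hB : tensorEval (fun s => (δ.A s)ᴴ) Y.adj = (tensorEval δ.A Y)ᴴ :=
    (conjTranspose_tensorEval _ _).symm
  have h1 : δ.f.pencil Y Y.adj = J m ⊗ₖ (1 : Matrix (Fin n) (Fin n) ℂ) -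
      (tensorEval δ.A Y + (tensorEval δ.A Y)ᴴ) := by
    rw [← hB, ← sub_sub]; rfl
  rw [h1, Matrix.butterflyPencil, hA, ψ_eq, ψs_eq, Matrix.add_kronecker, Matrix.add_kronecker,
    vecMulVec_kronecker_one, vecMulVec_kronecker_one]
  have e1 : (incl m * δ.ψtop) ⊗ₖ (1 : Matrix (Fin n) (Fin n) ℂ) =
      (incl m ⊗ₖ (1 : Matrix (Fin n) (Fin n) ℂ)) * (δ.ψtop ⊗ₖ (1 : Matrix (Fin n) (Fin n) ℂ)) := by
    rw [← Matrix.mul_kronecker_mul, Matrix.one_mul]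
  have e2 : (δ.ψsleft * (incl m)ᴴ) ⊗ₖ (1 : Matrix (Fin n) (Fin n) ℂ) =
      (δ.ψsleft ⊗ₖ (1 : Matrix (Fin n) (Fin n) ℂ)) *
        (incl m ⊗ₖ (1 : Matrix (Fin n) (Fin n) ℂ))ᴴ := by
    rw [Matrix.conjTranspose_kronecker, ← Matrix.mul_kronecker_mul]; simp
  rw [e1, e2]
  congr 1
  simp only [wing, bodyLeft, bodyRight, head, Matrix.add_mul, Matrix.mul_add, Matrix.mul_assoc,
    Matrix.conjTranspose_add, Matrix.conjTranspose_mul, Matrix.conjTranspose_conjTranspose]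
  abel

theorem isHermitian_pencil_f (δ : ConstructionData m) {n : ℕ} (Y : MatTuple δ.h n) :
    (δ.f.pencil Y Y.adj).IsHermitian := by
  have hJ : (J m)ᴴ = J m := by simp [J, Matrix.fromBlocks_conjTranspose]
  have hB : tensorEval (fun s => (δ.A s)ᴴ) Y.adj = (tensorEval δ.A Y)ᴴ :=
    (conjTranspose_tensorEval _ _).symm
  have h1 : δ.f.pencil Y Y.adj = J m ⊗ₖ (1 : Matrix (Fin n) (Fin n) ℂ) -
      (tensorEval δ.A Y + (tensorEval δ.A Y)ᴴ) := by
    rw [← hB, ← sub_sub]; rfl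
  have h2 : (J m ⊗ₖ (1 : Matrix (Fin n) (Fin n) ℂ) -
      (tensorEval δ.A Y + (tensorEval δ.A Y)ᴴ)).IsHermitian := by
    rw [Matrix.IsHermitian, Matrix.conjTranspose_sub, Matrix.conjTranspose_add,
      Matrix.conjTranspose_conjTranspose, Matrix.conjTranspose_kronecker, hJ,
      Matrix.conjTranspose_one, add_comm (tensorEval δ.A Y)ᴴ]
  rw [h1]
  exact h2

theorem isSymmetric_f (δ : ConstructionData m) : δ.f.IsSymmetric := by
  intro n Y _
  rw [DescriptorRealization.eval, DescriptorRealization.evalPair, Matrix.conjTranspose_mul,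
    Matrix.conjTranspose_mul, Matrix.conjTranspose_conjTranspose, Matrix.conjTranspose_nonsing_inv,
    (δ.isHermitian_pencil_f Y).eq, Matrix.mul_assoc]
  rfl

theorem eval_f (δ : ConstructionData m) {n : ℕ} {Y : MatTuple δ.h n} (hY : Y ∈ δ.f.dom n)
    {U : Matrix ((Fin m.a ⊕ Fin m.a) × Fin n) (Fin n) ℂ}
    (hU : (1 - (δ.wing (tensorEval δ.C Y) + (δ.wing (tensorEval δ.C Y))ᴴ)) * U =
      δ.bodyLeft (tensorEval δ.C Y) + (δ.bodyRight (tensorEval δ.C Y))ᴴ) :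
    δ.f.eval Y = valueAtZero m • 1 +
      ((δ.bodyLeft (tensorEval δ.C Y) + (δ.bodyRight (tensorEval δ.C Y))ᴴ)ᴴ * U +
      (head m (tensorEval δ.C Y) + (head m (tensorEval δ.C Y))ᴴ)) := by
  have hP : IsUnit (δ.f.pencil Y Y.adj) := hY
  rw [pencil_f] at hP
  rw [← (butterflyFrame m n).value hU hP, ← pencil_f]
  rfl

open scoped Matrix.Norms.L2Operator in
/-- `f` is convex near `0`, being an affine function plus `L* (1 - T)⁻¹ L` with `T`, `L` affine and
`1 - T` positive definite for small arguments. -/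
theorem isConvexNearZero_f (δ : ConstructionData m) : δ.f.IsConvexNearZero := by
  obtain ⟨ε₁, hε₁, hdom⟩ := δ.f.exists_forall_norm_le_mem_dom
  let G : Fin δ.h → Matrix (Fin m.a ⊕ Fin m.a) (Fin m.a ⊕ Fin m.a) ℂ :=
    fun s => δ.ψtop * δ.C s * m.K * δ.ψsleft
  have hwing : ∀ (n : ℕ) (Y : MatTuple δ.h n), δ.wing (tensorEval δ.C Y) = tensorEval G Y := by
    intro n Y
    rw [wing, kronecker_one_mul_tensorEval, tensorEval_mul_kronecker_one,
      tensorEval_mul_kronecker_one]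
  obtain ⟨S, hS0, hS⟩ : ∃ S : ℝ, 0 ≤ S ∧ S = ∑ s, ‖G s‖ :=
    ⟨_, Finset.sum_nonneg fun _ _ => norm_nonneg _, rfl⟩
  have hpos : ∀ (n : ℕ) (Y : MatTuple δ.h n), (∀ s, ‖Y s‖ ≤ 1 / (4 * (S + 1))) →
      (1 - (δ.wing (tensorEval δ.C Y) + (δ.wing (tensorEval δ.C Y))ᴴ)).PosDef := by
    intro n Y hY
    refine posDef_one_sub_of_norm_lt_one ?_ ?_
    · rw [Matrix.IsHermitian, Matrix.conjTranspose_add, Matrix.conjTranspose_conjTranspose, add_comm]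
    · have h1 : ‖δ.wing (tensorEval δ.C Y)‖ ≤ 1 / 4 := by
        rw [hwing]
        refine (norm_tensorEval_le G Y hY).trans ?_
        rw [← hS, mul_one_div, div_le_div_iff₀ (by positivity) (by norm_num)]
        linarith
      refine (norm_add_le _ _).trans_lt ?_
      rw [Matrix.l2_opNorm_conjTranspose]
      linarith
  obtain ⟨ε, hε, hε1, hε2⟩ : ∃ ε : ℝ, 0 < ε ∧ ε ≤ ε₁ ∧ ε ≤ 1 / (4 * (S + 1)) :=
    ⟨min ε₁ (1 / (4 * (S + 1))), by positivity, min_le_left _ _, min_le_right _ _⟩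
  refine ⟨ε, hε, fun n => ⟨fun Y hY => hdom n Y fun s =>
    (norm_le_of_mem_freeBall hε hY s).trans hε1, fun X hX Y hY => ?_⟩⟩
  have hXn := norm_le_of_mem_freeBall hε hX
  have hYn := norm_le_of_mem_freeBall hε hY
  have hZn : ∀ s, ‖((1 / 2 : ℂ) • (X + Y)) s‖ ≤ ε := by
    intro s
    rw [Pi.smul_apply, Pi.add_apply, norm_smul]
    have := norm_add_le (X s) (Y s)
    have h1 := hXn s
    have h2 := hYn s
    norm_num
    linarith
  have hs : star (1 / 2 : ℂ) = 1 / 2 := by simp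
  have hval : ∀ Z : MatTuple δ.h n, (∀ s, ‖Z s‖ ≤ ε) → δ.f.eval Z = valueAtZero m • 1 +
      ((δ.bodyLeft (tensorEval δ.C Z) + (δ.bodyRight (tensorEval δ.C Z))ᴴ)ᴴ *
        (1 - (δ.wing (tensorEval δ.C Z) + (δ.wing (tensorEval δ.C Z))ᴴ))⁻¹ *
        (δ.bodyLeft (tensorEval δ.C Z) + (δ.bodyRight (tensorEval δ.C Z))ᴴ) +
      (head m (tensorEval δ.C Z) + (head m (tensorEval δ.C Z))ᴴ)) := by
    intro Z hZ
    have hu := (hpos n Z fun s => (hZ s).trans hε2).isUnit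
    rw [Matrix.mul_assoc]
    refine δ.eval_f (hdom n Z fun s => (hZ s).trans hε1) ?_
    rw [← Matrix.mul_assoc, Matrix.mul_nonsing_inv _ ((Matrix.isUnit_iff_isUnit_det _).1 hu),
      Matrix.one_mul]
  have hmid : tensorEval δ.C ((1 / 2 : ℂ) • (X + Y)) =
      (1 / 2 : ℂ) • (tensorEval δ.C X + tensorEval δ.C Y) := by
    rw [tensorEval_smul, tensorEval_add]
  have hfrac := Matrix.posSemidef_fractional_midpoint
    (hpos n X fun s => (hXn s).trans hε2) (hpos n Y fun s => (hYn s).trans hε2)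
    (hpos n ((1 / 2 : ℂ) • (X + Y)) fun s => (hZn s).trans hε2)
    (L₁ := δ.bodyLeft (tensorEval δ.C X) + (δ.bodyRight (tensorEval δ.C X))ᴴ)
    (L₂ := δ.bodyLeft (tensorEval δ.C Y) + (δ.bodyRight (tensorEval δ.C Y))ᴴ)
    (L₀ := δ.bodyLeft (tensorEval δ.C ((1 / 2 : ℂ) • (X + Y))) +
      (δ.bodyRight (tensorEval δ.C ((1 / 2 : ℂ) • (X + Y))))ᴴ)
    (by
      rw [hmid]
      simp only [wing, Matrix.mul_smul, Matrix.smul_mul, Matrix.mul_add, Matrix.add_mul,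
        Matrix.conjTranspose_smul, Matrix.conjTranspose_add, hs]
      module)
    (by
      rw [hmid]
      simp only [bodyLeft, bodyRight, Matrix.mul_smul, Matrix.smul_mul, Matrix.mul_add,
        Matrix.add_mul, Matrix.conjTranspose_smul, Matrix.conjTranspose_add, hs]
      module)
  have hhead : head m (tensorEval δ.C ((1 / 2 : ℂ) • (X + Y))) =
      (1 / 2 : ℂ) • (head m (tensorEval δ.C X) + head m (tensorEval δ.C Y)) := by
    rw [hmid]
    simp only [head, Matrix.mul_smul, Matrix.smul_mul, Matrix.mul_add, Matrix.add_mul]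
  have hheadH : (head m (tensorEval δ.C ((1 / 2 : ℂ) • (X + Y))))ᴴ =
      (1 / 2 : ℂ) • ((head m (tensorEval δ.C X))ᴴ + (head m (tensorEval δ.C Y))ᴴ) := by
    rw [hhead, Matrix.conjTranspose_smul, hs, Matrix.conjTranspose_add]
  rw [hval X hXn, hval Y hYn, hval _ hZn, hheadH, hhead]
  convert hfrac using 1
  module

end ConstructionData

/-! ### The identity `r = f ∘ q` -/

namespace IsMoorePenroseInverse

variable {a : ℕ} {D E : Matrix (Fin a) (Fin a) ℂ}

theorem mul_sq (h : IsMoorePenroseInverse D E) (hD : D.IsHermitian) : E * (D * D) = D := by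
  rw [← Matrix.mul_assoc]
  have h1 := congrArg (· * D) h.hermitian_right
  have h2 := congrArg Matrix.conjTranspose h.mul_mul_left
  simp only [Matrix.conjTranspose_mul, hD.eq] at h1 h2
  rw [← h1, Matrix.mul_assoc, h2]

theorem sq_mul (h : IsMoorePenroseInverse D E) (hD : D.IsHermitian) : D * D * E = D := by
  rw [Matrix.mul_assoc]
  have h1 := congrArg (D * ·) h.hermitian_left
  have h2 := congrArg Matrix.conjTranspose h.mul_mul_left
  simp only [Matrix.conjTranspose_mul, hD.eq] at h1 h2
  rw [← h1, h2]

end IsMoorePenroseInverse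

namespace AngularOperator

variable {a b : ℕ} (P : AngularOperator a b)

theorem conjTranspose_col_mul_signature_mul_col :
    P.colᴴ * signatureMatrix a b * P.col = P.D * P.D := by
  rw [P.sq_D, col, signatureMatrix, Matrix.conjTranspose_fromRows_eq_fromCols_conjTranspose,
    Matrix.fromCols_mul_fromBlocks, Matrix.fromCols_mul_fromRows]
  simp [sub_eq_add_neg]

/-- The graph of `ρ` contains the range of `E` exactly when `E` factors through `[I; ρ]`. -/
theorem ContainsRange.exists_eq_mul {E : Matrix (Fin a ⊕ Fin b) (Fin a ⊕ Fin b) ℂ}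
    (h : P.ContainsRange E) :
    ∃ β : Matrix (Fin a) (Fin a ⊕ Fin b) ℂ, E = P.col * β := by
  have h1 : ∀ k, ∃ u, P.col *ᵥ u = E.col k := by
    intro k
    have := h ⟨Pi.single k 1, rfl⟩
    obtain ⟨u, hu⟩ := this
    exact ⟨u, by simpa using hu⟩
  choose u hu using h1
  refine ⟨Matrix.of fun i k => u k i, ?_⟩
  ext i k
  have := congrFun (hu k) i
  rw [Matrix.mul_apply]
  simpa [Matrix.mulVec, dotProduct] using this.symm

end AngularOperator

namespace ConstructionData

variable {g : ℕ} {m : SymmetricRealization g} (δ : ConstructionData m)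

/-- Elements of the algebra have their ranges in `K {u ⊕ ρu}`, since the `KBⱼ` do. -/
theorem exists_left_factor {Z : Matrix (Fin m.a ⊕ Fin m.b) (Fin m.a ⊕ Fin m.b) ℂ}
    (hZ : Z ∈ NonUnitalAlgebra.adjoin ℂ (Set.range fun j => m.K * m.B j)) :
    ∃ γ : Matrix (Fin m.a) (Fin m.a ⊕ Fin m.b) ℂ, Z = m.K * δ.P.col * γ := by
  induction hZ using NonUnitalAlgebra.adjoin_induction with
  | mem x hx =>
    obtain ⟨j, rfl⟩ := hx
    obtain ⟨β, hβ⟩ := AngularOperator.ContainsRange.exists_eq_mul δ.P (δ.range_le j)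
    exact ⟨β, by simp only [Matrix.mul_assoc, ← hβ]⟩
  | add x y _ _ hx hy =>
    obtain ⟨γ, rfl⟩ := hx
    obtain ⟨γ', rfl⟩ := hy
    exact ⟨γ + γ', by rw [Matrix.mul_add]⟩
  | zero => exact ⟨0, by simp⟩
  | mul x y _ _ hx _ =>
    obtain ⟨γ, rfl⟩ := hx
    exact ⟨γ * y, by rw [Matrix.mul_assoc]⟩
  | smul z x _ hx =>
    obtain ⟨γ, rfl⟩ := hx
    exact ⟨z • γ, by rw [Matrix.mul_smul]⟩

/-- The adjoints of elements of the algebra have their ranges in `{u ⊕ ρ_*u}`. -/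
theorem exists_right_factor {Z : Matrix (Fin m.a ⊕ Fin m.b) (Fin m.a ⊕ Fin m.b) ℂ}
    (hZ : Z ∈ NonUnitalAlgebra.adjoin ℂ (Set.range fun j => m.K * m.B j)) :
    ∃ γ : Matrix (Fin m.a ⊕ Fin m.b) (Fin m.a) ℂ, Z = γ * δ.Ps.colᴴ := by
  induction hZ using NonUnitalAlgebra.adjoin_induction with
  | mem x hx =>
    obtain ⟨j, rfl⟩ := hx
    obtain ⟨β, hβ⟩ := AngularOperator.ContainsRange.exists_eq_mul δ.Ps (δ.range_le_adj j)
    refine ⟨m.K * βᴴ, ?_⟩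
    have := congrArg Matrix.conjTranspose hβ
    rw [Matrix.conjTranspose_conjTranspose, Matrix.conjTranspose_mul] at this
    simp only [Matrix.mul_assoc, ← this]
  | add x y _ _ hx hy =>
    obtain ⟨γ, rfl⟩ := hx
    obtain ⟨γ', rfl⟩ := hy
    exact ⟨γ + γ', by rw [Matrix.add_mul]⟩
  | zero => exact ⟨0, by simp⟩
  | mul x y _ _ _ hy =>
    obtain ⟨γ, rfl⟩ := hy
    exact ⟨x * γ, by rw [Matrix.mul_assoc]⟩
  | smul z x _ hx =>
    obtain ⟨γ, rfl⟩ := hx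
    exact ⟨z • γ, by rw [Matrix.smul_mul]⟩

theorem C_mem (s : Fin δ.h) :
    δ.C s ∈ NonUnitalAlgebra.adjoin ℂ (Set.range fun j => m.K * m.B j) := by
  have h : δ.C s ∈ Submodule.span ℂ (Set.range δ.C) := Submodule.subset_span ⟨s, rfl⟩
  rw [δ.span_C] at h
  exact h

section Gram

variable {n : ℕ} (Y : MatTuple δ.h n)

/-- On the range of the algebra, the semidefinite form of `ψ` agrees with that of `K`. -/
theorem gram_ψtop :
    ((δ.ψtop ⊗ₖ (1 : Matrix (Fin n) (Fin n) ℂ)) * tensorEval δ.C Y)ᴴ *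
      ((δ.ψtop ⊗ₖ (1 : Matrix (Fin n) (Fin n) ℂ)) * tensorEval δ.C Y) =
    (tensorEval δ.C Y)ᴴ * (m.K ⊗ₖ (1 : Matrix (Fin n) (Fin n) ℂ)) * tensorEval δ.C Y := by
  choose γ hγ using fun s => δ.exists_left_factor (δ.C_mem s)
  have hQ : tensorEval δ.C Y =
      ((m.K * δ.P.col) ⊗ₖ (1 : Matrix (Fin n) (Fin n) ℂ)) * tensorEval γ Y := by
    rw [kronecker_one_mul_tensorEval]
    congr 1
    funext s
    exact hγ s
  have hD := δ.P.posSemidef_D.isHermitian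
  have hcol := δ.P.conjTranspose_col_mul_signature_mul_col
  change δ.P.colᴴ * m.K * δ.P.col = _ at hcol
  have h1 : δ.ψtop * (m.K * δ.P.col) = Matrix.fromRows δ.P.D 0 := by
    rw [ψtop, Matrix.fromRows_mul, Matrix.mul_assoc, ← Matrix.mul_assoc δ.P.colᴴ, hcol,
      δ.P.pinv_D.mul_sq hD, Matrix.zero_mul]
  have h2 : (δ.ψtop * (m.K * δ.P.col))ᴴ * (δ.ψtop * (m.K * δ.P.col)) = δ.P.D * δ.P.D := by
    rw [h1, Matrix.conjTranspose_fromRows_eq_fromCols_conjTranspose, Matrix.fromCols_mul_fromRows,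
      hD.eq]
    simp
  have h3 : (m.K * δ.P.col)ᴴ * m.K * (m.K * δ.P.col) = δ.P.D * δ.P.D := by
    rw [Matrix.conjTranspose_mul, conjTranspose_K, Matrix.mul_assoc δ.P.colᴴ, K_mul_K,
      Matrix.mul_one, ← Matrix.mul_assoc, hcol]
  have h4 : ((δ.ψtop ⊗ₖ (1 : Matrix (Fin n) (Fin n) ℂ)) *
      ((m.K * δ.P.col) ⊗ₖ (1 : Matrix (Fin n) (Fin n) ℂ)))ᴴ *
      ((δ.ψtop ⊗ₖ (1 : Matrix (Fin n) (Fin n) ℂ)) *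
      ((m.K * δ.P.col) ⊗ₖ (1 : Matrix (Fin n) (Fin n) ℂ))) =
      ((m.K * δ.P.col) ⊗ₖ (1 : Matrix (Fin n) (Fin n) ℂ))ᴴ *
        (m.K ⊗ₖ (1 : Matrix (Fin n) (Fin n) ℂ)) *
        ((m.K * δ.P.col) ⊗ₖ (1 : Matrix (Fin n) (Fin n) ℂ)) := by
    rw [← Matrix.mul_kronecker_mul, Matrix.conjTranspose_kronecker, Matrix.conjTranspose_kronecker,
      ← Matrix.mul_kronecker_mul, ← Matrix.mul_kronecker_mul, ← Matrix.mul_kronecker_mul,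
      Matrix.one_mul, h2, h3]
    simp
  rw [hQ]
  have h5 := congrArg (fun M => (tensorEval γ Y)ᴴ * M * tensorEval γ Y) h4
  simp only [Matrix.conjTranspose_mul, Matrix.mul_assoc] at h5 ⊢
  exact h5

/-- The dual statement, for `ψ_*` and the adjoints of the algebra. -/
theorem gram_ψsleft :
    (tensorEval δ.C Y * (m.K ⊗ₖ (1 : Matrix (Fin n) (Fin n) ℂ)) *
      (δ.ψsleft ⊗ₖ (1 : Matrix (Fin n) (Fin n) ℂ))) *
    (tensorEval δ.C Y * (m.K ⊗ₖ (1 : Matrix (Fin n) (Fin n) ℂ)) *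
      (δ.ψsleft ⊗ₖ (1 : Matrix (Fin n) (Fin n) ℂ)))ᴴ =
    tensorEval δ.C Y * (m.K ⊗ₖ (1 : Matrix (Fin n) (Fin n) ℂ)) * (tensorEval δ.C Y)ᴴ := by
  choose γ hγ using fun s => δ.exists_right_factor (δ.C_mem s)
  have hQ : tensorEval δ.C Y =
      tensorEval γ Y * (δ.Ps.colᴴ ⊗ₖ (1 : Matrix (Fin n) (Fin n) ℂ)) := by
    rw [tensorEval_mul_kronecker_one]
    congr 1
    funext s
    exact hγ s
  have hD := δ.Ps.posSemidef_D.isHermitian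
  have hcol := δ.Ps.conjTranspose_col_mul_signature_mul_col
  change δ.Ps.colᴴ * m.K * δ.Ps.col = _ at hcol
  have h1 : δ.Ps.colᴴ * (m.K * δ.ψsleft) = Matrix.fromCols 0 δ.Ps.D := by
    rw [ψsleft, ← Matrix.mul_assoc, Matrix.mul_fromCols, Matrix.mul_zero, ← Matrix.mul_assoc, hcol,
      δ.Ps.pinv_D.sq_mul hD]
  have h2 : (δ.Ps.colᴴ * (m.K * δ.ψsleft)) * (δ.Ps.colᴴ * (m.K * δ.ψsleft))ᴴ =
      δ.Ps.colᴴ * m.K * δ.Ps.col := by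
    rw [h1, Matrix.conjTranspose_fromCols_eq_fromRows_conjTranspose, Matrix.fromCols_mul_fromRows,
      hD.eq, hcol]
    simp
  have h4 : ((δ.Ps.colᴴ ⊗ₖ (1 : Matrix (Fin n) (Fin n) ℂ)) *
        ((m.K ⊗ₖ (1 : Matrix (Fin n) (Fin n) ℂ)) *
          (δ.ψsleft ⊗ₖ (1 : Matrix (Fin n) (Fin n) ℂ)))) *
      ((δ.Ps.colᴴ ⊗ₖ (1 : Matrix (Fin n) (Fin n) ℂ)) *
        ((m.K ⊗ₖ (1 : Matrix (Fin n) (Fin n) ℂ)) *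
          (δ.ψsleft ⊗ₖ (1 : Matrix (Fin n) (Fin n) ℂ))))ᴴ =
      (δ.Ps.colᴴ ⊗ₖ (1 : Matrix (Fin n) (Fin n) ℂ)) *
        (m.K ⊗ₖ (1 : Matrix (Fin n) (Fin n) ℂ)) *
        (δ.Ps.colᴴ ⊗ₖ (1 : Matrix (Fin n) (Fin n) ℂ))ᴴ := by
    rw [← Matrix.mul_kronecker_mul, ← Matrix.mul_kronecker_mul, Matrix.conjTranspose_kronecker,
      Matrix.conjTranspose_kronecker, ← Matrix.mul_kronecker_mul, ← Matrix.mul_kronecker_mul,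
      ← Matrix.mul_kronecker_mul, h2, Matrix.conjTranspose_conjTranspose]
    simp
  rw [hQ]
  have h5 := congrArg (fun M => tensorEval γ Y * M * (tensorEval γ Y)ᴴ) h4
  simp only [Matrix.conjTranspose_mul, Matrix.mul_assoc] at h5 ⊢
  exact h5

end Gram

/-- The defining equation `q (I - Λ_Ξ(y)) = y` of `q`, in coordinates. -/
theorem eval_q (δ : ConstructionData m) {n : ℕ} {X : MatTuple g n} (hX : ∀ s, X ∈ (δ.q s).dom n)
    (t : Fin δ.h) : (δ.q t).eval X = ∑ i, (δ.M i t • (1 : Matrix (Fin n) (Fin n) ℂ) +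
      ∑ j, (∑ k, δ.M i k * δ.Ξ k j t) • (δ.q j).eval X) * X i := by
  -- the row `R = e₀* P⁻¹`, where `P` is the common pencil of all `q s`
  obtain ⟨A, hA⟩ : ∃ A : Fin g → Matrix (Fin 1 ⊕ Fin δ.h) (Fin 1 ⊕ Fin δ.h) ℂ,
      A = fun i => Matrix.fromBlocks 0 (Matrix.of fun _ k => δ.M i k) 0 (∑ k, δ.M i k • δ.Ξ k) :=
    ⟨_, rfl⟩
  obtain ⟨P, hP⟩ : ∃ P : Matrix ((Fin 1 ⊕ Fin δ.h) × Fin n) ((Fin 1 ⊕ Fin δ.h) × Fin n) ℂ,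
      P = (δ.q t).pencil X X.adj := ⟨_, rfl⟩
  obtain ⟨R, hR⟩ : ∃ R : Matrix (Fin n) ((Fin 1 ⊕ Fin δ.h) × Fin n) ℂ,
      R = (colTensor (Pi.single (Sum.inl 0) 1 : Fin 1 ⊕ Fin δ.h → ℂ) n)ᴴ * P⁻¹ := ⟨_, rfl⟩
  have hPu : IsUnit P := hP ▸ hX t
  have hPe : P = 1 - tensorEval A X := by
    have h1 : tensorEval (0 : Fin g → Matrix (Fin 1 ⊕ Fin δ.h) (Fin 1 ⊕ Fin δ.h) ℂ) X.adj = 0 := by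
      simp [tensorEval]
    have h2 : P = (1 : Matrix (Fin 1 ⊕ Fin δ.h) (Fin 1 ⊕ Fin δ.h) ℂ) ⊗ₖ
        (1 : Matrix (Fin n) (Fin n) ℂ) - tensorEval A X -
        tensorEval (0 : Fin g → Matrix (Fin 1 ⊕ Fin δ.h) (Fin 1 ⊕ Fin δ.h) ℂ) X.adj := by
      rw [hP, hA]; rfl
    rw [h2, h1, sub_zero, Matrix.one_kronecker_one]
  have hRP : R - R * tensorEval A X =
      (colTensor (Pi.single (Sum.inl 0) 1 : Fin 1 ⊕ Fin δ.h → ℂ) n)ᴴ := by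
    have h1 : R * P = (colTensor (Pi.single (Sum.inl 0) 1 : Fin 1 ⊕ Fin δ.h → ℂ) n)ᴴ := by
      rw [hR, Matrix.mul_assoc, Matrix.nonsing_inv_mul _ ((Matrix.isUnit_iff_isUnit_det _).1 hPu),
        Matrix.mul_one]
    rw [← h1, hPe, Matrix.mul_sub, Matrix.mul_one]
  have hq : ∀ s, R * colTensor (Pi.single (Sum.inr s) 1 : Fin 1 ⊕ Fin δ.h → ℂ) n =
      (δ.q s).eval X := fun s => by
    rw [hR, hP]; rfl
  have hcol : ∀ w : Fin 1 ⊕ Fin δ.h → ℂ, R * colTensor w n =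
      (star (Pi.single (Sum.inl 0) 1 : Fin 1 ⊕ Fin δ.h → ℂ) ⬝ᵥ w) • 1 +
        ∑ i, R * colTensor (A i *ᵥ w) n * X i := by
    intro w
    have h1 := congrArg (· * colTensor w n) hRP
    simp only [Matrix.sub_mul] at h1
    rw [Matrix.mul_assoc, tensorEval_mul_colTensor, conjTranspose_colTensor_mul_colTensor,
      Matrix.mul_sum, sub_eq_iff_eq_add] at h1
    simpa only [Matrix.mul_assoc] using h1
  have hadd : ∀ w w' : Fin 1 ⊕ Fin δ.h → ℂ,
      colTensor (w + w') n = colTensor w n + colTensor w' n := by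
    intro w w'; ext; simp [colTensor, add_mul]
  have hsmul : ∀ (z : ℂ) (w : Fin 1 ⊕ Fin δ.h → ℂ), colTensor (z • w) n = z • colTensor w n := by
    intro z w; ext; simp [colTensor, mul_assoc]
  have hsum : ∀ w : Fin δ.h → Fin 1 ⊕ Fin δ.h → ℂ,
      colTensor (∑ j, w j) n = ∑ j, colTensor (w j) n := by
    intro w
    ext
    simp [colTensor, Finset.sum_apply, Matrix.sum_apply, Finset.sum_mul]
  have hA0 : ∀ i, A i *ᵥ (Pi.single (Sum.inl 0) 1 : Fin 1 ⊕ Fin δ.h → ℂ) = 0 := by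
    intro i
    rw [hA]
    ext (p | p) <;> simp
  have h0 : R * colTensor (Pi.single (Sum.inl 0) 1 : Fin 1 ⊕ Fin δ.h → ℂ) n = 1 := by
    rw [hcol]
    have : ∀ i, R * colTensor (A i *ᵥ (Pi.single (Sum.inl 0) 1 : Fin 1 ⊕ Fin δ.h → ℂ)) n *
        X i = 0 := by
      intro i
      rw [hA0]
      have : colTensor (0 : Fin 1 ⊕ Fin δ.h → ℂ) n = 0 := by ext; simp [colTensor]
      rw [this]; simp
    rw [Finset.sum_eq_zero fun i _ => this i]
    simp
  have hA1 : ∀ i, A i *ᵥ (Pi.single (Sum.inr t) 1 : Fin 1 ⊕ Fin δ.h → ℂ) =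
      δ.M i t • (Pi.single (Sum.inl 0) 1 : Fin 1 ⊕ Fin δ.h → ℂ) +
        ∑ j, (∑ k, δ.M i k * δ.Ξ k j t) • (Pi.single (Sum.inr j) 1 : Fin 1 ⊕ Fin δ.h → ℂ) := by
    intro i
    rw [hA]
    ext (p | p)
    · rw [Subsingleton.elim p 0]
      simp [Finset.sum_apply]
    · simp [Finset.sum_apply, Matrix.sum_apply, Pi.single_apply]
  rw [← hq t, hcol]
  have h2 : (star (Pi.single (Sum.inl 0) 1 : Fin 1 ⊕ Fin δ.h → ℂ) ⬝ᵥ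
      (Pi.single (Sum.inr t) 1 : Fin 1 ⊕ Fin δ.h → ℂ)) = 0 := by simp
  rw [h2, zero_smul, zero_add]
  refine Finset.sum_congr rfl fun i _ => ?_
  rw [hA1, hadd, hsmul, hsum, Matrix.mul_add, Matrix.mul_smul, h0, Matrix.mul_sum]
  congr 2
  refine Finset.sum_congr rfl fun j _ => ?_
  rw [hsmul, Matrix.mul_smul, hq]

open scoped Matrix.Norms.L2Operator in
theorem zero_mem_dom_q (δ : ConstructionData m) (n : ℕ) (s : Fin δ.h) :
    (0 : MatTuple g n) ∈ (δ.q s).dom n := by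
  obtain ⟨ε, hε, h⟩ := (δ.q s).exists_forall_norm_le_mem_dom
  exact h n 0 fun j => by simpa using hε.le

theorem evalMap_q_zero (δ : ConstructionData m) (n : ℕ) :
    DescriptorRealization.evalMap δ.q (0 : MatTuple g n) = 0 := by
  funext s
  rw [DescriptorRealization.evalMap, eval_q δ fun s => δ.zero_mem_dom_q n s]
  simp

/-- The convexotonic identity `(1 + Λ_C(q(X))) (1 - Λ_{KB}(X)) = 1`. -/
theorem one_add_mul_one_sub (δ : ConstructionData m) {n : ℕ} {X : MatTuple g n}
    (hX : ∀ s, X ∈ (δ.q s).dom n) :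
    (1 + tensorEval δ.C (DescriptorRealization.evalMap δ.q X)) *
      (1 - tensorEval (fun i => m.K * m.B i) X) = 1 := by
  set Q := tensorEval δ.C (DescriptorRealization.evalMap δ.q X) with hQ
  set T := tensorEval (fun i => m.K * m.B i) X with hT
  have hT' : T = ∑ i, ∑ s, δ.C s ⊗ₖ (δ.M i s • X i) := by
    rw [hT, tensorEval]
    refine Finset.sum_congr rfl fun i _ => ?_
    rw [δ.coord i]
    ext p q
    simp only [Matrix.kroneckerMap_apply, Matrix.sum_apply, Matrix.smul_apply, Finset.sum_mul]
    refine Finset.sum_congr rfl fun s _ => ?_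
    simp [mul_comm, mul_left_comm]
  have hQT : Q * T = ∑ i, ∑ s, δ.C s ⊗ₖ
      ((∑ j, (∑ k, δ.M i k * δ.Ξ k j s) • (δ.q j).eval X) * X i) := by
    have e1 : ∀ j i, δ.C j * (m.K * m.B i) = ∑ s, (∑ k, δ.M i k * δ.Ξ k j s) • δ.C s := by
      intro j i
      rw [δ.coord i, Matrix.mul_sum]
      simp only [Matrix.mul_smul, δ.mul_C, Finset.smul_sum, smul_smul, Finset.sum_smul]
      exact Finset.sum_comm
    rw [hQ, hT, tensorEval, tensorEval, Matrix.mul_sum]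
    refine Finset.sum_congr rfl fun i _ => ?_
    rw [Matrix.sum_mul]
    have e2 : ∀ j, δ.C j ⊗ₖ DescriptorRealization.evalMap δ.q X j * ((m.K * m.B i) ⊗ₖ X i) =
        ∑ s, δ.C s ⊗ₖ (((∑ k, δ.M i k * δ.Ξ k j s) • (δ.q j).eval X) * X i) := by
      intro j
      rw [← Matrix.mul_kronecker_mul, e1]
      ext p q
      simp only [Matrix.kroneckerMap_apply, Matrix.sum_apply, Matrix.smul_apply, Finset.sum_mul,
        Matrix.smul_mul, DescriptorRealization.evalMap, smul_eq_mul]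
      refine Finset.sum_congr rfl fun s _ => ?_
      rw [Finset.mul_sum]
      refine Finset.sum_congr rfl fun k _ => ?_
      ring
    simp only [e2]
    rw [Finset.sum_comm]
    refine Finset.sum_congr rfl fun s _ => ?_
    rw [Matrix.sum_mul]
    ext p q
    simp only [Matrix.kroneckerMap_apply, Matrix.sum_apply, Finset.mul_sum]
  have hQ' : Q = T + Q * T := by
    rw [hQT, hT', ← Finset.sum_add_distrib]
    simp only [← Finset.sum_add_distrib, ← Matrix.kronecker_add]
    rw [Finset.sum_comm, hQ, tensorEval]
    refine Finset.sum_congr rfl fun s _ => ?_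
    rw [DescriptorRealization.evalMap, eval_q δ hX s]
    ext p q
    simp only [Matrix.kroneckerMap_apply, Matrix.sum_apply, Finset.mul_sum]
    refine Finset.sum_congr rfl fun i _ => ?_
    rw [Matrix.add_mul, Matrix.smul_mul, Matrix.one_mul]
  rw [Matrix.mul_sub, Matrix.mul_one, Matrix.add_mul, Matrix.one_mul]
  nth_rewrite 1 [hQ']
  abel

end ConstructionData

namespace Matrix

/-- The algebra relating the blocks of `f` to those of the realization of `r`. Here `Q` is
`Λ_C(q(X))`, `E₁ = D† [I ρ*] Q` and `E₂ = Q K [I; ρ_*] D_*†` factor the semidefinite forms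
`Q* K Q` and `Q K Q*`, and `F` is the wing of the butterfly. -/
structure ButterflyBlocks {D P : Type*} [Fintype D] [DecidableEq D] [Fintype P]
    (K Q : Matrix D D ℂ) (E₁ : Matrix P D ℂ) (E₂ : Matrix D P ℂ) (F : Matrix P P ℂ) : Prop where
  mul_self : K * K = 1
  hermitian : Kᴴ = K
  gram_left : E₁ᴴ * E₁ = Qᴴ * K * Q
  gram_right : E₂ * E₂ᴴ = Q * K * Qᴴ
  mul_adj : E₁ * K * Qᴴ = F * E₂ᴴ
  mul_self_adj : E₁ * K * E₁ᴴ = F * Fᴴ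
  sq_zero : F * F = 0
  mul_left_zero : F * E₁ = 0
  right_mul_zero : E₂ * F = 0
  right_mul_left_zero : E₂ * E₁ = 0

namespace ButterflyBlocks

variable {D P : Type*} [Fintype D] [DecidableEq D] [Fintype P]
  {K Q : Matrix D D ℂ} {E₁ : Matrix P D ℂ} {E₂ : Matrix D P ℂ} {F : Matrix P P ℂ}

theorem eq_add (h : ButterflyBlocks K Q E₁ E₂ F) {M : Type*} {ω b : Matrix D M ℂ}
    (hω : (K - Qᴴ * K * Q) * ω = b) : ω = K * (E₁ᴴ * (E₁ * ω)) + K * b := by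
  rw [← hω, Matrix.sub_mul, ← h.gram_left, ← Matrix.mul_add, Matrix.mul_assoc E₁ᴴ, add_sub_cancel,
    ← Matrix.mul_assoc, h.mul_self, Matrix.one_mul]

/-- The value `c* (1 + Q) ω` of `r` in butterfly form. -/
theorem value (h : ButterflyBlocks K Q E₁ E₂ F) {M : Type*} [Fintype M] {ω c : Matrix D M ℂ}
    (hω : (K - Qᴴ * K * Q) * ω = (1 + Qᴴ) * c) :
    cᴴ * ((1 + Q) * ω) = cᴴ * K * c + ((E₁ * K * c + (cᴴ * E₂)ᴴ)ᴴ *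
      (E₁ * ω + Fᴴ * (E₁ * ω) + E₂ᴴ * c) + (cᴴ * Q * K * c + (cᴴ * Q * K * c)ᴴ)) := by
  have a1 : E₁ᴴ * (Fᴴ * (E₁ * ω)) = 0 := by
    rw [← Matrix.mul_assoc, ← Matrix.conjTranspose_mul, h.mul_left_zero, Matrix.conjTranspose_zero,
      Matrix.zero_mul]
  have a2 : E₁ᴴ * (E₂ᴴ * c) = 0 := by
    rw [← Matrix.mul_assoc, ← Matrix.conjTranspose_mul, h.right_mul_left_zero,
      Matrix.conjTranspose_zero, Matrix.zero_mul]
  have a3 : E₂ * (E₁ * ω) = 0 := by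
    rw [← Matrix.mul_assoc, h.right_mul_left_zero, Matrix.zero_mul]
  have a4 : ∀ Z : Matrix P M ℂ, Q * (K * (E₁ᴴ * Z)) = E₂ * (Fᴴ * Z) := by
    intro Z
    have := congrArg Matrix.conjTranspose h.mul_adj
    simp only [Matrix.conjTranspose_mul, Matrix.conjTranspose_conjTranspose, h.hermitian] at this
    have h' := congrArg (· * Z) this
    simpa only [Matrix.mul_assoc] using h'
  have a5 : ∀ Z : Matrix D M ℂ, Q * (K * (Qᴴ * Z)) = E₂ * (E₂ᴴ * Z) := by
    intro Z
    have h' := congrArg (· * Z) h.gram_right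
    simpa only [Matrix.mul_assoc] using h'.symm
  have hω' := h.eq_add hω
  have e : (1 + Q) * ω = K * (E₁ᴴ * (E₁ * ω)) + K * c + K * (Qᴴ * c) +
      (E₂ * (Fᴴ * (E₁ * ω)) + Q * (K * c) + E₂ * (E₂ᴴ * c)) := by
    rw [← a4, ← a5, Matrix.add_mul, Matrix.one_mul]
    have e1 : ω = K * (E₁ᴴ * (E₁ * ω)) + K * c + K * (Qᴴ * c) := by
      nth_rewrite 1 [hω']
      rw [Matrix.add_mul, Matrix.one_mul, Matrix.mul_add, add_assoc]
    have e2 : Q * ω = Q * (K * (E₁ᴴ * (E₁ * ω))) + Q * (K * c) + Q * (K * (Qᴴ * c)) := by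
      nth_rewrite 1 [e1]
      rw [Matrix.mul_add, Matrix.mul_add]
    rw [e2, ← e1]
  rw [e]
  simp only [Matrix.conjTranspose_add, Matrix.conjTranspose_mul, Matrix.conjTranspose_conjTranspose,
    h.hermitian, Matrix.add_mul, Matrix.mul_add, Matrix.mul_assoc, a1, a2, a3, Matrix.mul_zero,
    add_zero, zero_add]
  abel

variable [DecidableEq P]

theorem one_sub_mul (h : ButterflyBlocks K Q E₁ E₂ F) {M : Type*} {ω b : Matrix D M ℂ}
    (hω : (K - Qᴴ * K * Q) * ω = b) :
    (1 - (F + Fᴴ)) * (E₁ * ω + Fᴴ * (E₁ * ω)) = E₁ * (K * b) := by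
  have h1 : E₁ * ω = F * (Fᴴ * (E₁ * ω)) + E₁ * (K * b) := by
    nth_rewrite 1 [h.eq_add hω]
    rw [Matrix.mul_add, ← Matrix.mul_assoc E₁ K, ← Matrix.mul_assoc (E₁ * K), h.mul_self_adj,
      Matrix.mul_assoc F]
  have h2 : F * (E₁ * ω) = 0 := by rw [← Matrix.mul_assoc, h.mul_left_zero, Matrix.zero_mul]
  have h3 : Fᴴ * (Fᴴ * (E₁ * ω)) = 0 := by
    rw [← Matrix.mul_assoc, ← Matrix.conjTranspose_mul, h.sq_zero, Matrix.conjTranspose_zero,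
      Matrix.zero_mul]
  rw [Matrix.sub_mul, Matrix.one_mul, Matrix.add_mul, Matrix.mul_add, Matrix.mul_add, h2, h3,
    ← sub_eq_iff_eq_add'.2 h1]
  abel

/-- If the reduced matrix `1 - (F + F*)` of `f` has no kernel, then `K - Q* K Q` has none. -/
theorem eq_zero (h : ButterflyBlocks K Q E₁ E₂ F) {M : Type*} {ω : Matrix D M ℂ}
    (hF : ∀ U : Matrix P M ℂ, (1 - (F + Fᴴ)) * U = 0 → U = 0)
    (hω : (K - Qᴴ * K * Q) * ω = 0) : ω = 0 := by
  have h1 := hF _ ((h.one_sub_mul hω).trans (by simp))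
  have h3 : Fᴴ * (Fᴴ * (E₁ * ω)) = 0 := by
    rw [← Matrix.mul_assoc, ← Matrix.conjTranspose_mul, h.sq_zero, Matrix.conjTranspose_zero,
      Matrix.zero_mul]
  have h4 : Fᴴ * (E₁ * ω) = 0 := by
    have := congrArg (Fᴴ * ·) h1
    simpa [Matrix.mul_add, h3] using this
  rw [h4, add_zero] at h1
  rw [h.eq_add hω, h1]
  simp

/-- A solution `ω` of the system of `r` yields a solution of the reduced system of `f`. -/
theorem solution (h : ButterflyBlocks K Q E₁ E₂ F) {M : Type*} [Fintype M] {ω c : Matrix D M ℂ}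
    (hω : (K - Qᴴ * K * Q) * ω = (1 + Qᴴ) * c) :
    (1 - (F + Fᴴ)) * (E₁ * ω + Fᴴ * (E₁ * ω) + E₂ᴴ * c) = E₁ * K * c + (cᴴ * E₂)ᴴ := by
  have h1 : Fᴴ * (E₂ᴴ * c) = 0 := by
    rw [← Matrix.mul_assoc, ← Matrix.conjTranspose_mul, h.right_mul_zero, Matrix.conjTranspose_zero,
      Matrix.zero_mul]
  have h2 : E₁ * (K * ((1 + Qᴴ) * c)) = E₁ * K * c + F * (E₂ᴴ * c) := by
    rw [Matrix.add_mul, Matrix.one_mul, Matrix.mul_add, Matrix.mul_add, ← Matrix.mul_assoc E₁ K,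
      ← Matrix.mul_assoc E₁ K, ← Matrix.mul_assoc (E₁ * K), h.mul_adj, Matrix.mul_assoc F]
  rw [Matrix.mul_add, h.one_sub_mul hω, h2, Matrix.sub_mul, Matrix.one_mul, Matrix.add_mul, h1,
    Matrix.conjTranspose_mul, Matrix.conjTranspose_conjTranspose]
  abel

end ButterflyBlocks

end Matrix

namespace ConstructionData

variable {g : ℕ} {m : SymmetricRealization g} (δ : ConstructionData m)

theorem butterflyBlocks {n : ℕ} (Y : MatTuple δ.h n) :
    Matrix.ButterflyBlocks (m.K ⊗ₖ (1 : Matrix (Fin n) (Fin n) ℂ)) (tensorEval δ.C Y)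
      ((δ.ψtop ⊗ₖ (1 : Matrix (Fin n) (Fin n) ℂ)) * tensorEval δ.C Y)
      (tensorEval δ.C Y * (m.K ⊗ₖ (1 : Matrix (Fin n) (Fin n) ℂ)) *
        (δ.ψsleft ⊗ₖ (1 : Matrix (Fin n) (Fin n) ℂ)))
      (δ.wing (tensorEval δ.C Y)) := by
  have g1 := δ.gram_ψtop Y
  have g2 := δ.gram_ψsleft Y
  have hz : (δ.ψsleft ⊗ₖ (1 : Matrix (Fin n) (Fin n) ℂ)) *
      (δ.ψtop ⊗ₖ (1 : Matrix (Fin n) (Fin n) ℂ)) = 0 := by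
    rw [← Matrix.mul_kronecker_mul, ψsleft_mul_ψtop, Matrix.zero_kronecker]
  have hKK : (m.K ⊗ₖ (1 : Matrix (Fin n) (Fin n) ℂ)) * (m.K ⊗ₖ (1 : Matrix (Fin n) (Fin n) ℂ)) =
      1 := by
    rw [← Matrix.mul_kronecker_mul, K_mul_K, Matrix.one_mul, Matrix.one_kronecker_one]
  have hKh : (m.K ⊗ₖ (1 : Matrix (Fin n) (Fin n) ℂ))ᴴ = m.K ⊗ₖ (1 : Matrix (Fin n) (Fin n) ℂ) := by
    rw [Matrix.conjTranspose_kronecker, conjTranspose_K, Matrix.conjTranspose_one]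
  rw [wing]
  generalize tensorEval δ.C Y = Q at *
  generalize m.K ⊗ₖ (1 : Matrix (Fin n) (Fin n) ℂ) = K at *
  generalize δ.ψtop ⊗ₖ (1 : Matrix (Fin n) (Fin n) ℂ) = p at *
  generalize δ.ψsleft ⊗ₖ (1 : Matrix (Fin n) (Fin n) ℂ) = s at *
  have hz' : ∀ {M : Type} (Z : Matrix ((Fin m.a ⊕ Fin m.b) × Fin n) M ℂ), s * (p * Z) = 0 := by
    intro M Z
    rw [← Matrix.mul_assoc, hz, Matrix.zero_mul]
  have h2 : p * Q * K * Qᴴ = p * Q * K * s * (Q * K * s)ᴴ := by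
    have := congrArg (p * ·) g2
    simpa only [Matrix.mul_assoc] using this.symm
  refine
    { mul_self := hKK
      hermitian := hKh
      gram_left := g1
      gram_right := g2
      mul_adj := h2
      mul_self_adj := ?_
      sq_zero := ?_
      mul_left_zero := ?_
      right_mul_zero := ?_
      right_mul_left_zero := ?_ }
  · have := congrArg (· * pᴴ) h2
    simp only [Matrix.conjTranspose_mul, Matrix.mul_assoc] at this ⊢
    exact this
  all_goals simp only [Matrix.mul_assoc, hz', Matrix.mul_zero]

/-- Wherever `q` and `f ∘ q` are defined, so is the realization of `r`, with the same value. -/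
theorem mem_dom_and_eval_eq {n : ℕ} {X : MatTuple g n} (hX : ∀ s, X ∈ (δ.q s).dom n)
    (hY : DescriptorRealization.evalMap δ.q X ∈ δ.f.dom n) :
    X ∈ m.toDescriptor.dom n ∧
      m.toDescriptor.eval X = δ.f.eval (DescriptorRealization.evalMap δ.q X) := by
  have hQT := δ.one_add_mul_one_sub hX
  have hf : ∀ U : Matrix ((Fin m.a ⊕ Fin m.a) × Fin n) (Fin n) ℂ, _ → _ :=
    fun U => δ.eval_f hY (U := U)
  have hb := δ.butterflyBlocks (DescriptorRealization.evalMap δ.q X)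
  have hzero : ∀ U : Matrix ((Fin m.a ⊕ Fin m.a) × Fin n) Unit ℂ,
      (1 - (δ.wing (tensorEval δ.C (DescriptorRealization.evalMap δ.q X)) +
        (δ.wing (tensorEval δ.C (DescriptorRealization.evalMap δ.q X)))ᴴ)) * U = 0 → U = 0 := by
    intro U hU
    have hP : IsUnit (δ.f.pencil (DescriptorRealization.evalMap δ.q X)
      (DescriptorRealization.evalMap δ.q X).adj) := hY
    rw [pencil_f] at hP
    exact (butterflyFrame m n).eq_zero hU hP
  generalize DescriptorRealization.evalMap δ.q X = Y at *
  generalize tensorEval δ.C Y = Q at *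
  obtain ⟨K, hK⟩ : ∃ K, K = m.K ⊗ₖ (1 : Matrix (Fin n) (Fin n) ℂ) := ⟨_, rfl⟩
  obtain ⟨T, hT⟩ : ∃ T, T = tensorEval (fun i => m.K * m.B i) X := ⟨_, rfl⟩
  rw [← hK] at hb
  rw [← hT] at hQT
  have hTQ : (1 - T) * (1 + Q) = 1 := mul_eq_one_comm.1 hQT
  have hG : tensorEval m.B X = K * T := by
    rw [hK, hT, kronecker_one_mul_tensorEval]
    congr 1
    funext j
    rw [← Matrix.mul_assoc, K_mul_K, Matrix.one_mul]
  obtain ⟨Pm, hPm⟩ : ∃ Pm : Matrix ((Fin m.a ⊕ Fin m.b) × Fin n) ((Fin m.a ⊕ Fin m.b) × Fin n) ℂ,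
      Pm = m.toDescriptor.pencil X X.adj := ⟨_, rfl⟩
  have hp : Pm = K - K * T - (K * T)ᴴ := by
    rw [hPm, ← hG, hK, conjTranspose_tensorEval]; rfl
  have hQS : Q * (1 - T) = T := by
    rw [Matrix.add_mul, Matrix.one_mul] at hQT
    exact (eq_sub_of_add_eq' hQT).trans (by abel)
  -- the congruence `K - KT - T*K = (1 - T)* (K - Q*KQ) (1 - T)`
  have hp2 : Pm = (1 - T)ᴴ * (K - Qᴴ * K * Q) * (1 - T) := by
    have e1 : (1 - T)ᴴ * (K - Qᴴ * K * Q) * (1 - T) =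
        (1 - T)ᴴ * K * (1 - T) - (Q * (1 - T))ᴴ * K * (Q * (1 - T)) := by
      rw [Matrix.mul_sub (1 - T)ᴴ K, Matrix.sub_mul _ _ (1 - T), Matrix.conjTranspose_mul]
      simp only [Matrix.mul_assoc]
    rw [hp, e1, hQS, Matrix.conjTranspose_mul, hb.hermitian, Matrix.conjTranspose_sub,
      Matrix.conjTranspose_one]
    simp only [Matrix.mul_sub, Matrix.sub_mul, Matrix.mul_assoc, Matrix.one_mul, Matrix.mul_one]
    abel
  have hN : IsUnit (K - Qᴴ * K * Q) :=
    Matrix.isUnit_of_forall_mul_eq_zero fun ω hω => hb.eq_zero hzero hω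
  have hS : IsUnit (1 - T) := IsUnit.of_mul_eq_one _ hTQ
  have hSh : IsUnit (1 - T)ᴴ := by
    refine IsUnit.of_mul_eq_one (1 + Q)ᴴ ?_
    rw [← Matrix.conjTranspose_mul, hQT, Matrix.conjTranspose_one]
  have hu : IsUnit (Pm) := by
    rw [hp2]
    exact (hSh.mul hN).mul hS
  refine ⟨show IsUnit (m.toDescriptor.pencil X X.adj) from hPm ▸ hu, ?_⟩
  obtain ⟨c, hc⟩ : ∃ c, c = colTensor m.c n := ⟨_, rfl⟩
  obtain ⟨ω, hω⟩ : ∃ ω, ω = (K - Qᴴ * K * Q)⁻¹ * ((1 + Qᴴ) * c) := ⟨_, rfl⟩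
  have hω' : (K - Qᴴ * K * Q) * ω = (1 + Qᴴ) * c := by
    rw [hω, ← Matrix.mul_assoc, Matrix.mul_nonsing_inv _ ((Matrix.isUnit_iff_isUnit_det _).1 hN),
      Matrix.one_mul]
  have hsol : Pm * ((1 + Q) * ω) = c := by
    rw [hp2, Matrix.mul_assoc, ← Matrix.mul_assoc (1 - T), hTQ, Matrix.one_mul, Matrix.mul_assoc,
      hω', ← Matrix.mul_assoc]
    have : (1 - T)ᴴ * (1 + Qᴴ) = 1 := by
      have := congrArg Matrix.conjTranspose hQT
      rwa [Matrix.conjTranspose_mul, Matrix.conjTranspose_one, Matrix.conjTranspose_add,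
        Matrix.conjTranspose_one] at this
    rw [this, Matrix.one_mul]
  have hinv : Pm⁻¹ * c = (1 + Q) * ω := by
    have h1 := Matrix.nonsing_inv_mul _ ((Matrix.isUnit_iff_isUnit_det _).1 hu)
    have h2 := congrArg (Pm⁻¹ * ·) hsol
    rw [← Matrix.mul_assoc, h1] at h2
    exact h2.symm.trans (Matrix.one_mul _)
  have heval : m.toDescriptor.eval X = cᴴ * ((1 + Q) * ω) := by
    rw [← hinv, ← Matrix.mul_assoc, hc, hPm]; rfl
  have hκ : cᴴ * K * c = valueAtZero m • 1 := by
    rw [hc, hK, Matrix.mul_assoc, kronecker_one_mul_colTensor,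
      conjTranspose_colTensor_mul_colTensor, valueAtZero]
  rw [heval, hb.value hω', hκ, hf _ ((hb.solution hω').trans ?_)]
  · simp only [bodyLeft, bodyRight, head, hc, hK, Matrix.mul_assoc]
  · simp only [bodyLeft, bodyRight, hc, hK, Matrix.mul_assoc]

/-- Every choice of the data factors `r` through a convex and an analytic function. -/
theorem isConvexAnalyticComposite {r : DescriptorRealization g}
    (hr : r.Equivalent m.toDescriptor) : r.IsConvexAnalyticComposite δ.f δ.q where
  symmetric := δ.isSymmetric_f
  convex := δ.isConvexNearZero_f
  analytic := fun _ _ => rfl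
  map_zero := δ.evalMap_q_zero
  comp := by
    intro n X hXr hXq hXf
    obtain ⟨h1, h2⟩ := δ.mem_dom_and_eval_eq hXq hXf
    rw [hr n X hXr h1, h2]

end ConstructionData

/-! ### Existence of the angular operators and of the remaining choices -/

namespace Matrix

theorem IsHermitian.exists_diagonalization {n : Type*} [Fintype n] [DecidableEq n]
    {M : Matrix n n ℂ} (hM : M.IsHermitian) : ∃ (U : Matrix n n ℂ) (l : n → ℝ),
      Uᴴ * U = 1 ∧ U * Uᴴ = 1 ∧ M = U * diagonal (fun i => (l i : ℂ)) * Uᴴ ∧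
      (M.PosSemidef → ∀ i, 0 ≤ l i) := by
  refine ⟨hM.eigenvectorUnitary, hM.eigenvalues, ?_, ?_, ?_, fun h i => h.eigenvalues_nonneg i⟩
  · exact Unitary.coe_star_mul_self hM.eigenvectorUnitary
  · exact Unitary.coe_mul_star_self hM.eigenvectorUnitary
  · have := hM.spectral_theorem
    rwa [Unitary.conjStarAlgAut_apply] at this

/-- A positive semidefinite matrix has a positive semidefinite square root with a Moore-Penrose
inverse. -/
theorem PosSemidef.exists_sqrt_pinv {a : ℕ} {M : Matrix (Fin a) (Fin a) ℂ} (hM : M.PosSemidef) :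
    ∃ D E : Matrix (Fin a) (Fin a) ℂ, D.PosSemidef ∧ D * D = M ∧ IsMoorePenroseInverse D E := by
  obtain ⟨U, l, hU, -, hMU, hl⟩ := hM.isHermitian.exists_diagonalization
  replace hl := hl hM
  let φ : (Fin a → ℝ) → Matrix (Fin a) (Fin a) ℂ :=
    fun f => U * diagonal (fun i => (f i : ℂ)) * Uᴴ
  have hmul : ∀ f k, φ f * φ k = φ (f * k) := by
    intro f k
    simp only [φ]
    calc U * diagonal (fun i => (f i : ℂ)) * Uᴴ * (U * diagonal (fun i => (k i : ℂ)) * Uᴴ)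
        = U * diagonal (fun i => (f i : ℂ)) * (Uᴴ * U) * diagonal (fun i => (k i : ℂ)) * Uᴴ := by
          simp only [Matrix.mul_assoc]
      _ = U * (diagonal (fun i => (f i : ℂ)) * diagonal (fun i => (k i : ℂ))) * Uᴴ := by
          rw [hU, Matrix.mul_one, Matrix.mul_assoc U]
      _ = _ := by
          rw [diagonal_mul_diagonal]
          simp
  have hherm : ∀ f, (φ f)ᴴ = φ f := by
    intro f
    simp only [φ, conjTranspose_mul, conjTranspose_conjTranspose, diagonal_conjTranspose,
      Matrix.mul_assoc]
    congr 3
    ext i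
    simp
  refine ⟨φ fun i => Real.sqrt (l i), φ fun i => (Real.sqrt (l i))⁻¹, ?_, ?_, ?_⟩
  · refine PosSemidef.mul_mul_conjTranspose_same (PosSemidef.diagonal fun i => ?_) U
    exact Complex.zero_le_real.2 (Real.sqrt_nonneg _)
  · rw [hmul, hMU]
    have : (fun i => Real.sqrt (l i)) * (fun i => Real.sqrt (l i)) = l := by
      funext i; exact Real.mul_self_sqrt (hl i)
    rw [this]
  · refine ⟨?_, ?_, ?_, ?_⟩
    · rw [hmul, hmul]; congr 1; funext i; exact mul_inv_mul_cancel _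
    · rw [hmul, hmul]; congr 1; funext i
      simpa using mul_inv_mul_cancel (Real.sqrt (l i))⁻¹
    · rw [hmul, hherm]
    · rw [hmul, hherm]

end Matrix

theorem star_dotProduct_signature_mulVec {a b : ℕ} (z : Fin a ⊕ Fin b → ℂ) :
    star z ⬝ᵥ (signatureMatrix a b *ᵥ z) =
      ((∑ i, ‖z (Sum.inl i)‖ ^ 2 - ∑ i, ‖z (Sum.inr i)‖ ^ 2 : ℝ) : ℂ) := by
  simp [signatureMatrix, Matrix.mulVec, dotProduct, Matrix.one_apply,
    Complex.conj_mul', sub_eq_add_neg, Finset.sum_neg_distrib]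

/-- Every subspace that is nonnegative for the signature form lies in the graph of a contraction. -/
theorem exists_angularOperator {a b : ℕ} (S : Submodule ℂ (Fin a ⊕ Fin b → ℂ))
    (hS : ∀ z ∈ S, 0 ≤ star z ⬝ᵥ (signatureMatrix a b *ᵥ z)) :
    ∃ P : AngularOperator a b, S ≤ LinearMap.range P.col.mulVecLin := by
  let π₁ : S →ₗ[ℂ] EuclideanSpace ℂ (Fin a) :=
    (WithLp.linearEquiv 2 ℂ (Fin a → ℂ)).symm.toLinearMap ∘ₗ
      LinearMap.funLeft ℂ ℂ Sum.inl ∘ₗ S.subtype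
  let π₂ : S →ₗ[ℂ] EuclideanSpace ℂ (Fin b) :=
    (WithLp.linearEquiv 2 ℂ (Fin b → ℂ)).symm.toLinearMap ∘ₗ
      LinearMap.funLeft ℂ ℂ Sum.inr ∘ₗ S.subtype
  have hπ₁ : ∀ z i, π₁ z i = z.1 (Sum.inl i) := fun z i => rfl
  have hπ₂ : ∀ z i, π₂ z i = z.1 (Sum.inr i) := fun z i => rfl
  have hle : ∀ z, ‖π₂ z‖ ≤ ‖π₁ z‖ := by
    intro z
    have h := hS z z.2
    rw [star_dotProduct_signature_mulVec, Complex.zero_le_real, sub_nonneg] at h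
    rw [← sq_le_sq₀ (norm_nonneg _) (norm_nonneg _), EuclideanSpace.norm_sq_eq,
      EuclideanSpace.norm_sq_eq]
    simpa only [hπ₁, hπ₂] using h
  obtain ⟨s, hs⟩ := π₁.rangeRestrict.exists_rightInverse_of_surjective π₁.range_rangeRestrict
  have hs' : ∀ u : LinearMap.range π₁, π₁ (s u) = u := fun u =>
    congrArg Subtype.val (LinearMap.congr_fun hs u)
  -- the contraction is extended by zero to the orthogonal complement of the projection of `S`
  let R : EuclideanSpace ℂ (Fin a) →ₗ[ℂ] EuclideanSpace ℂ (Fin b) :=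
    π₂ ∘ₗ s ∘ₗ ((LinearMap.range π₁).orthogonalProjectionOnto : _ →ₗ[ℂ] _)
  have hR : ∀ z, R (π₁ z) = π₂ z := by
    intro z
    have h1 : (LinearMap.range π₁).orthogonalProjectionOnto (π₁ z) = ⟨π₁ z, z, rfl⟩ :=
      Submodule.orthogonalProjectionOnto_mem_subspace_eq_self (K := LinearMap.range π₁)
        ⟨π₁ z, z, rfl⟩
    change π₂ (s ((LinearMap.range π₁).orthogonalProjectionOnto (π₁ z))) = π₂ z
    rw [h1, ← sub_eq_zero, ← map_sub, ← norm_le_zero_iff]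
    refine (hle _).trans ?_
    rw [map_sub, hs', sub_self, norm_zero]
  have hRn : ∀ u, ‖R u‖ ≤ ‖u‖ := by
    intro u
    change ‖π₂ (s ((LinearMap.range π₁).orthogonalProjectionOnto u))‖ ≤ ‖u‖
    refine (hle _).trans ?_
    rw [hs']
    exact Submodule.norm_orthogonalProjectionOnto_apply_le _ u
  let ρ : Matrix (Fin b) (Fin a) ℂ := Matrix.toEuclideanLin.symm R
  have hρ : ∀ u : Fin a → ℂ, ∀ i, (ρ *ᵥ u) i = R (WithLp.toLp 2 u) i := by
    intro u i
    have : Matrix.toEuclideanLin ρ = R := LinearEquiv.apply_symm_apply _ _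
    rw [← this]
    rfl
  have hcontr : (1 - ρᴴ * ρ).PosSemidef := by
    refine Matrix.PosSemidef.of_dotProduct_mulVec_nonneg ?_ fun x => ?_
    · exact (Matrix.isHermitian_one).sub (Matrix.isHermitian_conjTranspose_mul_self ρ)
    · have h1 : star x ⬝ᵥ ((1 - ρᴴ * ρ) *ᵥ x) = star x ⬝ᵥ x - star (ρ *ᵥ x) ⬝ᵥ (ρ *ᵥ x) := by
        rw [Matrix.sub_mulVec, Matrix.one_mulVec, dotProduct_sub, ← Matrix.mulVec_mulVec,
          Matrix.star_mulVec, ← Matrix.dotProduct_mulVec]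
      have h2 : ∀ {k : ℕ} (y : Fin k → ℂ), star y ⬝ᵥ y = ((∑ i, ‖y i‖ ^ 2 : ℝ) : ℂ) := by
        intro k y
        simp [dotProduct, Complex.conj_mul']
      have h3 := hRn (WithLp.toLp 2 x)
      rw [← sq_le_sq₀ (norm_nonneg _) (norm_nonneg _), EuclideanSpace.norm_sq_eq,
        EuclideanSpace.norm_sq_eq] at h3
      rw [h1, h2, h2, ← Complex.ofReal_sub, Complex.zero_le_real, sub_nonneg]
      simpa only [hρ] using h3
  obtain ⟨D, E, hD, hDD, hE⟩ := hcontr.exists_sqrt_pinv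
  refine ⟨⟨ρ, D, E, hcontr, hD, hDD, hE⟩, fun z hz => ⟨fun i => z (Sum.inl i), ?_⟩⟩
  rw [Matrix.mulVecLin_apply, AngularOperator.col]
  funext i
  rcases i with i | i
  · simp [Matrix.fromRows_mulVec]
  · rw [Matrix.fromRows_mulVec, Sum.elim_inr, hρ]
    have := congrArg (fun v => v i) (hR ⟨z, hz⟩)
    exact this

namespace SymmetricRealization

variable {g : ℕ}

/-- Nonnegativity of the sum of the ranges gives a common angular operator. -/
theorem exists_angularOperator_containsRange (m : SymmetricRealization g)
    (B : Fin g → Matrix (Fin m.a ⊕ Fin m.b) (Fin m.a ⊕ Fin m.b) ℂ)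
    (hB : ∀ x : Fin g → Fin m.a ⊕ Fin m.b → ℂ,
      0 ≤ star (∑ j, B j *ᵥ x j) ⬝ᵥ (m.K *ᵥ ∑ j, B j *ᵥ x j)) :
    ∃ P : AngularOperator m.a m.b, ∀ j, P.ContainsRange (B j) := by
  let φ : (Fin g → Fin m.a ⊕ Fin m.b → ℂ) →ₗ[ℂ] (Fin m.a ⊕ Fin m.b → ℂ) :=
    ∑ j, (B j).mulVecLin ∘ₗ LinearMap.proj j
  have hφ : ∀ x, φ x = ∑ j, B j *ᵥ x j := fun x => by simp [φ]
  obtain ⟨P, hP⟩ := exists_angularOperator (LinearMap.range φ) (by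
    rintro _ ⟨x, rfl⟩
    rw [hφ]
    exact hB x)
  refine ⟨P, fun j => le_trans ?_ hP⟩
  rintro _ ⟨u, rfl⟩
  refine ⟨Pi.single j u, ?_⟩
  rw [hφ, Matrix.mulVecLin_apply, Finset.sum_eq_single j]
  · simp
  · intro i _ hi; simp [hi]
  · simp

theorem nonempty_constructionData (m : SymmetricRealization g)
    (hB : ∀ x : Fin g → Fin m.a ⊕ Fin m.b → ℂ,
      0 ≤ star (∑ j, m.B j *ᵥ x j) ⬝ᵥ (m.K *ᵥ ∑ j, m.B j *ᵥ x j))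
    (hB' : ∀ x : Fin g → Fin m.a ⊕ Fin m.b → ℂ,
      0 ≤ star (∑ j, (m.B j)ᴴ *ᵥ x j) ⬝ᵥ (m.K *ᵥ ∑ j, (m.B j)ᴴ *ᵥ x j)) :
    Nonempty (ConstructionData m) := by
  obtain ⟨P, hP⟩ := m.exists_angularOperator_containsRange _ hB
  obtain ⟨Ps, hPs⟩ := m.exists_angularOperator_containsRange (fun j => (m.B j)ᴴ) hB'
  let S := NonUnitalAlgebra.adjoin ℂ (Set.range fun j => m.K * m.B j)
  let β := Module.finBasis ℂ S.toSubmodule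
  let C : Fin (Module.finrank ℂ S.toSubmodule) →
    Matrix (Fin m.a ⊕ Fin m.b) (Fin m.a ⊕ Fin m.b) ℂ := fun s => (β s : Matrix _ _ ℂ)
  have hrepr : ∀ Z ∈ S.toSubmodule, ∃ c : Fin (Module.finrank ℂ S.toSubmodule) → ℂ,
      Z = ∑ s, c s • C s := by
    intro Z hZ
    refine ⟨β.repr ⟨Z, hZ⟩, ?_⟩
    have := congrArg Subtype.val (β.sum_repr ⟨Z, hZ⟩)
    rw [Submodule.coe_sum] at this
    exact this.symm
  have hCmem : ∀ s, C s ∈ S.toSubmodule := fun s => (β s).2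
  have hmul : ∀ j k, C j * C k ∈ S.toSubmodule := fun j k => S.mul_mem (hCmem j) (hCmem k)
  have hKB : ∀ i, m.K * m.B i ∈ S.toSubmodule := fun i =>
    NonUnitalAlgebra.subset_adjoin ℂ ⟨i, rfl⟩
  choose ξ hξ using fun j k => hrepr _ (hmul j k)
  choose μ hμ using fun i => hrepr _ (hKB i)
  exact ⟨{
    P := P
    Ps := Ps
    range_le := hP
    range_le_adj := hPs
    h := Module.finrank ℂ S.toSubmodule
    C := C
    linearIndependent_C := β.linearIndependent.map' S.toSubmodule.subtype
      (Submodule.ker_subtype _)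
    span_C := by
      have h1 : Set.range C = S.toSubmodule.subtype '' Set.range β := by
        rw [← Set.range_comp]; rfl
      rw [h1, Submodule.span_image, β.span_eq, Submodule.map_top, Submodule.range_subtype]
    Ξ := fun k => Matrix.of fun j s => ξ j k s
    mul_C := hξ
    M := Matrix.of μ
    coord := hμ }⟩

end SymmetricRealization

/-! ### States of a realization, and their slices -/

section States

open scoped Matrix.Norms.L2Operator
open Filter Topology

variable {g : ℕ} {ι N : Type} [Fintype ι] [DecidableEq ι] [Fintype N] [DecidableEq N]

/-- `Z - ∑ⱼ Xⱼ Z Tⱼᵀ - ∑ⱼ Xⱼ* Z T'ⱼᵀ`: the operator `I - Λ_T(X) - Λ_{T'}(X*)` acting on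
`ℂ^ι ⊗ ℂ^N`, whose elements are written as `N × ι` matrices. -/
def stateOp (T T' : Fin g → Matrix ι ι ℂ) (X : Fin g → Matrix N N ℂ) (Z : Matrix N ι ℂ) :
    Matrix N ι ℂ :=
  Z - ∑ j, X j * Z * (T j)ᵀ - ∑ j, (X j)ᴴ * Z * (T' j)ᵀ

theorem mulVec_vec_eq_vec_stateOp (T T' : Fin g → Matrix ι ι ℂ) (X : Fin g → Matrix N N ℂ)
    (Z : Matrix N ι ℂ) :
    (1 - (tensorEval T X + tensorEval T' fun j => (X j)ᴴ)) *ᵥ Z.vec = (stateOp T T' X Z).vec := by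
  simp only [stateOp, tensorEval, Matrix.sub_mulVec, Matrix.add_mulVec, Matrix.one_mulVec,
    Matrix.sum_mulVec, Matrix.kronecker_mulVec_vec, Matrix.vec_sub, Matrix.vec_add, Matrix.vec_sum,
    sub_sub]

theorem exists_isUnit_one_sub_tensorEval (T T' : Fin g → Matrix ι ι ℂ) :
    ∃ δ : ℝ, 0 < δ ∧ ∀ (N : Type) [Fintype N] [DecidableEq N] (X : Fin g → Matrix N N ℂ),
      (∀ j, ‖X j‖ ≤ δ) → IsUnit (1 - (tensorEval T X + tensorEval T' fun j => (X j)ᴴ)) := by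
  obtain ⟨s, hs⟩ : ∃ s : ℝ, s = ∑ j, ‖T j‖ + ∑ j, ‖T' j‖ := ⟨_, rfl⟩
  have hs0 : 0 ≤ s := by
    rw [hs]
    exact add_nonneg (Finset.sum_nonneg fun j _ => norm_nonneg _)
      (Finset.sum_nonneg fun j _ => norm_nonneg _)
  refine ⟨1 / (s + 1), by positivity, fun N _ _ X hX => ?_⟩
  refine isUnit_one_sub_of_norm_lt_one ?_
  have h : ‖tensorEval T X + tensorEval T' fun j => (X j)ᴴ‖ ≤ s * (1 / (s + 1)) := by
    rw [hs, add_mul, ← hs]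
    refine (norm_add_le _ _).trans (add_le_add (norm_tensorEval_le _ _ hX)
      (norm_tensorEval_le _ _ fun j => ?_))
    rw [Matrix.l2_opNorm_conjTranspose]
    exact hX j
  refine h.trans_lt ?_
  rw [mul_one_div, div_lt_one (by positivity)]
  linarith

theorem norm_fromBlocks_zero_le (X : Matrix N N ℂ) :
    ‖(Matrix.fromBlocks X 0 0 0 : Matrix (N ⊕ Unit) (N ⊕ Unit) ℂ)‖ ≤ ‖X‖ := by
  let φ : Matrix N N ℂ →⋆ₙₐ[ℂ] Matrix (N ⊕ Unit) (N ⊕ Unit) ℂ :=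
    { toFun := fun X => Matrix.fromBlocks X 0 0 0
      map_smul' := fun z A => by simp [Matrix.fromBlocks_smul]
      map_zero' := by simp
      map_add' := fun A B => by simp [Matrix.fromBlocks_add]
      map_mul' := fun A B => by simp [Matrix.fromBlocks_multiply]
      map_star' := fun A => by
        simp [Matrix.star_eq_conjTranspose, Matrix.fromBlocks_conjTranspose] }
  exact NonUnitalStarAlgHom.norm_apply_le φ X

theorem norm_submatrix_equiv_le {N' : Type} [Fintype N'] [DecidableEq N'] (e : N' ≃ N)
    (X : Matrix N N ℂ) : ‖X.submatrix e e‖ ≤ ‖X‖ := by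
  let φ : Matrix N N ℂ →⋆ₙₐ[ℂ] Matrix N' N' ℂ :=
    { toFun := fun X => X.submatrix e e
      map_smul' := fun z A => rfl
      map_zero' := rfl
      map_add' := fun A B => rfl
      map_mul' := fun A B => (Matrix.submatrix_mul_equiv A B e e e).symm
      map_star' := fun A => rfl }
  exact NonUnitalStarAlgHom.norm_apply_le φ X

/-- The tuple `X ⊕ 0`, with `β*` and `α` added in the new column and row. -/
def borderedTuple (X : Fin g → Matrix N N ℂ) (α β : Fin g → Matrix Unit N ℂ) :
    Fin g → Matrix (N ⊕ Unit) (N ⊕ Unit) ℂ :=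
  fun j => Matrix.fromBlocks (X j) (β j)ᴴ (α j) 0

theorem stateOp_borderedTuple {ι N : Type} [Fintype ι] [Fintype N] (T T' : Fin g → Matrix ι ι ℂ)
    (X : Fin g → Matrix N N ℂ) (α β : Fin g → Matrix Unit N ℂ) (Z : Matrix N ι ℂ)
    (z : Matrix Unit ι ℂ) :
    stateOp T T' (borderedTuple X α β) (Matrix.fromRows Z z) =
      Matrix.fromRows
        (stateOp T T' X Z - ∑ j, (β j)ᴴ * z * (T j)ᵀ - ∑ j, (α j)ᴴ * z * (T' j)ᵀ)
        (z - ∑ j, α j * Z * (T j)ᵀ - ∑ j, β j * Z * (T' j)ᵀ) := by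
  have hsum : ∀ (F : Fin g → Matrix N ι ℂ) (G : Fin g → Matrix Unit ι ℂ),
      ∑ j, Matrix.fromRows (F j) (G j) = Matrix.fromRows (∑ j, F j) (∑ j, G j) := by
    intro F G
    ext i k
    rcases i with i | i <;> simp [Matrix.sum_apply]
  simp only [stateOp, borderedTuple, Matrix.fromBlocks_conjTranspose,
    Matrix.fromBlocks_mul_fromRows,
    Matrix.fromRows_mul, hsum, Matrix.conjTranspose_conjTranspose, Matrix.conjTranspose_zero,
    Matrix.zero_mul, add_zero, Matrix.add_mul, Finset.sum_add_distrib]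
  ext i k
  rcases i with i | i <;> simp <;> ring

/-- The slices of a state `Z`: the span of its rows. -/
def slices (Z : Matrix N ι ℂ) : Submodule ℂ (ι → ℂ) := LinearMap.range Z.vecMulLinear

theorem vecMul_mem_slices {ι N : Type} [Fintype N] (Z : Matrix N ι ℂ) (φ : N → ℂ) :
    φ ᵥ* Z ∈ slices Z := ⟨φ, rfl⟩

/-- If the slices of a state do not absorb the vector produced by a bordering of `X`, then an
arbitrarily small bordering has a state with more slices. -/
theorem exists_finrank_slices_lt {T T' : Fin g → Matrix ι ι ℂ} {δ : ℝ}
    (hδ : ∀ (N : Type) [Fintype N] [DecidableEq N] (X : Fin g → Matrix N N ℂ),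
      (∀ j, ‖X j‖ ≤ δ) → IsUnit (1 - (tensorEval T X + tensorEval T' fun j => (X j)ᴴ)))
    {X : Fin g → Matrix N N ℂ} (hX : ∀ j, ‖X j‖ < δ) {W Z : Matrix N ι ℂ}
    (hZ : stateOp T T' X Z = W) (α β : Fin g → Matrix Unit N ℂ)
    (hx : (∑ j, α j * Z * (T j)ᵀ + ∑ j, β j * Z * (T' j)ᵀ) () ∉ slices Z) :
    ∃ (X' : Fin g → Matrix (N ⊕ Unit) (N ⊕ Unit) ℂ) (Z' : Matrix (N ⊕ Unit) ι ℂ),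
      (∀ j, ‖X' j‖ < δ) ∧ stateOp T T' X' Z' = Matrix.fromRows W 0 ∧
      Module.finrank ℂ (slices Z) < Module.finrank ℂ (slices Z') := by
  let X' : ℝ → Fin g → Matrix (N ⊕ Unit) (N ⊕ Unit) ℂ := fun t =>
    borderedTuple X ((t : ℂ) • α) ((t : ℂ) • β)
  have hX'c : ∀ j, Continuous fun t => X' t j := by
    intro j
    refine continuous_matrix fun p q => ?_
    rcases p with p | p <;> rcases q with q | q <;>
      simp only [X', borderedTuple, Matrix.fromBlocks_apply₁₁, Matrix.fromBlocks_apply₁₂,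
        Matrix.fromBlocks_apply₂₁, Matrix.fromBlocks_apply₂₂, Pi.smul_apply,
        Matrix.conjTranspose_apply, Matrix.smul_apply] <;> fun_prop
  have hX'0 : ∀ j, X' 0 j = Matrix.fromBlocks (X j) 0 0 0 := by
    intro j; simp [X', borderedTuple]
  have hX'n : ∀ᶠ t in 𝓝 (0 : ℝ), ∀ j, ‖X' t j‖ < δ := by
    refine eventually_all.2 fun j => ?_
    refine (hX'c j).norm.continuousAt.eventually_lt continuousAt_const ?_
    rw [hX'0]
    exact (norm_fromBlocks_zero_le _).trans_lt (hX j)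
  let Q : ℝ → Matrix (ι × (N ⊕ Unit)) (ι × (N ⊕ Unit)) ℂ := fun t =>
    1 - (tensorEval T (X' t) + tensorEval T' fun j => (X' t j)ᴴ)
  have hQc : Continuous Q := by
    refine continuous_const.sub (Continuous.add ?_ ?_)
    · refine continuous_finsetSum _ fun j _ => continuous_matrix fun p q => ?_
      exact continuous_const.mul ((hX'c j).matrix_elem _ _)
    · refine continuous_finsetSum _ fun j _ => continuous_matrix fun p q => ?_
      exact continuous_const.mul ((hX'c j).matrix_conjTranspose.matrix_elem _ _)
  have hQu : ∀ᶠ t in 𝓝 (0 : ℝ), IsUnit (Q t) := by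
    filter_upwards [hX'n] with t ht using hδ _ _ fun j => (ht j).le
  -- the state of the bordered tuple
  let Z' : ℝ → Matrix (N ⊕ Unit) ι ℂ := fun t => Matrix.of fun k i =>
    ((Q t)⁻¹ *ᵥ (Matrix.fromRows W (0 : Matrix Unit ι ℂ)).vec) (i, k)
  have hZ'vec : ∀ t, (Z' t).vec = (Q t)⁻¹ *ᵥ (Matrix.fromRows W (0 : Matrix Unit ι ℂ)).vec :=
    fun t => rfl
  have hZ'eq : ∀ t, IsUnit (Q t) → stateOp T T' (X' t) (Z' t) = Matrix.fromRows W 0 := by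
    intro t ht
    rw [← Matrix.vec_inj, ← mulVec_vec_eq_vec_stateOp, hZ'vec, Matrix.mulVec_mulVec]
    rw [Matrix.mul_nonsing_inv _ ((Matrix.isUnit_iff_isUnit_det _).1 ht), Matrix.one_mulVec]
  have hZ'0 : Z' 0 = Matrix.fromRows Z 0 := by
    have h0 : IsUnit (Q 0) := hQu.self_of_nhds
    have h1 : stateOp T T' (X' 0) (Matrix.fromRows Z 0) = Matrix.fromRows W 0 := by
      simp only [X', stateOp_borderedTuple]
      simp [hZ]
    rw [← Matrix.vec_inj, hZ'vec, ← h1, ← mulVec_vec_eq_vec_stateOp, Matrix.mulVec_mulVec]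
    rw [Matrix.nonsing_inv_mul _ ((Matrix.isUnit_iff_isUnit_det _).1 h0), Matrix.one_mulVec]
  have hZ'c : ContinuousAt Z' 0 := by
    have h1 : ContinuousAt (fun t => (Q t)⁻¹) 0 :=
      ContinuousAt.comp (f := Q) (g := fun P => P⁻¹)
        (Matrix.continuousAt_inv_of_isUnit hQu.self_of_nhds) hQc.continuousAt
    have h2 : ContinuousAt
        (fun t => (Q t)⁻¹ *ᵥ (Matrix.fromRows W (0 : Matrix Unit ι ℂ)).vec) 0 :=
      (Continuous.matrix_mulVec continuous_id continuous_const).continuousAt.comp h1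
    refine continuousAt_pi.2 fun k => continuousAt_pi.2 fun i => ?_
    exact continuousAt_pi.1 h2 (i, k)
  -- the rows of `Z' t` other than the last one
  let Y : ℝ → Matrix N ι ℂ := fun t => (Z' t).toRows₁
  have hYc : ContinuousAt Y 0 := by
    refine continuousAt_pi.2 fun k => ?_
    exact continuousAt_pi.1 hZ'c (Sum.inl k)
  have hY0 : Y 0 = Z := by simp only [Y, hZ'0, Matrix.toRows₁_fromRows]
  have hrow : ∀ t, IsUnit (Q t) → (Z' t).toRows₂ =
      (t : ℂ) • (∑ j, α j * Y t * (T j)ᵀ + ∑ j, β j * Y t * (T' j)ᵀ) := by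
    intro t ht
    have h1 := hZ'eq t ht
    rw [← Matrix.fromRows_toRows (Z' t)] at h1
    simp only [X', stateOp_borderedTuple] at h1
    have h2 := congrArg Matrix.toRows₂ h1
    rw [Matrix.toRows₂_fromRows, Matrix.toRows₂_fromRows] at h2
    simp only [Pi.smul_apply, Matrix.smul_mul, ← Finset.smul_sum, sub_sub, ← smul_add] at h2
    exact sub_eq_zero.1 h2
  -- lifts of a basis of the slices of `Z`
  obtain ⟨k, hk⟩ : ∃ k, k = Module.finrank ℂ (slices Z) := ⟨_, rfl⟩
  let b := Module.finBasisOfFinrankEq ℂ (slices Z) hk.symm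
  have hb : ∀ i, ∃ φ : N → ℂ, φ ᵥ* Z = b i := fun i => (b i).2
  choose φ hφ using hb
  let F : ℝ → Option (Fin k) → ι → ℂ := fun t o =>
    o.elim ((∑ j, α j * Y t * (T j)ᵀ + ∑ j, β j * Y t * (T' j)ᵀ) ()) fun i => φ i ᵥ* Y t
  have hF0 : LinearIndependent ℂ (F 0) := by
    have h1 : LinearIndependent ℂ fun i => ((b i : slices Z) : ι → ℂ) :=
      b.linearIndependent.map' (slices Z).subtype (Submodule.ker_subtype _)
    rw [linearIndependent_option]
    refine ⟨?_, ?_⟩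
    · have h2 : (fun i : Fin k => F 0 (some i)) = fun i => ((b i : slices Z) : ι → ℂ) := by
        ext1 i
        simp only [F, hY0, Option.elim_some, hφ]
      change LinearIndependent ℂ (fun i : Fin k => F 0 (some i))
      rw [h2]
      exact h1
    · intro hmem
      refine hx ?_
      simp only [F, hY0, Option.elim_none] at hmem
      refine Submodule.span_le.2 ?_ hmem
      rintro _ ⟨i, rfl⟩
      exact vecMul_mem_slices _ _
  have hFc : ContinuousAt F 0 := by
    refine continuousAt_pi.2 fun o => ?_
    cases o with
    | none =>
      have : Continuous fun Y : Matrix N ι ℂ =>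
          (∑ j, α j * Y * (T j)ᵀ + ∑ j, β j * Y * (T' j)ᵀ) () := by
        refine (continuous_apply ()).comp ?_
        fun_prop
      exact this.continuousAt.comp hYc
    | some i =>
      have : Continuous fun Y : Matrix N ι ℂ => φ i ᵥ* Y :=
        Continuous.matrix_vecMul continuous_const continuous_id
      exact this.continuousAt.comp hYc
  have hFev : ∀ᶠ t in 𝓝 (0 : ℝ), LinearIndependent ℂ (F t) := by
    exact hFc.eventually (LinearIndependent.eventually hF0)
  obtain ⟨t, ⟨ht1, ht2, ht3⟩, ht0⟩ := (((hX'n.and (hQu.and hFev)).filter_mono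
    (nhdsWithin_le_nhds (s := {0}ᶜ))).and self_mem_nhdsWithin).exists
  have ht0' : (t : ℂ) ≠ 0 := by exact_mod_cast ht0
  refine ⟨X' t, Z' t, ht1, hZ'eq t ht2, ?_⟩
  have hmem : ∀ o, F t o ∈ slices (Z' t) := by
    intro o
    have hsplit : ∀ (χ : N → ℂ) (ω : Unit → ℂ),
        χ ᵥ* Y t + ω ᵥ* (Z' t).toRows₂ ∈ slices (Z' t) := by
      intro χ ω
      have h1 := Matrix.sumElim_vecMul_fromRows (Y t) (Z' t).toRows₂ χ ω
      rw [Matrix.fromRows_toRows] at h1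
      rw [← h1]
      exact vecMul_mem_slices _ _
    cases o with
    | none =>
      have h1 := hsplit 0 (fun _ => (t : ℂ)⁻¹)
      rw [hrow t ht2, Matrix.zero_vecMul, zero_add] at h1
      convert h1 using 1
      ext i
      simp only [F, Option.elim_none, Matrix.vecMul, dotProduct, Matrix.smul_apply, smul_eq_mul,
        Finset.univ_unique, Finset.sum_singleton]
      rw [inv_mul_cancel_left₀ ht0']
    | some i =>
      have h1 := hsplit (φ i) 0
      rw [Matrix.zero_vecMul, add_zero] at h1
      exact h1
  have h2 : LinearIndependent ℂ fun o => (⟨F t o, hmem o⟩ : slices (Z' t)) :=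
    LinearIndependent.of_comp (slices (Z' t)).subtype ht3
  have h3 := h2.fintype_card_le_finrank
  rw [Fintype.card_option, Fintype.card_fin, hk] at h3
  exact h3

theorem slices_fromRows {ι N : Type} [Fintype N] (Z : Matrix N ι ℂ) (z : Matrix Unit ι ℂ) :
    slices Z ≤ slices (Matrix.fromRows Z z) ∧ z () ∈ slices (Matrix.fromRows Z z) := by
  refine ⟨?_, ?_⟩
  · rintro _ ⟨φ, rfl⟩
    have h := vecMul_mem_slices (Matrix.fromRows Z z) (Sum.elim φ 0)
    rw [Matrix.sumElim_vecMul_fromRows, Matrix.zero_vecMul, add_zero] at h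
    exact h
  · have h := vecMul_mem_slices (Matrix.fromRows Z z) (Sum.elim 0 1)
    rw [Matrix.sumElim_vecMul_fromRows, Matrix.zero_vecMul, zero_add] at h
    convert h using 1
    ext i
    simp [Matrix.vecMul, dotProduct]

theorem fromRows_vecMulVec {ι N : Type} (v : N → ℂ) (a : ℂ) (c : ι → ℂ) :
    Matrix.fromRows (Matrix.vecMulVec v c) (Matrix.of fun (_ : Unit) i => a * c i) =
      Matrix.vecMulVec (Sum.elim v fun _ => a) c := by
  ext i k
  rcases i with i | i <;> simp [Matrix.vecMulVec_apply]

/-- A reachable system has states, at matrices as small as desired, whose slices span the whole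
state space. A state with the largest number of slices is such: its slices contain `c`, and are
invariant under all coefficients, since otherwise a bordering would produce more slices. -/
theorem exists_slices_eq_top (T T' : Fin g → Matrix ι ι ℂ) (c : ι → ℂ)
    (hspan : Submodule.span ℂ (Set.range fun w : List (Fin g ⊕ Fin g) =>
      (w.map (Sum.elim T T')).prod *ᵥ c) = ⊤) {δ : ℝ} (hδ : 0 < δ) :
    ∃ (N : Type) (_ : Fintype N) (_ : DecidableEq N) (X : Fin g → Matrix N N ℂ) (v : N → ℂ)
      (Z : Matrix N ι ℂ), (∀ j, ‖X j‖ ≤ δ) ∧ stateOp T T' X Z = Matrix.vecMulVec v c ∧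
      slices Z = ⊤ := by
  obtain ⟨δ₁, hδ₁, hunit⟩ := exists_isUnit_one_sub_tensorEval T T'
  obtain ⟨δ', hδ', h1, h2⟩ : ∃ δ' : ℝ, 0 < δ' ∧ δ' ≤ δ ∧ δ' ≤ δ₁ :=
    ⟨min δ δ₁, lt_min hδ hδ₁, min_le_left _ _, min_le_right _ _⟩
  let p : Set ℕ := {k | ∃ (N : Type) (_ : Fintype N) (_ : DecidableEq N)
    (X : Fin g → Matrix N N ℂ) (v : N → ℂ) (Z : Matrix N ι ℂ), (∀ j, ‖X j‖ < δ') ∧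
      stateOp T T' X Z = Matrix.vecMulVec v c ∧ Module.finrank ℂ (slices Z) = k}
  have hp0 : p.Nonempty := by
    refine ⟨_, Unit, inferInstance, inferInstance, 0, 0, 0, fun j => ?_, ?_, rfl⟩
    · simpa using hδ'
    · simp [stateOp]
  have hpb : BddAbove p := by
    refine ⟨Module.finrank ℂ (ι → ℂ), ?_⟩
    rintro k ⟨N, _, _, X, v, Z, -, -, rfl⟩
    exact Submodule.finrank_le _
  obtain ⟨N, _, _, X, v, Z, hX, hZ, hk⟩ := Nat.sSup_mem hp0 hpb
  have hmax : ∀ k ∈ p, k ≤ Module.finrank ℂ (slices Z) := fun k h => hk ▸ le_csSup hpb h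
  refine ⟨N, inferInstance, inferInstance, X, v, Z, fun j => (hX j).le.trans h1, hZ, ?_⟩
  have hc : c ∈ slices Z := by
    by_contra hc
    obtain ⟨hle, hmem⟩ := slices_fromRows Z (Matrix.of fun _ => c)
    have hlt : slices Z < slices (Matrix.fromRows Z (Matrix.of fun _ => c)) :=
      lt_of_le_of_ne hle fun h => hc (h ▸ hmem)
    refine (Submodule.finrank_lt_finrank_of_lt hlt).not_ge (hmax _ ⟨N ⊕ Unit, inferInstance,
      inferInstance, borderedTuple X 0 0, Sum.elim v fun _ => 1, _, fun j => ?_, ?_, rfl⟩)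
    · simpa [borderedTuple] using (norm_fromBlocks_zero_le (X j)).trans_lt (hX j)
    · rw [stateOp_borderedTuple, ← fromRows_vecMulVec]
      simp [hZ]
  have hinv : ∀ α β : Fin g → Matrix Unit N ℂ,
      (∑ j, α j * Z * (T j)ᵀ + ∑ j, β j * Z * (T' j)ᵀ) () ∈ slices Z := by
    intro α β
    by_contra hx
    obtain ⟨X', Z', hX', hZ', hlt⟩ := exists_finrank_slices_lt
      (fun N _ _ X hX => hunit N X fun j => (hX j).trans h2) hX hZ α β hx
    refine hlt.not_ge (hmax _ ⟨N ⊕ Unit, inferInstance, inferInstance, X',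
      Sum.elim v fun _ => 0, Z', hX', ?_, rfl⟩)
    rw [hZ', ← fromRows_vecMulVec]
    congr 1
    ext i k
    simp
  have hletter : ∀ (a : Fin g ⊕ Fin g), ∀ x ∈ slices Z, Sum.elim T T' a *ᵥ x ∈ slices Z := by
    rintro a _ ⟨φ, rfl⟩
    rcases a with j | j
    · have h := hinv (Pi.single j (Matrix.of fun _ => φ)) 0
      rw [Finset.sum_eq_single j (fun i _ hi => by simp [hi]) (by simp)] at h
      simp only [Pi.single_eq_same, Pi.zero_apply, Matrix.zero_mul, Finset.sum_const_zero,
        add_zero] at h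
      rw [Sum.elim_inl, Matrix.vecMulLinear_apply, ← Matrix.vecMul_transpose]
      exact h
    · have h := hinv 0 (Pi.single j (Matrix.of fun _ => φ))
      rw [Finset.sum_eq_single (s := Finset.univ) (f := fun i => Pi.single (M := fun _ =>
        Matrix Unit N ℂ) j (Matrix.of fun _ => φ) i * Z * (T' i)ᵀ) j
        (fun i _ hi => by simp [hi]) (by simp)] at h
      simp only [Pi.single_eq_same, Pi.zero_apply, Matrix.zero_mul, Finset.sum_const_zero,
        zero_add] at h
      rw [Sum.elim_inr, Matrix.vecMulLinear_apply, ← Matrix.vecMul_transpose]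
      exact h
  rw [eq_top_iff, ← hspan]
  refine Submodule.span_le.2 ?_
  rintro _ ⟨w, rfl⟩
  induction w with
  | nil => simpa using hc
  | cons a w ih =>
    simp only [List.map_cons, List.prod_cons, ← Matrix.mulVec_mulVec]
    exact hletter a _ ih

end States

/-! ### Plurisubharmonicity makes the ranges of the coefficients nonnegative -/

section HessianOfSymmetricRealization

open scoped Matrix.Norms.L2Operator
open Filter Topology

variable {g : ℕ}

theorem colTensor_mulVec {ι : Type} {n : ℕ} (b : ι → ℂ) (v : Fin n → ℂ) :
    colTensor b n *ᵥ v = (Matrix.vecMulVec v b).vec := by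
  ext ⟨i, k⟩
  simp [colTensor, Matrix.mulVec, dotProduct, Matrix.one_apply, Matrix.vec,
    Matrix.vecMulVec_apply, mul_comm]

namespace DescriptorRealization

/-- The pencil acts on a state, up to the invertible coefficient at `0`, as `stateOp`. -/
theorem pencil_mulVec_vec {n : ℕ} (r : DescriptorRealization g) (X : MatTuple g n)
    (Z : Matrix (Fin n) r.ι ℂ) :
    r.pencil X X.adj *ᵥ (Z * (r.J⁻¹)ᵀ).vec =
      (stateOp (fun j => r.A j * r.J⁻¹) (fun j => r.B j * r.J⁻¹) X Z).vec := by
  have hJ : (r.J⁻¹)ᵀ * (r.J)ᵀ = 1 := by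
    rw [← Matrix.transpose_mul, Matrix.mul_nonsing_inv _
      ((Matrix.isUnit_iff_isUnit_det _).1 r.isUnit_J), Matrix.transpose_one]
  have h : ∀ M : Matrix r.ι r.ι ℂ, (M * r.J⁻¹)ᵀ = (r.J⁻¹)ᵀ * Mᵀ := fun M =>
    Matrix.transpose_mul _ _
  simp only [pencil, MatTuple.adj, Matrix.sub_mulVec, Matrix.sum_mulVec,
    Matrix.kronecker_mulVec_vec, stateOp, h, Matrix.vec_sub, Matrix.vec_sum, Matrix.one_mul,
    Matrix.mul_assoc, hJ, Matrix.mul_one]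

end DescriptorRealization

/-- Equivalent realizations have the same complex Hessian near `0`. -/
theorem DescriptorRealization.IsPlushNearZero.exists_posSemidef_of_equivalent
    {r s : DescriptorRealization g} (hr : r.IsPlushNearZero) (h : r.Equivalent s) :
    ∃ δ : ℝ, 0 < δ ∧ ∀ (n : ℕ) (X : MatTuple g n), (∀ j, ‖X j‖ ≤ δ) →
      X ∈ s.dom n ∧ ∀ H, (s.complexHessian X H).PosSemidef := by
  obtain ⟨ε, hε, hplush⟩ := hr
  obtain ⟨δ₁, hδ₁, h1⟩ := mem_freeBall_of_norm (g := g) hε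
  obtain ⟨δ₂, hδ₂, h2⟩ := s.exists_forall_norm_le_mem_dom
  obtain ⟨δ, hδ, hle1, hle2⟩ : ∃ δ : ℝ, 0 < δ ∧ 2 * δ ≤ δ₁ ∧ 2 * δ ≤ δ₂ := by
    refine ⟨min δ₁ δ₂ / 2, by positivity, ?_, ?_⟩
    · linarith [min_le_left δ₁ δ₂]
    · linarith [min_le_right δ₁ δ₂]
  refine ⟨δ, hδ, fun n X hX => ?_⟩
  have hr' : ∀ Y : MatTuple g n, (∀ j, ‖Y j‖ ≤ 2 * δ) → Y ∈ r.dom n := fun Y hY =>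
    (hplush n Y (h1 n Y fun j => (hY j).trans hle1)).1
  have hs' : ∀ Y : MatTuple g n, (∀ j, ‖Y j‖ ≤ 2 * δ) → Y ∈ s.dom n := fun Y hY =>
    h2 n Y fun j => (hY j).trans hle2
  have hX2 : ∀ j, ‖X j‖ ≤ 2 * δ := fun j => (hX j).trans (by linarith)
  refine ⟨hs' X hX2, fun H => ?_⟩
  have hlim := s.tendsto_quarterAverage_eval (hs' X hX2) H
  have hlim' := r.tendsto_quarterAverage_eval (hr' X hX2) H
  suffices heq : r.complexHessian X H = s.complexHessian X H by
    rw [← heq]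
    exact (hplush n X (h1 n X fun j => (hX2 j).trans hle1)).2 H
  refine tendsto_nhds_unique (hlim'.congr' ?_) hlim
  obtain ⟨S, hS⟩ : ∃ S : ℝ, S = ∑ j, ‖H j‖ := ⟨_, rfl⟩
  have hS0 : 0 ≤ S := hS ▸ Finset.sum_nonneg fun j _ => norm_nonneg _
  have hev : ∀ᶠ t : ℝ in 𝓝[≠] 0, |t| < δ / (S + 1) := by
    have : ∀ᶠ t : ℝ in 𝓝 0, |t| < δ / (S + 1) := by
      refine continuous_abs.continuousAt.eventually_lt continuousAt_const ?_
      rw [abs_zero]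
      positivity
    exact this.filter_mono nhdsWithin_le_nhds
  filter_upwards [hev] with t ht
  rw [h n X (hr' X hX2) (hs' X hX2)]
  congr 2
  refine quarterAverage_congr fun z hz => ?_
  have hY : ∀ j, ‖(X + z • H) j‖ ≤ 2 * δ := by
    intro j
    have h3 : ‖H j‖ ≤ S := hS ▸ Finset.single_le_sum (f := fun j => ‖H j‖)
      (fun i _ => norm_nonneg _) (Finset.mem_univ j)
    calc ‖(X + z • H) j‖ ≤ ‖X j‖ + ‖z • H j‖ := norm_add_le _ _
      _ ≤ δ + δ / (S + 1) * S := by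
          refine add_le_add (hX j) ?_
          rw [norm_smul, hz]
          exact mul_le_mul ht.le h3 (norm_nonneg _) (by positivity)
      _ ≤ 2 * δ := by
          have : δ / (S + 1) * S ≤ δ := by
            rw [div_mul_eq_mul_div, div_le_iff₀ (by positivity)]
            nlinarith
          linarith
  exact h n _ (hr' _ hY) (hs' _ hY)

theorem stateOp_submatrix {ι N N' : Type} [Fintype ι] [Fintype N] [Fintype N']
    (T T' : Fin g → Matrix ι ι ℂ) (X : Fin g → Matrix N N ℂ) (Z : Matrix N ι ℂ) (e : N' ≃ N) :
    stateOp T T' (fun j => (X j).submatrix e e) (Z.submatrix e id) =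
      (stateOp T T' X Z).submatrix e id := by
  have hsum : ∀ F : Fin g → Matrix N ι ℂ,
      (∑ j, F j).submatrix e id = ∑ j, (F j).submatrix e id := by
    intro F
    ext i k
    simp [Matrix.sum_apply]
  have hmul : ∀ (Y : Matrix N N ℂ) (S : Matrix ι ι ℂ),
      (Y * Z * S).submatrix e id = Y.submatrix e e * Z.submatrix e id * S := by
    intro Y S
    ext i k
    simp only [Matrix.submatrix_apply, Matrix.mul_apply, id]
    refine Finset.sum_congr rfl fun l _ => ?_
    rw [← e.sum_comp]
  have hsub : ∀ F G : Matrix N ι ℂ,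
      (F - G).submatrix e id = F.submatrix e id - G.submatrix e id := fun F G => rfl
  simp only [stateOp, hsub, hsum, hmul, Matrix.conjTranspose_submatrix]

namespace SymmetricRealization

variable (m : SymmetricRealization g)

/-- The coefficients `BⱼK`. -/
def T (j : Fin g) : Matrix (Fin m.a ⊕ Fin m.b) (Fin m.a ⊕ Fin m.b) ℂ := m.B j * m.K

/-- The coefficients `Bⱼ*K`. -/
def T' (j : Fin g) : Matrix (Fin m.a ⊕ Fin m.b) (Fin m.a ⊕ Fin m.b) ℂ := (m.B j)ᴴ * m.K

theorem transpose_K : m.Kᵀ = m.K := by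
  simp [K, signatureMatrix, Matrix.fromBlocks_transpose]

theorem inv_K : m.K⁻¹ = m.K := Matrix.inv_eq_left_inv (ConstructionData.K_mul_K m)

theorem pencil_mulVec_vec {n : ℕ} (X : MatTuple g n) (Z : Matrix (Fin n) (Fin m.a ⊕ Fin m.b) ℂ) :
    m.toDescriptor.pencil X X.adj *ᵥ (Z * m.K).vec = (stateOp m.T m.T' X Z).vec := by
  have h := m.toDescriptor.pencil_mulVec_vec X Z
  change m.toDescriptor.pencil X X.adj *ᵥ (Z * (m.K⁻¹)ᵀ).vec =
    (stateOp (fun j => m.B j * m.K⁻¹) (fun j => (m.B j)ᴴ * m.K⁻¹) X Z).vec at h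
  rw [m.inv_K, m.transpose_K] at h
  exact h

/-- The Hessian of a symmetric realization, as a sum of two Hermitian forms. -/
theorem nonneg_of_posSemidef_complexHessian {n : ℕ} {X H : MatTuple g n}
    (hX : X ∈ m.toDescriptor.dom n) (hpos : (m.toDescriptor.complexHessian X H).PosSemidef)
    {v : Fin n → ℂ} {Z Z₁ Z₂ : Matrix (Fin n) (Fin m.a ⊕ Fin m.b) ℂ}
    (hZ : stateOp m.T m.T' X Z = Matrix.vecMulVec v m.c)
    (hZ₁ : stateOp m.T m.T' X Z₁ = ∑ j, H j * Z * (m.T j)ᵀ)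
    (hZ₂ : stateOp m.T m.T' X Z₂ = ∑ j, (H j)ᴴ * Z * (m.T' j)ᵀ) :
    0 ≤ ((∑ j, H j * Z * (m.T j)ᵀ)ᴴ * (Z₁ * m.K)).trace +
      ((∑ j, (H j)ᴴ * Z * (m.T' j)ᵀ)ᴴ * (Z₂ * m.K)).trace := by
  have hP : ∃ P : Matrix ((Fin m.a ⊕ Fin m.b) × Fin n) ((Fin m.a ⊕ Fin m.b) × Fin n) ℂ,
      P = m.toDescriptor.pencil X X.adj := ⟨_, rfl⟩
  obtain ⟨P, hP⟩ := hP
  have hPu : IsUnit P := hP ▸ hX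
  have hinv : P⁻¹ * P = 1 := Matrix.nonsing_inv_mul _ ((Matrix.isUnit_iff_isUnit_det _).1 hPu)
  have hPH : Pᴴ = P := by
    have hK : m.Kᴴ = m.K := ConstructionData.conjTranspose_K m
    rw [hP]
    change (m.K ⊗ₖ (1 : Matrix (Fin n) (Fin n) ℂ) - tensorEval m.B X -
      tensorEval (fun j => (m.B j)ᴴ) X.adj)ᴴ = m.K ⊗ₖ (1 : Matrix (Fin n) (Fin n) ℂ) -
      tensorEval m.B X - tensorEval (fun j => (m.B j)ᴴ) X.adj
    simp only [Matrix.conjTranspose_sub, conjTranspose_tensorEval, Matrix.conjTranspose_kronecker,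
      hK, Matrix.conjTranspose_one, Matrix.conjTranspose_conjTranspose, MatTuple.adj]
    exact sub_right_comm _ _ _
  have hstate : ∀ Y : Matrix (Fin n) (Fin m.a ⊕ Fin m.b) ℂ,
      P⁻¹ *ᵥ (stateOp m.T m.T' X Y).vec = (Y * m.K).vec := by
    intro Y
    have hPY : P *ᵥ (Y * m.K).vec = (stateOp m.T m.T' X Y).vec := by
      rw [hP]
      exact m.pencil_mulVec_vec X Y
    rw [← hPY, Matrix.mulVec_mulVec, hinv, Matrix.one_mulVec]
  obtain ⟨A, hA⟩ : ∃ A : Matrix ((Fin m.a ⊕ Fin m.b) × Fin n) ((Fin m.a ⊕ Fin m.b) × Fin n) ℂ,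
      A = tensorEval m.B H := ⟨_, rfl⟩
  have hAH : Aᴴ = tensorEval (fun j => (m.B j)ᴴ) H.adj := by rw [hA, conjTranspose_tensorEval]; rfl
  have hAu : A *ᵥ (Z * m.K).vec = (∑ j, H j * Z * (m.T j)ᵀ).vec := by
    simp only [hA, tensorEval, Matrix.sum_mulVec, Matrix.kronecker_mulVec_vec, T,
      Matrix.transpose_mul, m.transpose_K, Matrix.vec_sum, Matrix.mul_assoc]
  have hAHu : Aᴴ *ᵥ (Z * m.K).vec = (∑ j, (H j)ᴴ * Z * (m.T' j)ᵀ).vec := by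
    simp only [hAH, tensorEval, Matrix.sum_mulVec, Matrix.kronecker_mulVec_vec, T', MatTuple.adj,
      Matrix.transpose_mul, m.transpose_K, Matrix.vec_sum, Matrix.mul_assoc]
  have hu : (P⁻¹ * colTensor m.c n) *ᵥ v = (Z * m.K).vec := by
    rw [← Matrix.mulVec_mulVec, colTensor_mulVec, ← hZ, hstate]
  have h := hpos.dotProduct_mulVec_nonneg v
  rw [DescriptorRealization.complexHessian_eq _ hX] at h
  have e : (colTensor m.c n)ᴴ * (P⁻¹ * (A * P⁻¹ * Aᴴ + Aᴴ * P⁻¹ * A) * P⁻¹) * colTensor m.c n =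
      (P⁻¹ * colTensor m.c n)ᴴ * (A * P⁻¹ * Aᴴ + Aᴴ * P⁻¹ * A) * (P⁻¹ * colTensor m.c n) := by
    rw [Matrix.conjTranspose_mul, Matrix.conjTranspose_nonsing_inv, hPH]
    simp only [Matrix.mul_assoc]
  have h' : 0 ≤ star v ⬝ᵥ (((colTensor m.c n)ᴴ * (P⁻¹ * (A * P⁻¹ * Aᴴ + Aᴴ * P⁻¹ * A) * P⁻¹) *
      colTensor m.c n) *ᵥ v) := by
    rw [hP, hA, conjTranspose_tensorEval]
    exact h
  rw [e, ← Matrix.mulVec_mulVec, hu, ← Matrix.mulVec_mulVec, Matrix.dotProduct_mulVec,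
    Matrix.vecMul_conjTranspose, star_star, hu, Matrix.add_mulVec, dotProduct_add] at h'
  have hform : ∀ M : Matrix ((Fin m.a ⊕ Fin m.b) × Fin n) ((Fin m.a ⊕ Fin m.b) × Fin n) ℂ,
      ∀ u : (Fin m.a ⊕ Fin m.b) × Fin n → ℂ,
      star u ⬝ᵥ ((Mᴴ * P⁻¹ * M) *ᵥ u) = star (M *ᵥ u) ⬝ᵥ (P⁻¹ *ᵥ (M *ᵥ u)) := by
    intro M u
    rw [Matrix.mul_assoc, ← Matrix.mulVec_mulVec, Matrix.dotProduct_mulVec,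
      Matrix.vecMul_conjTranspose, star_star, Matrix.mulVec_mulVec]
  have h1 := hform Aᴴ (Z * m.K).vec
  rw [Matrix.conjTranspose_conjTranspose] at h1
  rw [h1, hform A, hAu, hAHu, ← hZ₁, ← hZ₂, hstate, hstate, Matrix.star_vec_dotProduct_vec,
    Matrix.star_vec_dotProduct_vec, hZ₁, hZ₂, add_comm] at h'
  exact h'

/-- Plurisubharmonicity makes the span of the ranges of the `Bⱼ`, and that of the `Bⱼ*`,
`K`-nonnegative. A state whose slices span the state space is extended by zero to one more
dimension; then a direction `H` mapping into the new dimension, and its adjoint, isolate the form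
`K` in the Hessian. -/
theorem nonneg_of_isPlushNearZero (hm : m.IsMinimal) {r : DescriptorRealization g}
    (hr : r.IsPlushNearZero) (h : r.Equivalent m.toDescriptor)
    (x y : Fin g → Fin m.a ⊕ Fin m.b → ℂ) :
    0 ≤ star (∑ j, m.B j *ᵥ x j) ⬝ᵥ (m.K *ᵥ ∑ j, m.B j *ᵥ x j) +
      star (∑ j, (m.B j)ᴴ *ᵥ y j) ⬝ᵥ (m.K *ᵥ ∑ j, (m.B j)ᴴ *ᵥ y j) := by
  obtain ⟨δ, hδ, hpos⟩ := hr.exists_posSemidef_of_equivalent h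
  obtain ⟨N, _, _, X, v, Z, hX, hZ, htop⟩ := exists_slices_eq_top m.T m.T' m.c hm hδ
  have hsurj : ∀ x : Fin m.a ⊕ Fin m.b → ℂ, ∃ φ : N → ℂ, φ ᵥ* Z = m.K *ᵥ x := by
    intro x
    have : m.K *ᵥ x ∈ slices Z := htop ▸ Submodule.mem_top
    exact this
  choose φ hφ using hsurj
  -- the rows of `α` and `β` select the slices `K xⱼ` and `K yⱼ`
  obtain ⟨α, hα⟩ : ∃ α : Fin g → Matrix Unit N ℂ, α = fun j => Matrix.of fun _ => φ (x j) :=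
    ⟨_, rfl⟩
  obtain ⟨β, hβ⟩ : ∃ β : Fin g → Matrix Unit N ℂ, β = fun j => Matrix.of fun _ => φ (y j) :=
    ⟨_, rfl⟩
  obtain ⟨p, hp⟩ : ∃ p : Matrix Unit (Fin m.a ⊕ Fin m.b) ℂ, p = ∑ j, α j * Z * (m.T j)ᵀ :=
    ⟨_, rfl⟩
  obtain ⟨q, hq⟩ : ∃ q : Matrix Unit (Fin m.a ⊕ Fin m.b) ℂ, q = ∑ j, β j * Z * (m.T' j)ᵀ :=
    ⟨_, rfl⟩
  have hp' : p () = ∑ j, m.B j *ᵥ x j := by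
    rw [hp]
    ext i
    rw [Matrix.sum_apply, Finset.sum_apply]
    refine Finset.sum_congr rfl fun j _ => ?_
    have h1 : (α j * Z * (m.T j)ᵀ) () i = ((φ (x j) ᵥ* Z) ᵥ* (m.T j)ᵀ) i := by rw [hα]; rfl
    rw [h1, hφ, Matrix.vecMul_transpose, T, Matrix.mulVec_mulVec, Matrix.mul_assoc,
      ConstructionData.K_mul_K m,
      Matrix.mul_one]
  have hq' : q () = ∑ j, (m.B j)ᴴ *ᵥ y j := by
    rw [hq]
    ext i
    rw [Matrix.sum_apply, Finset.sum_apply]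
    refine Finset.sum_congr rfl fun j _ => ?_
    have h1 : (β j * Z * (m.T' j)ᵀ) () i = ((φ (y j) ᵥ* Z) ᵥ* (m.T' j)ᵀ) i := by rw [hβ]; rfl
    rw [h1, hφ, Matrix.vecMul_transpose, T', Matrix.mulVec_mulVec, Matrix.mul_assoc,
      ConstructionData.K_mul_K m,
      Matrix.mul_one]
  obtain ⟨n, ⟨e⟩⟩ : ∃ n : ℕ, Nonempty (Fin n ≃ N ⊕ Unit) :=
    ⟨_, ⟨(Fintype.equivFin (N ⊕ Unit)).symm⟩⟩
  let X' : MatTuple g n := fun j => (borderedTuple X 0 0 j).submatrix e e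
  have hX' : ∀ j, ‖X' j‖ ≤ δ := by
    intro j
    refine (norm_submatrix_equiv_le e _).trans ?_
    simpa [borderedTuple] using (norm_fromBlocks_zero_le (X j)).trans (hX j)
  obtain ⟨hdom, hpsd⟩ := hpos n X' hX'
  let H : MatTuple g n := fun j => (borderedTuple 0 α β j).submatrix e e
  let Z' : Matrix (Fin n) (Fin m.a ⊕ Fin m.b) ℂ := (Matrix.fromRows Z 0).submatrix e id
  have hZ' : stateOp m.T m.T' X' Z' = Matrix.vecMulVec (Sum.elim v (fun _ => 0) ∘ e) m.c := by
    rw [stateOp_submatrix, stateOp_borderedTuple]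
    simp only [hZ, Pi.zero_apply, Matrix.zero_mul, Matrix.mul_zero, Matrix.conjTranspose_zero,
      Finset.sum_const_zero, sub_zero]
    ext i k
    simp only [Matrix.submatrix_apply, Matrix.vecMulVec_apply, Function.comp_apply, id]
    rcases e i with l | l <;> simp [Matrix.vecMulVec_apply]
  have hnew : ∀ z : Matrix Unit (Fin m.a ⊕ Fin m.b) ℂ,
      stateOp m.T m.T' X' ((Matrix.fromRows 0 z).submatrix e id) =
        (Matrix.fromRows 0 z).submatrix e id := by
    intro z
    rw [stateOp_submatrix, stateOp_borderedTuple]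
    simp [stateOp]
  have hsum : ∀ (γ : Fin g → Matrix N Unit ℂ) (α : Fin g → Matrix Unit N ℂ)
      (S : Fin g → Matrix (Fin m.a ⊕ Fin m.b) (Fin m.a ⊕ Fin m.b) ℂ),
      ∑ j, (Matrix.fromBlocks 0 (γ j) (α j) 0 : Matrix (N ⊕ Unit) (N ⊕ Unit) ℂ).submatrix e e *
        Z' * (S j)ᵀ = (Matrix.fromRows 0 (∑ j, α j * Z * (S j)ᵀ) :
          Matrix (N ⊕ Unit) (Fin m.a ⊕ Fin m.b) ℂ).submatrix e id := by
    intro γ α S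
    have h1 : ∀ j, (Matrix.fromBlocks 0 (γ j) (α j) 0 :
        Matrix (N ⊕ Unit) (N ⊕ Unit) ℂ).submatrix e e * Z' =
        (Matrix.fromRows 0 (α j * Z) : Matrix (N ⊕ Unit) (Fin m.a ⊕ Fin m.b) ℂ).submatrix e id := by
      intro j
      rw [Matrix.submatrix_mul_equiv, Matrix.fromBlocks_mul_fromRows]
      simp
    simp only [h1]
    ext i k
    simp only [Matrix.submatrix_apply, Matrix.sum_apply, Matrix.mul_apply (N := (S _)ᵀ), id]
    rcases e i with l | l <;> simp [Matrix.mul_apply, Matrix.sum_apply]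
  have hZ₁ : ∑ j, H j * Z' * (m.T j)ᵀ = (Matrix.fromRows 0 p).submatrix e id := by
    rw [hp, ← hsum (fun j => (β j)ᴴ)]
    rfl
  have hZ₂ : ∑ j, (H j)ᴴ * Z' * (m.T' j)ᵀ = (Matrix.fromRows 0 q).submatrix e id := by
    rw [hq, ← hsum (fun j => (α j)ᴴ)]
    refine Finset.sum_congr rfl fun j _ => ?_
    simp [H, borderedTuple, Matrix.conjTranspose_submatrix, Matrix.fromBlocks_conjTranspose]
  have hmain := m.nonneg_of_posSemidef_complexHessian hdom (hpsd H) hZ'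
    ((hnew p).trans hZ₁.symm) ((hnew q).trans hZ₂.symm)
  have htrace : ∀ z : Matrix Unit (Fin m.a ⊕ Fin m.b) ℂ,
      (((Matrix.fromRows (0 : Matrix N _ ℂ) z).submatrix e id)ᴴ *
        ((Matrix.fromRows (0 : Matrix N _ ℂ) z).submatrix e id * m.K)).trace =
        star (z ()) ⬝ᵥ (m.K *ᵥ z ()) := by
    intro z
    have h1 : ((Matrix.fromRows (0 : Matrix N (Fin m.a ⊕ Fin m.b) ℂ) z).submatrix e id)ᴴ *
        (Matrix.fromRows (0 : Matrix N _ ℂ) z).submatrix e id = zᴴ * z := by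
      rw [Matrix.conjTranspose_submatrix, Matrix.submatrix_mul_equiv,
        Matrix.conjTranspose_fromRows_eq_fromCols_conjTranspose, Matrix.fromCols_mul_fromRows]
      simp
    rw [← Matrix.mul_assoc, h1, Matrix.mul_assoc, Matrix.trace_mul_comm, ← m.transpose_K,
      Matrix.mulVec_transpose, m.transpose_K, dotProduct_comm]
    simp only [Matrix.trace, Matrix.diag, Finset.univ_unique, Finset.sum_singleton]
    rfl
  rw [hZ₁, hZ₂, htrace, htrace, hp', hq'] at hmain
  exact hmain

end SymmetricRealization

end HessianOfSymmetricRealization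

/-! ### Existence of minimal symmetric realizations -/

/-- Sylvester's law of inertia for a possibly degenerate Hermitian matrix: `Y` identifies the
nondegenerate quotient of the Hermitian form with the form of a signature matrix. -/
theorem Matrix.IsHermitian.exists_signature {κ : Type} [Fintype κ] [DecidableEq κ]
    {H : Matrix κ κ ℂ} (hH : H.IsHermitian) :
    ∃ (a b : ℕ) (Y : Matrix κ (Fin a ⊕ Fin b) ℂ), Yᴴ * H * Y = signatureMatrix a b ∧
      H * Y * signatureMatrix a b * Yᴴ * H = H := by
  obtain ⟨U, l, hU, -, hHU, -⟩ := hH.exists_diagonalization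
  obtain ⟨a, ⟨e⟩⟩ : ∃ a : ℕ, Nonempty (Fin a ≃ {i // 0 < l i}) :=
    ⟨_, ⟨(Fintype.equivFin _).symm⟩⟩
  obtain ⟨b, ⟨f⟩⟩ : ∃ b : ℕ, Nonempty (Fin b ≃ {i // l i < 0}) :=
    ⟨_, ⟨(Fintype.equivFin _).symm⟩⟩
  obtain ⟨σ, hσ⟩ : ∃ σ : Fin a ⊕ Fin b → κ,
      σ = Sum.elim (fun i => (e i : κ)) (fun i => (f i : κ)) := ⟨_, rfl⟩
  obtain ⟨k, hk⟩ : ∃ k : Fin a ⊕ Fin b → ℝ, k = Sum.elim (fun _ => 1) (fun _ => -1) := ⟨_, rfl⟩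
  have hK : signatureMatrix a b = Matrix.diagonal fun s => (k s : ℂ) := by
    ext s t
    rcases s with s | s <;> rcases t with t | t <;>
      simp [signatureMatrix, hk, Matrix.diagonal_apply, Matrix.one_apply, apply_ite]
  have hinj : Function.Injective σ := by
    rw [hσ]
    rintro (s | s) (t | t) h <;> simp only [Sum.elim_inl, Sum.elim_inr] at h
    · rw [e.injective (Subtype.ext h)]
    · exact absurd (e s).2 (h ▸ (f t).2).not_gt
    · exact absurd (e t).2 (h ▸ (f s).2).not_gt
    · rw [f.injective (Subtype.ext h)]
  have hl : ∀ s, l (σ s) = k s * |l (σ s)| ∧ l (σ s) ≠ 0 := by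
    rw [hσ, hk]
    rintro (s | s)
    · have := (e s).2
      simp [abs_of_pos this, this.ne']
    · have := (f s).2
      simp [abs_of_neg this, this.ne]
  have hsurj : ∀ i, l i ≠ 0 → ∃ s, σ s = i := by
    intro i hi
    rw [hσ]
    rcases hi.lt_or_gt with h | h
    · exact ⟨Sum.inr (f.symm ⟨i, h⟩), by simp⟩
    · exact ⟨Sum.inl (e.symm ⟨i, h⟩), by simp⟩
  -- the eigenvectors for nonzero eigenvalues, normalized
  obtain ⟨d, hd⟩ : ∃ d : Fin a ⊕ Fin b → ℝ, d = fun s => (Real.sqrt |l (σ s)|)⁻¹ := ⟨_, rfl⟩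
  have hdd : ∀ s, d s * d s * |l (σ s)| = 1 := by
    intro s
    have h1 : 0 < |l (σ s)| := abs_pos.2 (hl s).2
    rw [hd]
    simp only
    rw [← mul_inv, Real.mul_self_sqrt h1.le, inv_mul_cancel₀ h1.ne']
  have hkk : ∀ s, k s * k s = 1 := by rw [hk]; rintro (s | s) <;> simp
  obtain ⟨E, hE⟩ : ∃ E : Matrix κ (Fin a ⊕ Fin b) ℂ,
      E = Matrix.of fun i s => if i = σ s then (d s : ℂ) else 0 := ⟨_, rfl⟩
  have hDE : Matrix.diagonal (fun i => (l i : ℂ)) * E =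
      Matrix.of fun i s => if i = σ s then ((l (σ s) * d s : ℝ) : ℂ) else 0 := by
    ext i s
    rw [Matrix.diagonal_mul, hE]
    by_cases h : i = σ s <;> simp [h]
  refine ⟨a, b, U * E, ?_, ?_⟩
  · have h1 : (U * E)ᴴ * H * (U * E) = Eᴴ * (Matrix.diagonal (fun i => (l i : ℂ)) * E) := by
      calc (U * E)ᴴ * H * (U * E)
          = Eᴴ * ((Uᴴ * U) * (Matrix.diagonal (fun i => (l i : ℂ)) * ((Uᴴ * U) * E))) := by
            rw [hHU, Matrix.conjTranspose_mul]
            simp only [Matrix.mul_assoc]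
        _ = _ := by rw [hU, Matrix.one_mul, Matrix.one_mul]
    rw [h1, hDE, hK, hE]
    ext s t
    simp only [Matrix.mul_apply, Matrix.conjTranspose_apply, Matrix.of_apply]
    rw [Finset.sum_eq_single (σ s) (fun i _ hi => by simp [hi]) (by simp)]
    by_cases hst : s = t
    · subst hst
      have h2 : d s * (l (σ s) * d s) = k s := by
        rw [(hl s).1]
        linear_combination k s * hdd s
      simp only [if_true, Matrix.diagonal_apply_eq, ← h2]
      simp
    · rw [Matrix.diagonal_apply_ne _ hst, if_neg fun h => hst (hinj h), mul_zero]
  · have h1 : H * (U * E) * signatureMatrix a b * (U * E)ᴴ * H =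
        U * ((Matrix.diagonal (fun i => (l i : ℂ)) * E) * signatureMatrix a b *
          (Matrix.diagonal (fun i => (l i : ℂ)) * E)ᴴ) * Uᴴ := by
      have hDH : (Matrix.diagonal (fun i => (l i : ℂ)))ᴴ = Matrix.diagonal (fun i => (l i : ℂ)) := by
        rw [Matrix.diagonal_conjTranspose]
        congr 1
        ext i
        simp
      calc H * (U * E) * signatureMatrix a b * (U * E)ᴴ * H
          = U * (Matrix.diagonal (fun i => (l i : ℂ)) * ((Uᴴ * U) * (E * (signatureMatrix a b *
              (Eᴴ * ((Uᴴ * U) * (Matrix.diagonal (fun i => (l i : ℂ)) * Uᴴ))))))) := by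
            rw [hHU, Matrix.conjTranspose_mul]
            simp only [Matrix.mul_assoc]
        _ = _ := by
            rw [hU, Matrix.one_mul, Matrix.one_mul, Matrix.conjTranspose_mul, hDH]
            simp only [Matrix.mul_assoc]
    rw [h1]
    conv_rhs => rw [hHU]
    congr 2
    rw [hDE, hK]
    ext i j
    rw [Matrix.mul_apply]
    simp only [Matrix.mul_diagonal, Matrix.conjTranspose_apply, Matrix.of_apply]
    by_cases hi : l i = 0
    · rw [Finset.sum_eq_zero fun s _ => ?_]
      · by_cases hij : i = j
        · subst hij; simp [hi]
        · rw [Matrix.diagonal_apply_ne _ hij]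
      · have : i ≠ σ s := fun h => (hl s).2 (h ▸ hi)
        simp [this]
    · obtain ⟨s, rfl⟩ := hsurj i hi
      rw [Finset.sum_eq_single s (fun t _ ht => by
        rw [if_neg fun h => ht (hinj h).symm]; simp) (by simp)]
      by_cases hij : σ s = j
      · subst hij
        have h2 : l (σ s) * d s * k s * (l (σ s) * d s) = l (σ s) := by
          have h3 : l (σ s) * l (σ s) = |l (σ s)| * |l (σ s)| := (abs_mul_abs_self _).symm
          have h4 := (hl s).1
          have h5 := hdd s
          calc l (σ s) * d s * k s * (l (σ s) * d s)
              = (l (σ s) * l (σ s)) * (d s * d s) * k s := by ring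
            _ = k s * |l (σ s)| * (d s * d s * |l (σ s)|) := by rw [h3]; ring
            _ = l (σ s) := by rw [h5, mul_one, ← h4]
        rw [Matrix.diagonal_apply_eq]
        conv_rhs => rw [← h2]
        simp
      · rw [Matrix.diagonal_apply_ne _ hij]
        simp [Ne.symm hij]

/-- The restriction of a Hermitian form to a subspace `V`: `S` is a section, with values in `V`, of
the projection `KS*G` of `V` onto its nondegenerate quotient. -/
theorem Matrix.IsHermitian.exists_section {κ : Type} [Fintype κ] [DecidableEq κ]
    {G : Matrix κ κ ℂ} (hG : G.IsHermitian) (V : Submodule ℂ (κ → ℂ)) :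
    ∃ (a b : ℕ) (S : Matrix κ (Fin a ⊕ Fin b) ℂ), (∀ u, S *ᵥ u ∈ V) ∧
      Sᴴ * G * S = signatureMatrix a b ∧ ∀ x ∈ V, ∀ y ∈ V,
        star y ⬝ᵥ (G *ᵥ (x - S *ᵥ (signatureMatrix a b * Sᴴ * G) *ᵥ x)) = 0 := by
  obtain ⟨p, hp⟩ := LinearMap.exists_leftInverse_of_injective V.subtype (Submodule.ker_subtype V)
  obtain ⟨S₀, hS₀⟩ : ∃ S₀ : Matrix κ κ ℂ, S₀ = LinearMap.toMatrix' (V.subtype ∘ₗ p) := ⟨_, rfl⟩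
  have hmul : ∀ x, S₀ *ᵥ x = p x := by
    intro x
    rw [hS₀, LinearMap.toMatrix'_mulVec]
    rfl
  have hmem : ∀ x, S₀ *ᵥ x ∈ V := fun x => hmul x ▸ (p x).2
  have hfix : ∀ x ∈ V, S₀ *ᵥ x = x := by
    intro x hx
    rw [hmul]
    exact congrArg Subtype.val (LinearMap.congr_fun hp ⟨x, hx⟩)
  have hH : (S₀ᴴ * G * S₀).IsHermitian := by
    rw [Matrix.IsHermitian, Matrix.conjTranspose_mul, Matrix.conjTranspose_mul,
      Matrix.conjTranspose_conjTranspose, hG.eq, Matrix.mul_assoc]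
  obtain ⟨a, b, Y, h1, h2⟩ := hH.exists_signature
  refine ⟨a, b, S₀ * Y, fun u => ?_, ?_, fun x hx y hy => ?_⟩
  · rw [← Matrix.mulVec_mulVec]
    exact hmem _
  · rw [← h1, Matrix.conjTranspose_mul]
    simp only [Matrix.mul_assoc]
  · have h3 : S₀ᴴ * (G * S₀ - G * (S₀ * Y * (signatureMatrix a b * (S₀ * Y)ᴴ * G)) * S₀) = 0 := by
      rw [Matrix.mul_sub, sub_eq_zero, ← Matrix.mul_assoc S₀ᴴ G S₀]
      conv_lhs => rw [← h2]
      rw [Matrix.conjTranspose_mul]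
      simp only [Matrix.mul_assoc]
    have h4 : star y ⬝ᵥ (G *ᵥ (x - (S₀ * Y) *ᵥ (signatureMatrix a b * (S₀ * Y)ᴴ * G) *ᵥ x)) =
        star y ⬝ᵥ ((S₀ᴴ * (G * S₀ - G * (S₀ * Y * (signatureMatrix a b * (S₀ * Y)ᴴ * G)) * S₀)) *ᵥ
          x) := by
      conv_lhs => rw [← hfix y hy, ← hfix x hx]
      rw [← Matrix.mulVec_mulVec x S₀ᴴ, Matrix.dotProduct_mulVec _ S₀ᴴ, Matrix.vecMul_conjTranspose,
        star_star, Matrix.sub_mulVec, Matrix.mulVec_sub]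
      simp only [Matrix.mulVec_mulVec, Matrix.mul_assoc]
    rw [h4, h3, Matrix.zero_mulVec, dotProduct_zero]

/-- A Hermitian linear system, given by a Hermitian form `G` and coefficients `T, T'` adjoint to each
other for `G`, has a minimal symmetric realization: restrict it to the span `V` of the vectors
reachable from `w`, and divide by the radical of the form. -/
theorem SymmetricRealization.exists_isMinimal {κ : Type} [Fintype κ] [DecidableEq κ] {g : ℕ}
    {G : Matrix κ κ ℂ} (hG : G.IsHermitian) {T T' : Fin g → Matrix κ κ ℂ}
    (hT : ∀ j, G * T j = (T' j)ᴴ * G) (w : κ → ℂ) :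
    ∃ m : SymmetricRealization g, m.IsMinimal ∧ ∀ (n : ℕ) (X : MatTuple g n) (v : Fin n → ℂ),
      (∀ Z, stateOp T T' X Z = 0 → Z = 0) → ∃ (Z : Matrix (Fin n) κ ℂ)
        (Z' : Matrix (Fin n) (Fin m.a ⊕ Fin m.b) ℂ), stateOp T T' X Z = Matrix.vecMulVec v w ∧
        stateOp m.T m.T' X Z' = Matrix.vecMulVec v m.c ∧
        ∀ k, star m.c ⬝ᵥ (m.K *ᵥ Z' k) = star w ⬝ᵥ (G *ᵥ Z k) := by
  have hT' : ∀ j, G * T' j = (T j)ᴴ * G := by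
    intro j
    have h := congrArg Matrix.conjTranspose (hT j)
    rw [Matrix.conjTranspose_mul, Matrix.conjTranspose_mul, Matrix.conjTranspose_conjTranspose,
      hG.eq] at h
    exact h.symm
  obtain ⟨V, hV⟩ : ∃ V : Submodule ℂ (κ → ℂ), V = Submodule.span ℂ (Set.range
      fun u : List (Fin g ⊕ Fin g) => (u.map (Sum.elim T T')).prod *ᵥ w) := ⟨_, rfl⟩
  have hwV : w ∈ V := by
    rw [hV]
    exact Submodule.subset_span ⟨[], by simp⟩
  have hinvV : ∀ (s : Fin g ⊕ Fin g), ∀ x ∈ V, Sum.elim T T' s *ᵥ x ∈ V := by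
    intro s x hx
    rw [hV] at hx ⊢
    induction hx using Submodule.span_induction with
    | mem x hx =>
      obtain ⟨u, rfl⟩ := hx
      refine Submodule.subset_span ⟨s :: u, ?_⟩
      simp only [List.map_cons, List.prod_cons, Matrix.mulVec_mulVec]
    | zero => rw [Matrix.mulVec_zero]; exact zero_mem _
    | add x y _ _ hx hy => rw [Matrix.mulVec_add]; exact add_mem hx hy
    | smul z x _ hx => rw [Matrix.mulVec_smul]; exact Submodule.smul_mem _ _ hx
  obtain ⟨a, b, S, hSV, hS, hrad⟩ := hG.exists_section V
  obtain ⟨K, hK⟩ : ∃ K, K = signatureMatrix a b := ⟨_, rfl⟩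
  have hKK : K * K = 1 := hK ▸ signatureMatrix_mul_self a b
  have hKH : Kᴴ = K := by
    rw [hK]
    simp [signatureMatrix, Matrix.fromBlocks_conjTranspose]
  rw [← hK] at hS hrad
  obtain ⟨p, hp⟩ : ∃ p : Matrix (Fin a ⊕ Fin b) κ ℂ, p = K * Sᴴ * G := ⟨_, rfl⟩
  rw [← hp] at hrad
  have hpS : p * S = 1 := by
    rw [hp, Matrix.mul_assoc, Matrix.mul_assoc, ← Matrix.mul_assoc Sᴴ, hS, hKK]
  -- `p` intertwines the coefficients on `V` with their compressions
  have hinter : ∀ (s : Fin g ⊕ Fin g), ∀ x ∈ V,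
      (p * Sum.elim T T' s * S) *ᵥ (p *ᵥ x) = p *ᵥ (Sum.elim T T' s *ᵥ x) := by
    intro s x hx
    have h1 : ∀ u, star u ⬝ᵥ (Sᴴ *ᵥ (G *ᵥ (Sum.elim T T' s *ᵥ (x - S *ᵥ (p *ᵥ x))))) = 0 := by
      intro u
      have h2 : G * Sum.elim T T' s = (Sum.elim T' T s)ᴴ * G := by
        rcases s with j | j
        · exact hT j
        · exact hT' j
      have h3 : Sum.elim T' T s *ᵥ (S *ᵥ u) ∈ V := by
        rcases s with j | j
        · exact hinvV (Sum.inr j) _ (hSV u)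
        · exact hinvV (Sum.inl j) _ (hSV u)
      rw [← hrad x hx _ h3, Matrix.mulVec_mulVec _ G, h2, ← Matrix.mulVec_mulVec,
        Matrix.dotProduct_mulVec, Matrix.vecMul_conjTranspose, star_star,
        Matrix.dotProduct_mulVec, Matrix.vecMul_conjTranspose, star_star]
    have h4 := dotProduct_star_self_eq_zero.1 (h1 _)
    have h5 : p *ᵥ (Sum.elim T T' s *ᵥ (x - S *ᵥ (p *ᵥ x))) = 0 := by
      rw [hp, ← Matrix.mulVec_mulVec, ← Matrix.mulVec_mulVec, ← hp, h4, Matrix.mulVec_zero]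
    rw [Matrix.mulVec_sub, Matrix.mulVec_sub, sub_eq_zero] at h5
    rw [h5, ← Matrix.mulVec_mulVec, ← Matrix.mulVec_mulVec]
  have hform : ∀ x ∈ V, ∀ y ∈ V, star (p *ᵥ y) ⬝ᵥ (K *ᵥ (p *ᵥ x)) = star y ⬝ᵥ (G *ᵥ x) := by
    intro x hx y hy
    have h1 := hrad x hx y hy
    rw [Matrix.mulVec_sub, dotProduct_sub, sub_eq_zero] at h1
    rw [h1, Matrix.star_mulVec, ← Matrix.dotProduct_mulVec]
    congr 1
    have hpH : pᴴ * K = G * S := by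
      rw [hp, Matrix.conjTranspose_mul, Matrix.conjTranspose_mul, hG.eq, hKH,
        Matrix.conjTranspose_conjTranspose, Matrix.mul_assoc, Matrix.mul_assoc, hKK, Matrix.mul_one]
    rw [Matrix.mulVec_mulVec _ pᴴ, hpH, Matrix.mulVec_mulVec _ G]
  let m : SymmetricRealization g := ⟨a, b, fun j => p * T j * S * K, p *ᵥ w⟩
  have hmK : m.K = K := hK.symm
  have hmT : ∀ j, m.T j = p * T j * S := by
    intro j
    rw [SymmetricRealization.T, hmK]
    change p * T j * S * K * K = _
    rw [Matrix.mul_assoc, hKK, Matrix.mul_one]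
  have hmT' : ∀ j, m.T' j = p * T' j * S := by
    intro j
    rw [SymmetricRealization.T', hmK]
    change (p * T j * S * K)ᴴ * K = _
    have h1 : (p * T j * S * K)ᴴ * K = K * Sᴴ * ((T j)ᴴ * G) * S * (K * K) := by
      rw [hp]
      simp only [Matrix.conjTranspose_mul, hG.eq, hKH, Matrix.conjTranspose_conjTranspose,
        Matrix.mul_assoc]
    rw [h1, hKK, Matrix.mul_one, ← hT' j, hp]
    simp only [Matrix.mul_assoc]
  have hletter : ∀ s : Fin g ⊕ Fin g,
      Sum.elim (fun j => m.B j * m.K) (fun j => (m.B j)ᴴ * m.K) s = p * Sum.elim T T' s * S := by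
    rintro (j | j)
    · exact hmT j
    · exact hmT' j
  refine ⟨m, ?_, fun n X v hinj => ?_⟩
  · have hword : ∀ u : List (Fin g ⊕ Fin g),
        (u.map (Sum.elim T T')).prod *ᵥ w ∈ V ∧
        (u.map (Sum.elim (fun j => m.B j * m.K) (fun j => (m.B j)ᴴ * m.K))).prod *ᵥ m.c =
          p *ᵥ ((u.map (Sum.elim T T')).prod *ᵥ w) := by
      intro u
      induction u with
      | nil =>
        simp only [List.map_nil, List.prod_nil, Matrix.one_mulVec]
        exact ⟨hwV, rfl⟩
      | cons s u ih =>
        simp only [List.map_cons, List.prod_cons, ← Matrix.mulVec_mulVec]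
        refine ⟨hinvV s _ ih.1, ?_⟩
        rw [ih.2, hletter]
        exact hinter s _ ih.1
    have hmap : Submodule.span ℂ (Set.range fun u : List (Fin g ⊕ Fin g) =>
        (u.map (Sum.elim (fun j => m.B j * m.K) (fun j => (m.B j)ᴴ * m.K))).prod *ᵥ m.c) =
        V.map p.mulVecLin := by
      rw [hV, Submodule.map_span, ← Set.range_comp]
      congr 2
      ext1 u
      exact (hword u).2
    refine hmap.trans (eq_top_iff.2 fun u _ => ⟨S *ᵥ u, hSV u, ?_⟩)
    rw [Matrix.mulVecLin_apply, Matrix.mulVec_mulVec, hpS, Matrix.one_mulVec]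
  · -- the states with slices in `V` form an invariant subspace, on which `stateOp` is bijective
    let W : Submodule ℂ (Matrix (Fin n) κ ℂ) :=
      { carrier := {Z | ∀ k, Z k ∈ V}
        add_mem' := fun h1 h2 k => add_mem (h1 k) (h2 k)
        zero_mem' := fun k => zero_mem V
        smul_mem' := fun z Z h k => Submodule.smul_mem V z (h k) }
    let L : Matrix (Fin n) κ ℂ →ₗ[ℂ] Matrix (Fin n) κ ℂ :=
      { toFun := stateOp T T' X
        map_add' := fun Z Z' => by
          simp only [stateOp, Matrix.mul_add, Matrix.add_mul, Finset.sum_add_distrib]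
          abel
        map_smul' := fun z Z => by
          simp only [stateOp, Matrix.mul_smul, Matrix.smul_mul, ← Finset.smul_sum, ← smul_sub,
            RingHom.id_apply] }
    have hterm : ∀ (s : Fin g ⊕ Fin g) (Y : Matrix (Fin n) (Fin n) ℂ), ∀ Z ∈ W,
        Y * Z * (Sum.elim T T' s)ᵀ ∈ W := by
      intro s Y Z hZ k
      have h1 : (Y * Z * (Sum.elim T T' s)ᵀ) k = Sum.elim T T' s *ᵥ ∑ l, Y k l • Z l := by
        rw [← Matrix.vecMul_transpose]
        ext i
        simp [Matrix.mul_apply, Matrix.vecMul, dotProduct]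
      rw [h1]
      exact hinvV s _ (sum_mem fun l _ => Submodule.smul_mem _ _ (hZ l))
    have hLW : ∀ Z ∈ W, L Z ∈ W := by
      intro Z hZ
      refine sub_mem (sub_mem hZ (sum_mem fun j _ => ?_)) (sum_mem fun j _ => ?_)
      · exact hterm (Sum.inl j) _ Z hZ
      · exact hterm (Sum.inr j) _ Z hZ
    have hLinj : Function.Injective (L.restrict hLW) := by
      rw [← LinearMap.ker_eq_bot, LinearMap.ker_eq_bot']
      intro Z hZ
      exact Subtype.ext (hinj _ (congrArg Subtype.val hZ))
    obtain ⟨⟨Z, hZW⟩, hZ⟩ := LinearMap.injective_iff_surjective.1 hLinj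
      ⟨Matrix.vecMulVec v w, fun k => Submodule.smul_mem V (v k) hwV⟩
    have hZ' : stateOp T T' X Z = Matrix.vecMulVec v w := congrArg Subtype.val hZ
    have hrow : ∀ k, (Z * pᵀ) k = p *ᵥ Z k := by
      intro k
      rw [← Matrix.vecMul_transpose]
      rfl
    have hcomp : ∀ s : Fin g ⊕ Fin g,
        Z * pᵀ * (p * Sum.elim T T' s * S)ᵀ = Z * (Sum.elim T T' s)ᵀ * pᵀ := by
      intro s
      ext k i
      have h1 := congrFun (hinter s (Z k) (hZW k)) i
      rw [← hrow, ← Matrix.vecMul_transpose, ← Matrix.vecMul_transpose,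
        ← Matrix.vecMul_transpose] at h1
      exact h1
    refine ⟨Z, Z * pᵀ, hZ', ?_, fun k => ?_⟩
    · have h1 : stateOp m.T m.T' X (Z * pᵀ) = stateOp T T' X Z * pᵀ := by
        have e1 : ∀ j, X j * (Z * pᵀ) * (m.T j)ᵀ = X j * Z * (T j)ᵀ * pᵀ := by
          intro j
          have := hcomp (Sum.inl j)
          rw [Sum.elim_inl] at this
          rw [hmT, Matrix.mul_assoc, this]
          simp only [Matrix.mul_assoc]
        have e2 : ∀ j, (X j)ᴴ * (Z * pᵀ) * (m.T' j)ᵀ = (X j)ᴴ * Z * (T' j)ᵀ * pᵀ := by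
          intro j
          have := hcomp (Sum.inr j)
          rw [Sum.elim_inr] at this
          rw [hmT', Matrix.mul_assoc, this]
          simp only [Matrix.mul_assoc]
        rw [stateOp, Finset.sum_congr rfl fun j _ => e1 j, Finset.sum_congr rfl fun j _ => e2 j,
          stateOp, Matrix.sub_mul, Matrix.sub_mul, Matrix.sum_mul, Matrix.sum_mul]
      rw [h1, hZ', Matrix.vecMulVec_mul, Matrix.vecMul_transpose]
    · rw [hmK, hrow]
      exact hform _ (hZW k) _ hwV

/-- The states of a direct sum of two systems. -/
theorem stateOp_fromBlocks {g : ℕ} {ι κ N : Type} [Fintype ι] [Fintype κ] [Fintype N]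
    (T T' : Fin g → Matrix ι ι ℂ) (S S' : Fin g → Matrix κ κ ℂ) (X : Fin g → Matrix N N ℂ)
    (Z : Matrix N ι ℂ) (Y : Matrix N κ ℂ) :
    stateOp (fun j => Matrix.fromBlocks (T j) 0 0 (S j))
      (fun j => Matrix.fromBlocks (T' j) 0 0 (S' j)) X (Matrix.fromCols Z Y) =
      Matrix.fromCols (stateOp T T' X Z) (stateOp S S' X Y) := by
  have hsum : ∀ (F : Fin g → Matrix N ι ℂ) (G : Fin g → Matrix N κ ℂ),
      ∑ j, Matrix.fromCols (F j) (G j) = Matrix.fromCols (∑ j, F j) (∑ j, G j) := by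
    intro F G
    ext i k
    rcases k with k | k <;> simp [Matrix.sum_apply]
  simp only [stateOp, Matrix.mul_fromCols, Matrix.fromBlocks_transpose, Matrix.transpose_zero,
    Matrix.fromCols_mul_fromBlocks, Matrix.mul_zero, add_zero, zero_add, hsum]
  ext i k
  rcases k with k | k <;> simp

namespace DescriptorRealization

variable {g n : ℕ}

/-- The values of `r`, read off from states. -/
theorem eval_mulVec (r : DescriptorRealization g) {X : MatTuple g n} (hX : X ∈ r.dom n)
    {v : Fin n → ℂ} {Z : Matrix (Fin n) r.ι ℂ}
    (hZ : stateOp (fun j => r.A j * r.J⁻¹) (fun j => r.B j * r.J⁻¹) X Z =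
      Matrix.vecMulVec v r.b) :
    r.eval X *ᵥ v = fun k => star r.c ⬝ᵥ (r.J⁻¹ *ᵥ Z k) := by
  have hinv : (r.pencil X X.adj)⁻¹ * r.pencil X X.adj = 1 :=
    Matrix.nonsing_inv_mul _ ((Matrix.isUnit_iff_isUnit_det _).1 hX)
  rw [eval, evalPair, ← Matrix.mulVec_mulVec, colTensor_mulVec, ← hZ, ← pencil_mulVec_vec,
    ← Matrix.mulVec_mulVec, Matrix.mulVec_mulVec _ _ (r.pencil X X.adj), hinv, Matrix.one_mulVec]
  ext k
  have h1 : (Z * (r.J⁻¹)ᵀ) k = r.J⁻¹ *ᵥ Z k := by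
    rw [← Matrix.vecMul_transpose]
    rfl
  rw [← h1]
  simp only [colTensor, Matrix.mulVec, dotProduct, Fintype.sum_prod_type, Matrix.vec,
    Matrix.conjTranspose_apply, Matrix.of_apply]
  refine Finset.sum_congr rfl fun i _ => ?_
  rw [Finset.sum_eq_single k (fun l _ hl => by simp [Matrix.one_apply_ne hl]) (by simp)]
  simp

theorem eq_zero_of_stateOp_eq_zero (r : DescriptorRealization g) {X : MatTuple g n}
    (hX : X ∈ r.dom n) {Z : Matrix (Fin n) r.ι ℂ}
    (hZ : stateOp (fun j => r.A j * r.J⁻¹) (fun j => r.B j * r.J⁻¹) X Z = 0) : Z = 0 := by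
  have hinv : (r.pencil X X.adj)⁻¹ * r.pencil X X.adj = 1 :=
    Matrix.nonsing_inv_mul _ ((Matrix.isUnit_iff_isUnit_det _).1 hX)
  have h := r.pencil_mulVec_vec X Z
  rw [hZ, Matrix.vec_zero] at h
  have h1 : (Z * (r.J⁻¹)ᵀ).vec = 0 := by
    rw [← Matrix.one_mulVec (Z * (r.J⁻¹)ᵀ).vec, ← hinv, ← Matrix.mulVec_mulVec, h,
      Matrix.mulVec_zero]
  have h2 : (r.J⁻¹)ᵀ * (r.J)ᵀ = 1 := by
    rw [← Matrix.transpose_mul, Matrix.mul_nonsing_inv _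
      ((Matrix.isUnit_iff_isUnit_det _).1 r.isUnit_J), Matrix.transpose_one]
  rw [← Matrix.mul_one Z, ← h2, ← Matrix.mul_assoc, Matrix.vec_eq_zero_iff.1 h1, Matrix.zero_mul]

/-- The adjoint function `r*`, with values `r(X, X*)*`. -/
noncomputable def adjoint (r : DescriptorRealization g) : DescriptorRealization g where
  ι := r.ι
  J := r.Jᴴ
  A := fun j => (r.B j)ᴴ
  B := fun j => (r.A j)ᴴ
  b := r.c
  c := r.b
  isUnit_J := by
    rw [Matrix.isUnit_iff_isUnit_det, Matrix.det_conjTranspose]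
    exact ((Matrix.isUnit_iff_isUnit_det _).1 r.isUnit_J).star

theorem pencil_adjoint (r : DescriptorRealization g) (X : MatTuple g n) :
    r.adjoint.pencil X X.adj = (r.pencil X X.adj)ᴴ := by
  simp only [pencil, adjoint, MatTuple.adj, Matrix.conjTranspose_sub, Matrix.conjTranspose_sum,
    Matrix.conjTranspose_kronecker, Matrix.conjTranspose_one, Matrix.conjTranspose_conjTranspose]
  exact sub_right_comm _ _ _

theorem mem_dom_adjoint {r : DescriptorRealization g} {X : MatTuple g n} (hX : X ∈ r.dom n) :
    X ∈ r.adjoint.dom n := by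
  have h : IsUnit (r.pencil X X.adj)ᴴ := by
    rw [Matrix.isUnit_iff_isUnit_det, Matrix.det_conjTranspose]
    exact ((Matrix.isUnit_iff_isUnit_det _).1 hX).star
  rw [← r.pencil_adjoint X] at h
  exact h

theorem eval_adjoint (r : DescriptorRealization g) (X : MatTuple g n) :
    r.adjoint.eval X = (r.eval X)ᴴ := by
  have h : r.adjoint.eval X =
      (colTensor r.b n)ᴴ * ((r.pencil X X.adj)ᴴ)⁻¹ * colTensor r.c n := by
    rw [← r.pencil_adjoint X]
    rfl
  rw [h, ← Matrix.conjTranspose_nonsing_inv, eval, evalPair, Matrix.conjTranspose_mul,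
    Matrix.conjTranspose_mul, Matrix.conjTranspose_conjTranspose, ← Matrix.mul_assoc]

/-- A symmetric nc rational function has a minimal symmetric realization. The function
`(r + r*)/2 = r` has the Hermitian realization with pencil `[0, L*; L, 0]`, where `L` is the pencil
of `r`, and vector `(c, b)/√2`; this is then cut down to a minimal one. -/
theorem IsSymmetric.exists_isMinimal {r : DescriptorRealization g} (hr : r.IsSymmetric) :
    ∃ m : SymmetricRealization g, m.IsMinimal ∧ r.Equivalent m.toDescriptor := by
  obtain ⟨lam, hlam⟩ : ∃ lam : ℂ, star lam * lam = 1 / 2 ∧ star lam = lam := by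
    refine ⟨((Real.sqrt (1 / 2) : ℝ) : ℂ), ?_, Complex.conj_ofReal _⟩
    rw [Complex.star_def, Complex.conj_ofReal, ← Complex.ofReal_mul,
      Real.mul_self_sqrt (by norm_num)]
    norm_num
  let G : Matrix (r.ι ⊕ r.ι) (r.ι ⊕ r.ι) ℂ := Matrix.fromBlocks 0 r.J⁻¹ (r.Jᴴ)⁻¹ 0
  let T : Fin g → Matrix (r.ι ⊕ r.ι) (r.ι ⊕ r.ι) ℂ := fun j =>
    Matrix.fromBlocks ((r.B j)ᴴ * (r.Jᴴ)⁻¹) 0 0 (r.A j * r.J⁻¹)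
  let T' : Fin g → Matrix (r.ι ⊕ r.ι) (r.ι ⊕ r.ι) ℂ := fun j =>
    Matrix.fromBlocks ((r.A j)ᴴ * (r.Jᴴ)⁻¹) 0 0 (r.B j * r.J⁻¹)
  have hG : G.IsHermitian := by
    simp only [G, Matrix.IsHermitian, Matrix.fromBlocks_conjTranspose, Matrix.conjTranspose_zero,
      Matrix.conjTranspose_nonsing_inv, Matrix.conjTranspose_conjTranspose]
  have hT : ∀ j, G * T j = (T' j)ᴴ * G := by
    intro j
    simp only [G, T, T', Matrix.fromBlocks_conjTranspose, Matrix.fromBlocks_multiply,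
      Matrix.conjTranspose_zero, Matrix.conjTranspose_mul, Matrix.conjTranspose_nonsing_inv,
      Matrix.conjTranspose_conjTranspose, Matrix.zero_mul, Matrix.mul_zero, add_zero, zero_add,
      Matrix.mul_assoc]
  obtain ⟨m, hm, hmr⟩ := SymmetricRealization.exists_isMinimal hG hT
    (Sum.elim (lam • r.c) (lam • r.b))
  refine ⟨m, hm, fun n X hXr hXm => ?_⟩
  have hinj : ∀ Z, stateOp T T' X Z = 0 → Z = 0 := by
    intro Z hZ
    rw [← Matrix.fromCols_toCols Z, stateOp_fromBlocks, ← Matrix.fromCols_zero] at hZ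
    obtain ⟨h1, h2⟩ := Matrix.fromCols_inj.eq_iff.1 hZ
    have z1 : Z.toCols₁ = 0 := r.adjoint.eq_zero_of_stateOp_eq_zero (mem_dom_adjoint hXr) h1
    have z2 : Z.toCols₂ = 0 := r.eq_zero_of_stateOp_eq_zero hXr h2
    rw [← Matrix.fromCols_toCols Z, z1, z2, Matrix.fromCols_zero]
  have hvec : ∀ v, r.eval X *ᵥ v = m.toDescriptor.eval X *ᵥ v := by
    intro v
    obtain ⟨Z, Z', hZ, hZ', hval⟩ := hmr n X v hinj
    have hmeval : m.toDescriptor.eval X *ᵥ v = fun k => star m.c ⬝ᵥ (m.K *ᵥ Z' k) := by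
      have h1 := m.toDescriptor.eval_mulVec hXm (v := v) (Z := Z') (by
        change stateOp (fun j => m.B j * m.K⁻¹) (fun j => (m.B j)ᴴ * m.K⁻¹) X Z' = _
        rw [m.inv_K]
        exact hZ')
      rw [h1]
      ext k
      change star m.c ⬝ᵥ (m.K⁻¹ *ᵥ Z' k) = _
      rw [m.inv_K]
    obtain ⟨Z₁, Z₂, rfl⟩ : ∃ Z₁ Z₂, Z = Matrix.fromCols Z₁ Z₂ :=
      ⟨_, _, (Matrix.fromCols_toCols Z).symm⟩
    have hw : Matrix.vecMulVec v (Sum.elim (lam • r.c) (lam • r.b)) =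
        Matrix.fromCols (Matrix.vecMulVec (lam • v) r.c) (Matrix.vecMulVec (lam • v) r.b) := by
      ext i k
      rcases k with k | k <;> simp [Matrix.vecMulVec_apply] <;> ring
    rw [stateOp_fromBlocks, hw] at hZ
    obtain ⟨h1, h2⟩ := Matrix.fromCols_inj.eq_iff.1 hZ
    have e1 := r.adjoint.eval_mulVec (mem_dom_adjoint hXr) (v := lam • v) (Z := Z₁) h1
    have e2 := r.eval_mulVec hXr (v := lam • v) (Z := Z₂) h2
    rw [eval_adjoint, hr n X hXr, Matrix.mulVec_smul] at e1
    rw [Matrix.mulVec_smul] at e2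
    rw [hmeval]
    ext k
    rw [hval]
    have f1 : lam * (r.eval X *ᵥ v) k = star r.b ⬝ᵥ ((r.Jᴴ)⁻¹ *ᵥ Z₁ k) := congrFun e1 k
    have f2 : lam * (r.eval X *ᵥ v) k = star r.c ⬝ᵥ (r.J⁻¹ *ᵥ Z₂ k) := congrFun e2 k
    have e3 : (Matrix.fromCols Z₁ Z₂ : Matrix (Fin n) (r.ι ⊕ r.ι) ℂ) k = Sum.elim (Z₁ k) (Z₂ k) := by
      ext i
      rcases i with i | i <;> rfl
    have e4 : star (Sum.elim (lam • r.c) (lam • r.b)) =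
        Sum.elim (star lam • star r.c) (star lam • star r.b) := by
      ext i
      rcases i with i | i <;> simp
    rw [e3, e4]
    simp only [G, Matrix.fromBlocks_mulVec, Matrix.zero_mulVec, zero_add, add_zero,
      Sum.elim_comp_inl, Sum.elim_comp_inr, sumElim_dotProduct_sumElim, smul_dotProduct,
      smul_eq_mul]
    rw [← f1, ← f2]
    linear_combination (-2 * (r.eval X *ᵥ v) k) * hlam.1
  ext k l
  have h := congrFun (hvec (Pi.single l 1)) k
  simpa using h

end DescriptorRealization

/-! ### The factorization theorem -/

namespace SymmetricRealization

/-- The choices in the construction exist for every minimal realization of a plush function. -/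
theorem nonempty_constructionData_of_isPlushNearZero {g : ℕ} {m : SymmetricRealization g}
    (hm : m.IsMinimal) {r : DescriptorRealization g} (hr : r.IsPlushNearZero)
    (h : r.Equivalent m.toDescriptor) : Nonempty (ConstructionData m) := by
  refine m.nonempty_constructionData (fun x => ?_) (fun x => ?_)
  · simpa using m.nonneg_of_isPlushNearZero hm hr h x 0
  · simpa using m.nonneg_of_isPlushNearZero hm hr h 0 x

end SymmetricRealization

namespace DescriptorRealization

/-- A composite with no intermediate variables is also a composite with one, which is mapped to
`0` and does not occur in `f`. -/
theorem IsConvexAnalyticComposite.exists_pos {g h : ℕ} {r : DescriptorRealization g}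
    {f : DescriptorRealization h} {q : Fin h → DescriptorRealization g}
    (H : r.IsConvexAnalyticComposite f q) :
    ∃ h : ℕ, 0 < h ∧ ∃ (f : DescriptorRealization h) (q : Fin h → DescriptorRealization g),
      r.IsConvexAnalyticComposite f q := by
  rcases Nat.eq_zero_or_pos h with rfl | hpos
  swap
  · exact ⟨h, hpos, f, q, H⟩
  let f' : DescriptorRealization 1 :=
    { ι := f.ι, J := f.J, A := fun _ => 0, B := fun _ => 0, b := f.b, c := f.c,
      isUnit_J := f.isUnit_J }
  let q' : Fin 1 → DescriptorRealization g := fun _ =>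
    { ι := Unit, J := 1, A := fun _ => 0, B := fun _ => 0, b := 0, c := 0, isUnit_J := isUnit_one }
  have hpencil : ∀ (n : ℕ) (Y : MatTuple 1 n) (Y' : MatTuple 0 n),
      f'.pencil Y Y.adj = f.pencil Y' Y'.adj := by
    intro n Y Y'
    simp [pencil, f']
  have heval : ∀ (n : ℕ) (Y : MatTuple 1 n) (Y' : MatTuple 0 n), f'.eval Y = f.eval Y' := by
    intro n Y Y'
    simp only [eval, evalPair, hpencil n Y Y']
    rfl
  have hdom : ∀ (n : ℕ) (Y : MatTuple 1 n) (Y' : MatTuple 0 n), Y ∈ f'.dom n → Y' ∈ f.dom n := by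
    intro n Y Y' hY
    change IsUnit (f.pencil Y' Y'.adj)
    rw [← hpencil n Y Y']
    exact hY
  have hdom' : ∀ (n : ℕ) (Y : MatTuple 1 n) (Y' : MatTuple 0 n), Y' ∈ f.dom n → Y ∈ f'.dom n := by
    intro n Y Y' hY
    change IsUnit (f'.pencil Y Y.adj)
    rw [hpencil n Y Y']
    exact hY
  have hq' : ∀ (n : ℕ) (X : MatTuple g n), evalMap q' X = 0 := by
    intro n X
    ext s k l
    simp [evalMap, eval, evalPair, q', colTensor, Matrix.mul_apply]
  refine ⟨1, one_pos, f', q', ?_, ?_, fun s j => rfl, fun n => hq' n 0, ?_⟩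
  · intro n Y hY
    rw [heval n Y 0]
    exact H.symmetric n 0 (hdom n Y 0 hY)
  · obtain ⟨ε, hε, hconv⟩ := H.convex
    have hball : ∀ n : ℕ, (0 : MatTuple 0 n) ∈ freeBall 0 ε n := by
      intro n
      have hε' : (0 : ℂ) < (ε : ℂ) ^ 2 := by exact_mod_cast pow_pos hε 2
      simpa [freeBall] using
        (Matrix.PosDef.one (n := Fin n) (R := ℂ)).smul hε'
    refine ⟨ε, hε, fun n => ⟨fun Y _ => hdom' n Y 0 ((hconv n).1 (hball n)), fun Y _ Y' _ => ?_⟩⟩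
    have h1 := (hconv n).2 0 (hball n) 0 (hball n)
    rw [heval n Y 0, heval n Y' 0, heval n _ ((1 / 2 : ℂ) • (0 + 0))]
    exact h1
  · intro n X hX _ hf
    rw [heval n _ (evalMap q X)]
    exact H.comp n X hX (fun s => s.elim0) (hdom n _ _ hf)

end DescriptorRealization

theorem theorem1p1 (g : ℕ) (r : DescriptorRealization g) (hr : r.IsSymmetric) :
    (r.IsPlushNearZero ↔
      ∃ h : ℕ, 0 < h ∧ ∃ (f : DescriptorRealization h) (q : Fin h → DescriptorRealization g),
        r.IsConvexAnalyticComposite f q) ∧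
    (r.IsPlushNearZero →
      (∃ m : SymmetricRealization g, m.IsMinimal ∧ r.Equivalent m.toDescriptor) ∧
      ∀ m : SymmetricRealization g, m.IsMinimal → r.Equivalent m.toDescriptor →
        Nonempty (ConstructionData m) ∧
        ∀ δ : ConstructionData m, r.IsConvexAnalyticComposite δ.f δ.q) := by
  refine ⟨⟨fun hplush => ?_, fun ⟨h, _, f, q, H⟩ => H.isPlushNearZero⟩, fun hplush =>
    ⟨hr.exists_isMinimal, fun m hm hrm =>
      ⟨SymmetricRealization.nonempty_constructionData_of_isPlushNearZero hm hplush hrm,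
        fun δ => δ.isConvexAnalyticComposite hrm⟩⟩⟩
  obtain ⟨m, hm, hrm⟩ := hr.exists_isMinimal
  obtain ⟨δ⟩ := SymmetricRealization.nonempty_constructionData_of_isPlushNearZero hm hplush hrm
  exact (δ.isConvexAnalyticComposite hrm).exists_pos
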